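/- Let $n \geq 3$ be odd, let $f_0 \in \mathbb{Z}$ be odd, let $k$ be the squarefree part of $f_0$ (so $k$ is squarefree and $f_0/k$ is a perfect square), and let $r_1, r_2 \geq 0$ be integers with $r_1 + 2r_2 = n$. Let $\mathcal{F}$ be the set of separable binary forms $F(x,z) = \sum_{i=0}^n f_i x^{n-i}z^i \in \mathbb{Z}[x,z]$ with leading coefficient $f_0$ that are primitive ($\gcd(f_0, \dots, f_n) = 1$) and split over $\mathbb{R}$ into $r_1$ linear and $r_2$ irreducible quadratic factors. For a form $F$ of degree $n$ with nonzero leading coefficient over $R = \mathbb{Z}$ or $\mathbb{Z}_p$, separable over $K = \operatorname{Frac}(R)$, put $K_F = K[x]/(F(x,1))$, let $\theta$ be the image of $x$, let $\zeta_i = \sum_{j=0}^{i-1} f_j\theta^{i-j}$, and let $R_F = R\langle 1, \zeta_1, \dots, \zeta_{n-1}\rangle \subset K_F$, which is a ring. We call $F$ maximal over $R$ if it is separable and primitive and $R_F$ is the maximal order (the integral closure of $R$) in $K_F$. For $R = \mathbb{Z}$, let $\mathrm{Cl}(R_F)$ be the group of invertible fractional ideals of $R_F$ in $K_F$ modulo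 principal ideals; the inverse different of $R_F$ is $\{x \in K_F : \mathrm{Tr}_{K_F/\mathbb{Q}}(xR_F) \subset \mathbb{Z}\}$. For a prime $p \mid k$, call $F$ squareful over $\mathbb{Z}_p$ if $F \equiv \kappa\, z^{e} H^2 \pmod p$ for some $\kappa \in (\mathbb{Z}/p\mathbb{Z})^\times$, some $e > 0$, and some monic form $H \in (\mathbb{Z}/p\mathbb{Z})[x,z]$ (so $z \nmid H$). (a) If $F \in \mathcal{F}$ is maximal over $\mathbb{Z}_p$ for every prime $p \mid f_0$ and squareful over $\mathbb{Z}_p$ for every prime $p \mid k$, then the inverse different of $R_F$ is invertible and its class is a square in $\mathrm{Cl}(R_F)$ (whether or not $R_F$ is maximal). (b) Let $\mathbb{Z}$ act on $\mathcal{F}$ by $F(x,z) \mapsto F(x+sz,z)$, and define the height of $F$ by $H(F) = \max_{2\leq i\leq n}|\widetilde f_i|^{1/i}$, where $x^n + \sum_{i=2}^n \widetilde f_i x^{n-i}z^i$ is the unique translate of the form $\frac{1}{f_0}F(x, f_0z)$ under $x \mapsto x+sz$, $s \in \mathbb{R}$, whose $x^{n-1}z$-coefficient is $0$. For all sufficiently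 large $X$ the set of $\mathbb{Z}$-orbits on $\mathcal{F}$ of height less than $X$ is finite and nonempty, and a positive proportion of the forms in $\mathcal{F}$, counted up to this action and ordered by height, are such that $R_F$ is non-maximal and the class of the inverse different is a square in $\mathrm{Cl}(R_F)$: there is a constant $c > 0$, depending only on $n, f_0, r_1, r_2$, such that for all sufficiently large $X$ at least a fraction $c$ of the $\mathbb{Z}$-orbits on $\mathcal{F}$ of height less than $X$ contain such a form. -/

import Mathlib

/-- A binary form `F(x,z) = ∑ i, f_i x^(n-i) z^i` of degree `n` over `S`,
given by its coefficients `f_0, …, f_n`; the leading coefficient is `F 0`. -/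
abbrev BinaryForm (S : Type*) (n : ℕ) := Fin (n + 1) → S

noncomputable section

namespace BinaryForm

/-- Base change of a form along a ring homomorphism. -/
def map {S T : Type*} [CommRing S] [CommRing T] (φ : S →+* T) {n : ℕ} (F : BinaryForm S n) :
    BinaryForm T n :=
  fun i => φ (F i)

/-- The coefficient `f_i`, for a natural number `i` (zero for `i > n`). -/
def coef {S : Type*} [CommRing S] {n : ℕ} (F : BinaryForm S n) (i : ℕ) : S :=
  if h : i < n + 1 then F ⟨i, h⟩ else 0

/-- The form as a polynomial in the two variables `x = X 0` and `z = X 1`. -/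
def toMvPoly {S : Type*} [CommRing S] {n : ℕ} (F : BinaryForm S n) : MvPolynomial (Fin 2) S :=
  ∑ i : Fin (n + 1),
    MvPolynomial.C (F i) * MvPolynomial.X 0 ^ (n - (i : ℕ)) * MvPolynomial.X 1 ^ (i : ℕ)

/-- The one-variable polynomial `F(x,1)`. -/
def dehomog {S : Type*} [CommRing S] {n : ℕ} (F : BinaryForm S n) : Polynomial S :=
  ∑ i : Fin (n + 1), Polynomial.C (F i) * Polynomial.X ^ (n - (i : ℕ))

theorem aeval_dehomog {S A : Type*} [CommRing S] [CommRing A] [Algebra S A] {n : ℕ}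
    (F : BinaryForm S n) (t : A) :
    Polynomial.aeval t (dehomog F) =
      ∑ j ∈ Finset.range (n + 1), algebraMap S A (F.coef j) * t ^ (n - j) := by
  have key : ∀ i : Fin (n + 1), F i = F.coef i := fun i => by
    simp only [coef, i.2, dif_pos, Fin.eta]
  rw [← Fin.sum_univ_eq_sum_range (fun i => algebraMap S A (F.coef i) * t ^ (n - i)) (n + 1)]
  simp only [dehomog, map_sum, map_mul, map_pow, Polynomial.aeval_C, Polynomial.aeval_X, key]

/-- `gcd (f_0, …, f_n) = 1`. -/
def IsPrimitive {S : Type*} [CommRing S] {n : ℕ} (F : BinaryForm S n) : Prop :=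
  Ideal.span (Set.range F) = ⊤

/-- Separability over the field `K`, for forms with nonzero leading coefficient. -/
def IsSeparable {R : Type*} (K : Type*) [CommRing R] [Field K] [Algebra R K] {n : ℕ}
    (F : BinaryForm R n) : Prop :=
  ((dehomog F).map (algebraMap R K)).Separable

/-! ### The ring cut out by a form -/

/-- The algebra `K_F = K[x] / (F(x,1))`. -/
abbrev etAlg {R : Type*} (K : Type*) [CommRing R] [Field K] [Algebra R K] {n : ℕ}
    (F : BinaryForm R n) : Type _ :=
  AdjoinRoot ((dehomog F).map (algebraMap R K))

/-- The image `θ` of `x` in `K_F`. -/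
def theta {R : Type*} (K : Type*) [CommRing R] [Field K] [Algebra R K] {n : ℕ}
    (F : BinaryForm R n) : etAlg K F :=
  AdjoinRoot.root ((dehomog F).map (algebraMap R K))

/-- `ζ_i = f_0 θ^i + f_1 θ^(i-1) + ⋯ + f_(i-1) θ`. -/
def zeta {R : Type*} (K : Type*) [CommRing R] [Field K] [Algebra R K] {n : ℕ}
    (F : BinaryForm R n) (i : ℕ) : etAlg K F :=
  ∑ j ∈ Finset.range i, algebraMap R (etAlg K F) (F.coef j) * theta K F ^ (i - j)

/-- The `R`-module with generators `1, ζ_1, …, ζ_(n-1)`. -/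
def orderModule {R : Type*} (K : Type*) [CommRing R] [Field K] [Algebra R K] {n : ℕ}
    (F : BinaryForm R n) : Submodule R (etAlg K F) :=
  Submodule.span R (insert 1 (zeta K F '' Set.Icc 1 (n - 1)))

section Multiplication

variable {R : Type*} {K : Type*} [CommRing R] [Field K] [Algebra R K] {n : ℕ}
  (F : BinaryForm R n)

theorem zeta_zero : zeta K F 0 = 0 := by simp [zeta]

theorem zeta_succ (i : ℕ) :
    zeta K F (i + 1) = theta K F * (zeta K F i + algebraMap R (etAlg K F) (F.coef i)) := by
  unfold zeta
  rw [Finset.sum_range_succ, mul_add, Finset.mul_sum]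
  congr 1
  · refine Finset.sum_congr rfl fun j hj => ?_
    have : i + 1 - j = (i - j) + 1 := by
      have := Finset.mem_range.1 hj
      omega
    rw [this, pow_succ]; ring
  · simp [mul_comm]

theorem zeta_last : zeta K F n = - algebraMap R (etAlg K F) (F.coef n) := by
  have h : Polynomial.aeval (theta K F) (dehomog F) = 0 := by
    rw [← Polynomial.aeval_map_algebraMap K]
    exact (AdjoinRoot.aeval_eq _).trans AdjoinRoot.mk_self
  rw [aeval_dehomog, Finset.sum_range_succ] at h
  rw [eq_neg_iff_add_eq_zero]
  simpa [zeta] using h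

theorem one_mem_orderModule : (1 : etAlg K F) ∈ orderModule K F :=
  Submodule.subset_span (Set.mem_insert _ _)

theorem algebraMap_mem_orderModule (r : R) : algebraMap R (etAlg K F) r ∈ orderModule K F := by
  rw [Algebra.algebraMap_eq_smul_one]
  exact Submodule.smul_mem _ _ (one_mem_orderModule F)

theorem zeta_mem_orderModule {i : ℕ} (hi : i ≤ n) : zeta K F i ∈ orderModule K F := by
  rcases Nat.eq_zero_or_pos i with rfl | h0
  · rw [zeta_zero]; exact Submodule.zero_mem _
  · rcases hi.eq_or_lt with rfl | hlt
    · rw [zeta_last, ← map_neg]; exact algebraMap_mem_orderModule F _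
    · exact Submodule.subset_span (Set.mem_insert_of_mem _ ⟨i, ⟨h0, by omega⟩, rfl⟩)

theorem zeta_mul_zeta_mem {i : ℕ} (hi : i ≤ n) :
    ∀ {j : ℕ}, j ≤ n → zeta K F i * zeta K F j ∈ orderModule K F := by
  induction i with
  | zero => intro j _; rw [zeta_zero, zero_mul]; exact Submodule.zero_mem _
  | succ i ih =>
    intro j hj
    rcases hj.eq_or_lt with rfl | hlt
    · rw [zeta_last, ← map_neg, mul_comm, ← Algebra.smul_def]
      exact Submodule.smul_mem _ _ (zeta_mem_orderModule F hi)
    · have e : zeta K F (i + 1) * zeta K F j = zeta K F i * zeta K F (j + 1)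
          + F.coef i • zeta K F (j + 1) - F.coef j • zeta K F (i + 1) := by
        rw [zeta_succ, zeta_succ, Algebra.smul_def, Algebra.smul_def]; ring
      rw [e]
      exact Submodule.sub_mem _ (Submodule.add_mem _ (ih (by omega) (by omega))
        (Submodule.smul_mem _ _ (zeta_mem_orderModule F (by omega))))
        (Submodule.smul_mem _ _ (zeta_mem_orderModule F hi))

theorem mul_mem_orderModule {a b : etAlg K F} (ha : a ∈ orderModule K F)
    (hb : b ∈ orderModule K F) : a * b ∈ orderModule K F := by
  have h : orderModule K F * orderModule K F ≤ orderModule K F := by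
    conv_lhs => unfold orderModule
    rw [Submodule.span_mul_span, Submodule.span_le]
    rintro _ ⟨x, hx, y, hy, rfl⟩
    change x * y ∈ orderModule K F
    rcases hx with rfl | ⟨i, hi, rfl⟩
    · rw [one_mul]; exact Submodule.subset_span hy
    · rcases hy with rfl | ⟨j, hj, rfl⟩
      · rw [mul_one]; exact zeta_mem_orderModule F (le_trans hi.2 (Nat.sub_le _ _))
      · exact zeta_mul_zeta_mem F (le_trans hi.2 (Nat.sub_le _ _))
          (le_trans hj.2 (Nat.sub_le _ _))
  exact h (Submodule.mul_mem_mul ha hb)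

end Multiplication

/-- The ring `R_F` cut out by `F`: the subring of `K_F` with underlying `R`-module
`R⟨1, ζ_1, …, ζ_(n-1)⟩`. -/
def order {R : Type*} (K : Type*) [CommRing R] [Field K] [Algebra R K] {n : ℕ}
    (F : BinaryForm R n) : Subalgebra R (etAlg K F) :=
  (orderModule K F).toSubalgebra (one_mem_orderModule F)
    (fun _ _ ha hb => mul_mem_orderModule F ha hb)

/-- `R_F` is the maximal order of `K_F`, i.e. the integral closure of `R` in `K_F`. -/
def IsMaximal {R : Type*} (K : Type*) [CommRing R] [Field K] [Algebra R K] {n : ℕ}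
    (F : BinaryForm R n) : Prop :=
  order K F = integralClosure R (etAlg K F)

/-! ### The class group and the inverse different of `R_F` over `ℤ` -/

/-- The ideal class group of a ring `B` contained in `A`, for `A` the total ring of fractions
of `B`: the group of invertible `B`-submodules of `A` (these are exactly the invertible
fractional ideals) modulo the subgroup of principal ideals `κ B`, `κ ∈ Aˣ`. -/
def IdealClassGroup (B A : Type*) [CommRing B] [CommRing A] [Algebra B A] : Type _ :=
  (Submodule B A)ˣ ⧸ (Units.map (Submodule.spanSingleton (A := A) B).toMonoidHom).range

instance (B A : Type*) [CommRing B] [CommRing A] [Algebra B A] :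
    CommGroup (IdealClassGroup B A) :=
  inferInstanceAs (CommGroup
    ((Submodule B A)ˣ ⧸ (Units.map (Submodule.spanSingleton (A := A) B).toMonoidHom).range))

/-- The class of an invertible fractional ideal. -/
def IdealClassGroup.mk {B A : Type*} [CommRing B] [CommRing A] [Algebra B A] :
    (Submodule B A)ˣ →* IdealClassGroup B A :=
  QuotientGroup.mk' (Units.map (Submodule.spanSingleton (A := A) B).toMonoidHom).range

/-- The ideal class group `Cl(R_F)`. -/
abbrev Cl {n : ℕ} (F : BinaryForm ℤ n) : Type :=
  IdealClassGroup (order ℚ F) (etAlg ℚ F)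

/-- The inverse different of `R_F`, i.e. `{x ∈ K_F : Tr(x R_F) ⊆ ℤ}`. -/
def inverseDifferent {n : ℕ} (F : BinaryForm ℤ n) : Submodule (order ℚ F) (etAlg ℚ F) where
  carrier := {x | ∀ y ∈ order ℚ F,
    Algebra.trace ℚ (etAlg ℚ F) (x * y) ∈ Set.range (algebraMap ℤ ℚ)}
  zero_mem' := fun y _ => ⟨0, by simp⟩
  add_mem' := fun {a b} ha hb y hy => by
    obtain ⟨s, hs⟩ := ha y hy
    obtain ⟨t, ht⟩ := hb y hy
    exact ⟨s + t, by rw [map_add, hs, ht, add_mul, map_add]⟩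
  smul_mem' := fun c x hx y hy => by
    have h := hx (c * y) (Subalgebra.mul_mem _ c.2 hy)
    have e : (c • x) * y = x * ((c : etAlg ℚ F) * y) := by
      rw [Subalgebra.smul_def, smul_eq_mul]; ring
    rw [e]; exact h

/-- The inverse different of `R_F` is invertible, and its class in `Cl(R_F)` is a square. -/
def InverseDifferentIsSquare {n : ℕ} (F : BinaryForm ℤ n) : Prop :=
  ∃ D : (Submodule (order ℚ F) (etAlg ℚ F))ˣ, D.val = inverseDifferent F ∧
    IsSquare (IdealClassGroup.mk D : Cl F)

/-! ### Families of forms -/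

/-- Over `ℝ`, the form splits into `r₁` linear and `r₂` irreducible quadratic factors. -/
def HasSignature {n : ℕ} (F : BinaryForm ℝ n) (r₁ r₂ : ℕ) : Prop :=
  ∃ (L : Fin r₁ → BinaryForm ℝ 1) (Q : Fin r₂ → BinaryForm ℝ 2),
    (∀ j, Irreducible (Q j).toMvPoly) ∧
      F.toMvPoly = (∏ i, (L i).toMvPoly) * ∏ j, (Q j).toMvPoly

/-- Separable primitive integral forms of degree `n` with leading coefficient `f₀` and
real signature `(r₁, r₂)`. -/
def primForms (n : ℕ) (f₀ : ℤ) (r₁ r₂ : ℕ) : Set (BinaryForm ℤ n) :=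
  {F | F 0 = f₀ ∧ F.IsSeparable ℚ ∧ F.IsPrimitive ∧
    (F.map (Int.castRingHom ℝ)).HasSignature r₁ r₂}

/-- Separable primitive forms of degree `n` over `ℤ_p` with leading coefficient `f₀` for which
`R_F` is the maximal order. -/
def maxFormsPadic (p : ℕ) [Fact p.Prime] (n : ℕ) (f₀ : ℤ_[p]) : Set (BinaryForm ℤ_[p] n) :=
  {F | F 0 = f₀ ∧ F.IsSeparable ℚ_[p] ∧ F.IsPrimitive ∧ F.IsMaximal ℚ_[p]}

/-- `F ≡ κ z^e H² (mod p)` with `e > 0`, `κ` a unit, and `H` a monic form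
(so that `z ∤ H`). -/
def IsSquareful (p : ℕ) [Fact p.Prime] {n : ℕ} (F : BinaryForm ℤ_[p] n) : Prop :=
  ∃ (κ : (ZMod p)ˣ) (e d : ℕ) (H : BinaryForm (ZMod p) d), 0 < e ∧ H 0 = 1 ∧
    (F.map PadicInt.toZMod).toMvPoly =
      MvPolynomial.C (κ : ZMod p) * MvPolynomial.X 1 ^ e * H.toMvPoly ^ 2

/-! ### Translation classes and height -/

/-- The translate `F(x + s z, z)`. -/
def translate {S : Type*} [CommRing S] {n : ℕ} (s : S) (F : BinaryForm S n) : BinaryForm S n :=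
  fun i => (Polynomial.taylor s (dehomog F)).coeff (n - (i : ℕ))

/-- The orbit of an integral form under the group of matrices `[[1, 0], [s, 1]]`, `s ∈ ℤ`. -/
def orbit {n : ℕ} (F : BinaryForm ℤ n) : Set (BinaryForm ℤ n) :=
  Set.range fun s : ℤ => translate s F

/-- The monicized form `F(x, f_0 z) / f_0`. -/
def monicize {n : ℕ} (F : BinaryForm ℝ n) : BinaryForm ℝ n :=
  fun i => (F 0)⁻¹ * (F i * F 0 ^ (i : ℕ))

/-- The translate of the monicized form whose `x^(n-1) z`-coefficient is zero. -/
def depressed {n : ℕ} (F : BinaryForm ℝ n) : BinaryForm ℝ n :=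
  translate (-(F.monicize.coef 1) / n) F.monicize

/-- The height of a real form: the maximum of `|f̃_i|^(1/i)` over `2 ≤ i ≤ n`, where the
`f̃_i` are the coefficients of the depressed form. -/
def height {n : ℕ} (F : BinaryForm ℝ n) : NNReal :=
  (Finset.Icc 2 n).sup fun i => ‖F.depressed.coef i‖₊ ^ (1 / (i : ℝ))

/-- The translation classes of forms in a family `A` that have height less than `X`. -/
def classesBelow {n : ℕ} (A : Set (BinaryForm ℤ n)) (X : ℝ) : Set (Set (BinaryForm ℤ n)) :=
  orbit '' {F ∈ A | ((F.map (Int.castRingHom ℝ)).height : ℝ) < X}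

end BinaryForm

/-- `k` is the squarefree part of `m`: `k` is squarefree and `m / k` is a perfect square. -/
def IsSquarefreePart (k m : ℤ) : Prop :=
  Squarefree k ∧ ∃ t : ℤ, m = k * t ^ 2

end

/-!
Think of `R_F` as the ring of functions on the subscheme `F = 0` of `ℙ¹`. For primitive `F` the
fractional ideal `I = (1, θ)` plays the role of `𝒪(1)`; it is invertible, with inverse the integral
ideal `J = idealInf F` generated by the coefficients `β_i` of `F(x,1) / (x - θ)`, the ideal of the
points at infinity `z = 0` (`idealOne_mul_idealInf`). A binary form `φ` of degree `d` cuts out the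
integral ideal `φ(θ) J^d` (`formIdeal`). Euler's formula says that the trace pairing is the residue
pairing twisted by `F'(θ)`, and the residue pairing makes `I^(n-2)` dual to `R_F`; so the inverse
different is `F'(θ)⁻¹ I^(n-2)` (`principal_mul_inverseDifferent`). Hence it is enough that `J` be a
square class.

Write `f_0 = k t²`. If `t` is prime to `f_1`, then `J = (J + (k)) (J + (t))²`, and `J + (k)` is the
product of the `J + (p)` for the primes `p ∣ k` (`idealInf_add_mul`). Suppose
`F = κ z^e H² + m G` with `κ` prime to `m`, so that the ideals of the forms satisfy
`J^e [H]² = (m) [G]` up to `κ`. If, modulo `m`, the form `H` meets neither `G` nor `z`, and `G` does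
not meet `z` unless `e = 1`, then `((m) + [H])² (J + (m))^e = (m)`, a purely formal identity in the
idempotent semiring of fractional ideals (`add_sq_mul_add_pow_eq`). As `n` is odd, so is `e`, and
`J + (m)` is a square class (`isSquareClass_idealInf_add_principal`).

For a maximal form the conditions on common zeros hold automatically: if `F` lies in the square of
the ideal `(φ, p)` of binary forms, then `R_F` is strictly contained in an explicit order
(`exists_isIntegral_not_mem_order`). Applied to a common factor of `G` and `H` modulo `p`, or to
`z`, this contradicts maximality at `p`, which is compared with maximality over `ℤ_p` in
coordinates (`mem_order_of_isMaximal_padic`). This gives the criterion for squareful forms,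
`inverseDifferentIsSquare_of_isSquareful`.

For the positive proportion, consider the forms with `f_1 = 1`, with `2 f_0 ∣ f_i` for `1 < i < n`
and with `f_n ≡ 4k` modulo `4k²`. Modulo `k` such a form is `x^(n-1) z`, so the identity above
applies with `m = k`, `e = 1`, without any assumption on maximality; and since `4 ∣ f_n` and
`2 ∣ f_(n-1)`, it lies in the square of `(x, 2)` and is not maximal. The remaining condition, on the
factorization over `ℝ`, holds in a box of coefficients around the rescalings of a polynomial whose
roots lie on a grid (`exists_stable_coefficients`), by stability of separated roots. Fixing
`f_1 = 1` leaves one form in each translation class, while every class of height less than `X` has a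
representative with `0 ≤ f_1 < n |f_0|` and `f_i = O(X^i)`. So both counts are compared one
coefficient at a time (`exists_boxes`): for each `i ≥ 2`, a full arithmetic progression in an
interval of length `≫ X^i` has positive density in an interval of length `O(X^i)`.
-/

noncomputable section

open Polynomial

/-! ### The residue pairing -/

namespace BinaryForm

section Residue

variable {R : Type*} {K : Type*} [CommRing R] [Field K] [Algebra R K] {n : ℕ}
  (F : BinaryForm R n)

theorem coef_of_lt {S : Type*} [CommRing S] (G : BinaryForm S n) (i : Fin (n + 1)) :
    G.coef i = G i := by
  rw [coef, dif_pos i.2]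

theorem coef_zero {S : Type*} [CommRing S] (G : BinaryForm S n) : G.coef 0 = G 0 :=
  coef_of_lt G 0

theorem coef_map {S T : Type*} [CommRing S] [CommRing T] (φ : S →+* T) (G : BinaryForm S n)
    (i : ℕ) : (G.map φ).coef i = φ (G.coef i) := by
  unfold coef map
  split_ifs <;> simp

theorem dehomog_eq_sum_range {S : Type*} [CommRing S] (G : BinaryForm S n) :
    dehomog G = ∑ j ∈ Finset.range (n + 1), C (G.coef j) * X ^ (n - j) := by
  rw [← Fin.sum_univ_eq_sum_range (fun i => C (G.coef i) * X ^ (n - i)) (n + 1)]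
  simp [dehomog, coef_of_lt]

theorem dehomog_map {S T : Type*} [CommRing S] [CommRing T] (φ : S →+* T)
    (G : BinaryForm S n) : dehomog (G.map φ) = (dehomog G).map φ := by
  simp [dehomog, map, Polynomial.map_sum]

theorem coeff_dehomog {S : Type*} [CommRing S] (G : BinaryForm S n) {i : ℕ} (hi : i ≤ n) :
    (dehomog G).coeff (n - i) = G.coef i := by
  rw [dehomog_eq_sum_range, finsetSum_coeff, Finset.sum_eq_single i]
  · simp
  · intro b hb hbi
    rw [coeff_C_mul_X_pow, if_neg]
    have := Finset.mem_range.1 hb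
    omega
  · intro h
    exact absurd (Finset.mem_range.2 (by omega)) h

theorem natDegree_dehomog_le {S : Type*} [CommRing S] (G : BinaryForm S n) :
    (dehomog G).natDegree ≤ n := by
  refine natDegree_sum_le_of_forall_le _ _ fun i _ => ?_
  exact (natDegree_C_mul_X_pow_le _ _).trans (Nat.sub_le _ _)

/-- A form is determined by its dehomogenization. -/
theorem dehomog_injective {S : Type*} [CommRing S] :
    Function.Injective (dehomog : BinaryForm S n → S[X]) := by
  intro F G h
  funext i
  have hi : (i : ℕ) ≤ n := by omega
  rw [← coef_of_lt F, ← coef_of_lt G, ← coeff_dehomog F hi, ← coeff_dehomog G hi, h]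

theorem natDegree_map_dehomog (h : algebraMap R K (F 0) ≠ 0) :
    ((dehomog F).map (algebraMap R K)).natDegree = n := by
  refine le_antisymm (natDegree_map_le.trans (natDegree_dehomog_le F)) ?_
  refine le_natDegree_of_ne_zero ?_
  have := coeff_dehomog F (Nat.zero_le n)
  rw [Nat.sub_zero] at this
  rwa [coeff_map, this, coef_zero]

theorem map_dehomog_ne_zero (h : algebraMap R K (F 0) ≠ 0) :
    (dehomog F).map (algebraMap R K) ≠ 0 := by
  intro h0
  apply h
  have := coeff_dehomog F (Nat.zero_le n)
  rw [← coef_zero F, ← this, ← coeff_map, h0, Polynomial.coeff_zero]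

theorem aeval_theta_dehomog : aeval (theta K F) (dehomog F) = 0 := by
  rw [← aeval_map_algebraMap K]
  exact (AdjoinRoot.aeval_eq _).trans AdjoinRoot.mk_self

variable (K) in
/-- `β_i = f_0 θ^i + f_1 θ^(i-1) + ⋯ + f_i`, the coefficients of the quotient of `F(x,1)` by
`x - θ`. -/
def beta (i : ℕ) : etAlg K F :=
  zeta K F i + algebraMap R (etAlg K F) (F.coef i)

theorem beta_zero : beta K F 0 = algebraMap R (etAlg K F) (F.coef 0) := by
  simp [beta, zeta_zero]

theorem theta_mul_beta (i : ℕ) : theta K F * beta K F i = zeta K F (i + 1) :=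
  (zeta_succ F i).symm

theorem beta_succ (i : ℕ) :
    beta K F (i + 1) = theta K F * beta K F i + algebraMap R (etAlg K F) (F.coef (i + 1)) := by
  rw [theta_mul_beta, beta]

theorem beta_last : beta K F n = 0 := by
  rw [beta, zeta_last, neg_add_cancel]

theorem beta_eq_sum (i : ℕ) : beta K F i =
    ∑ j ∈ Finset.range (i + 1), algebraMap R (etAlg K F) (F.coef j) * theta K F ^ (i - j) := by
  rw [beta, zeta, Finset.sum_range_succ]
  simp

theorem beta_mem_orderModule {i : ℕ} (hi : i ≤ n) : beta K F i ∈ orderModule K F :=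
  Submodule.add_mem _ (zeta_mem_orderModule F hi) (algebraMap_mem_orderModule F _)

theorem algebraMap_mul_eq_smul (r : R) (y : etAlg K F) :
    algebraMap R (etAlg K F) r * y = algebraMap R K r • y := by
  rw [Algebra.smul_def, ← IsScalarTower.algebraMap_apply]

/-- The linear functional on `K_F` sending `θ^i` to `0` for `i < n - 1` and `θ^(n-1)` to
`1 / f_0`. -/
def residue (h : algebraMap R K (F 0) ≠ 0) (hn : 0 < n) : etAlg K F →ₗ[K] K :=
  (algebraMap R K (F 0))⁻¹ • (AdjoinRoot.powerBasis (map_dehomog_ne_zero F h)).basis.coord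
    ⟨n - 1, by rw [AdjoinRoot.powerBasis_dim, natDegree_map_dehomog F h]; omega⟩

variable (h : algebraMap R K (F 0) ≠ 0) (hn : 0 < n)

theorem powerBasis_eq_theta_pow (i) :
    (AdjoinRoot.powerBasis (map_dehomog_ne_zero F h)).basis i = theta K F ^ (i : ℕ) := by
  rw [PowerBasis.coe_basis]; rfl

theorem residue_theta_pow {i : ℕ} (hi : i < n) :
    residue F h hn (theta K F ^ i) = if i = n - 1 then (algebraMap R K (F 0))⁻¹ else 0 := by
  have hi' : i < (AdjoinRoot.powerBasis (map_dehomog_ne_zero F h)).dim := by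
    rw [AdjoinRoot.powerBasis_dim, natDegree_map_dehomog F h]; omega
  have := powerBasis_eq_theta_pow F h ⟨i, hi'⟩
  simp only at this
  rw [← this, residue, LinearMap.smul_apply, Module.Basis.coord_apply, Module.Basis.repr_self,
    Finsupp.single_apply]
  simp [Fin.ext_iff]

/-- The family `β_(n-1), …, β_0` is dual to `1, θ, …, θ^(n-1)` for the residue pairing. -/
theorem residue_theta_pow_mul_beta {i m : ℕ} (hi : i < n) (hm : m < n) :
    residue F h hn (theta K F ^ i * beta K F m) = if i + m = n - 1 then 1 else 0 := by
  induction i generalizing m with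
  | zero =>
    rw [pow_zero, one_mul, beta_eq_sum, map_sum, Finset.sum_eq_single 0]
    · rw [algebraMap_mul_eq_smul, map_smul, Nat.sub_zero, residue_theta_pow F h hn hm, coef_zero]
      simp only [zero_add]
      split_ifs
      · simp [h]
      · simp
    · intro j hj hj0
      have := Finset.mem_range.1 hj
      rw [algebraMap_mul_eq_smul, map_smul, residue_theta_pow F h hn (by omega),
        if_neg (by omega), smul_zero]
    · simp
  | succ i ih =>
    have e : theta K F ^ (i + 1) * beta K F m
        = theta K F ^ i * beta K F (m + 1)
          - algebraMap R (etAlg K F) (F.coef (m + 1)) * theta K F ^ i := by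
      rw [beta_succ]; ring
    rw [e, map_sub, algebraMap_mul_eq_smul, map_smul, residue_theta_pow F h hn (by omega),
      if_neg (by omega), smul_zero, sub_zero]
    rcases (Nat.succ_le_of_lt hm).lt_or_eq with hlt | heq
    · rw [ih (by omega) hlt]
      simp only [Nat.succ_eq_add_one, show i + (m + 1) = i + 1 + m by ring]
    · rw [Nat.succ_eq_add_one] at heq
      rw [heq, beta_last, mul_zero, map_zero, if_neg (by omega)]

/-- Coordinates in the basis `θ^j` are residues against the dual basis. -/
theorem eq_sum_residue_mul_beta (w : etAlg K F) :
    w = ∑ j ∈ Finset.range n, residue F h hn (w * beta K F (n - 1 - j)) • theta K F ^ j := by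
  set b := (AdjoinRoot.powerBasis (map_dehomog_ne_zero F h)).basis with hb
  have hd : (AdjoinRoot.powerBasis (map_dehomog_ne_zero F h)).dim = n := by
    rw [AdjoinRoot.powerBasis_dim, natDegree_map_dehomog F h]
  have hw : w ∈ Submodule.span K (Set.range b) := b.span_eq ▸ Submodule.mem_top
  induction hw using Submodule.span_induction with
  | zero => simp
  | add x y _ _ hx hy =>
    simp only [add_mul, map_add, add_smul, Finset.sum_add_distrib]
    rw [← hx, ← hy]
  | smul c x _ hx =>
    simp only [smul_mul_assoc, map_smul, smul_assoc, ← Finset.smul_sum]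
    rw [← hx]
  | mem x hx =>
    obtain ⟨i, rfl⟩ := hx
    have hi : (i : ℕ) < n := by have := i.2; omega
    rw [hb, powerBasis_eq_theta_pow F h, Finset.sum_eq_single (i : ℕ)]
    · rw [residue_theta_pow_mul_beta F h hn hi (by omega), if_pos (by omega), one_smul]
    · intro j hj hji
      have := Finset.mem_range.1 hj
      rw [residue_theta_pow_mul_beta F h hn hi (by omega), if_neg (by omega), zero_smul]
    · intro hni
      exact absurd (Finset.mem_range.2 hi) hni

/-- `F'(θ)` is the value at `θ` of the quotient of `F(x,1)` by `x - θ`. -/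
theorem aeval_theta_derivative_eq_sum :
    aeval (theta K F) (derivative (dehomog F)) =
      ∑ j ∈ Finset.range n, theta K F ^ (n - 1 - j) * beta K F j := by
  have key : ∀ m : ℕ, aeval (theta K F) (derivative
      (∑ j ∈ Finset.range (m + 1), C (F.coef j) * X ^ (m - j))) =
      ∑ j ∈ Finset.range m, theta K F ^ (m - 1 - j) * beta K F j := by
    intro m
    induction m with
    | zero => simp
    | succ m ih =>
      have e : ∑ j ∈ Finset.range (m + 1 + 1), C (F.coef j) * X ^ (m + 1 - j) =
          X * ∑ j ∈ Finset.range (m + 1), C (F.coef j) * X ^ (m - j) + C (F.coef (m + 1)) := by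
        rw [Finset.sum_range_succ _ (m + 1), Finset.mul_sum, Nat.sub_self, pow_zero, mul_one]
        refine congrArg (· + C (F.coef (m + 1))) (Finset.sum_congr rfl fun j hj => ?_)
        have : m + 1 - j = m - j + 1 := by have := Finset.mem_range.1 hj; omega
        rw [this]; ring
      rw [e, derivative_add, derivative_mul, derivative_X, one_mul, derivative_C, add_zero,
        map_add, map_mul, ih, aeval_X, Finset.mul_sum]
      have e1 : ∑ j ∈ Finset.range m, theta K F ^ (m + 1 - 1 - j) * beta K F j =
          ∑ j ∈ Finset.range m, theta K F * (theta K F ^ (m - 1 - j) * beta K F j) := by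
        refine Finset.sum_congr rfl fun j hj => ?_
        have : m + 1 - 1 - j = m - 1 - j + 1 := by have := Finset.mem_range.1 hj; omega
        rw [this]; ring
      have e2 : aeval (theta K F) (∑ j ∈ Finset.range (m + 1), C (F.coef j) * X ^ (m - j)) =
          theta K F ^ (m + 1 - 1 - m) * beta K F m := by
        rw [beta_eq_sum]; simp [map_sum]
      rw [e2, Finset.sum_range_succ _ m, e1, add_comm]
  rw [← key n, ← dehomog_eq_sum_range]

theorem powerBasis_dim_eq : (AdjoinRoot.powerBasis (map_dehomog_ne_zero F h)).dim = n := by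
  rw [AdjoinRoot.powerBasis_dim, natDegree_map_dehomog F h]

theorem powerBasis_repr_eq_residue (w : etAlg K F) (i) :
    (AdjoinRoot.powerBasis (map_dehomog_ne_zero F h)).basis.repr w i =
      residue F h hn (w * beta K F (n - 1 - i)) := by
  have hi : (i : ℕ) < n := by have := i.2; have := powerBasis_dim_eq F h; omega
  conv_lhs => rw [eq_sum_residue_mul_beta F h hn w]
  rw [map_sum, Finsupp.finsetSum_apply, Finset.sum_eq_single (i : ℕ)]
  · rw [← powerBasis_eq_theta_pow F h i, map_smul, Finsupp.smul_apply, Module.Basis.repr_self,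
      Finsupp.single_eq_same, smul_eq_mul, mul_one]
  · intro j hj hji
    have hj' : j < (AdjoinRoot.powerBasis (map_dehomog_ne_zero F h)).dim := by
      have := Finset.mem_range.1 hj; have := powerBasis_dim_eq F h; omega
    have := powerBasis_eq_theta_pow F h ⟨j, hj'⟩
    simp only at this
    rw [← this, map_smul, Finsupp.smul_apply, Module.Basis.repr_self,
      Finsupp.single_eq_of_ne (by simp only [ne_eq, Fin.ext_iff]; omega), smul_zero]
  · intro hni
    exact absurd (Finset.mem_range.2 hi) hni

/-- Euler's formula: the trace form is the residue pairing twisted by `F'(θ)`. -/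
theorem trace_eq_residue (y : etAlg K F) :
    Algebra.trace K (etAlg K F) y =
      residue F h hn (aeval (theta K F) (derivative (dehomog F)) * y) := by
  have hd := powerBasis_dim_eq F h
  have e1 : Algebra.trace K (etAlg K F) y =
      ∑ i : Fin (AdjoinRoot.powerBasis (map_dehomog_ne_zero F h)).dim,
        residue F h hn (y * theta K F ^ (i : ℕ) * beta K F (n - 1 - i)) := by
    rw [Algebra.trace_eq_matrix_trace (AdjoinRoot.powerBasis (map_dehomog_ne_zero F h)).basis]
    refine Finset.sum_congr rfl fun i _ => ?_
    rw [Matrix.diag_apply, Algebra.leftMulMatrix_eq_repr_mul, powerBasis_repr_eq_residue F h hn,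
      powerBasis_eq_theta_pow F h]
  have e2 : aeval (theta K F) (derivative (dehomog F)) * y =
      ∑ i ∈ Finset.range n, y * theta K F ^ i * beta K F (n - 1 - i) := by
    rw [aeval_theta_derivative_eq_sum, Finset.sum_mul, ← Finset.sum_range_reflect]
    refine Finset.sum_congr rfl fun i hi => ?_
    have := Finset.mem_range.1 hi
    rw [show n - 1 - (n - 1 - i) = i by omega]
    ring
  rw [e1, e2, map_sum, Fin.sum_univ_eq_sum_range
    (fun i => residue F h hn (y * theta K F ^ i * beta K F (n - 1 - i))), hd]

theorem isUnit_aeval_theta_derivative (hF : F.IsSeparable K) :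
    IsUnit (aeval (theta K F) (derivative (dehomog F))) := by
  obtain ⟨a, b, hab⟩ := hF
  refine IsUnit.of_mul_eq_one (aeval (theta K F) b) ?_
  have := congrArg (aeval (theta K F)) hab
  rw [map_add, map_mul, map_mul, aeval_map_algebraMap, aeval_theta_dehomog, mul_zero, zero_add,
    derivative_map, aeval_map_algebraMap, map_one] at this
  rw [mul_comm, this]

end Residue

end BinaryForm

/-! ### Comaximal ideals in idempotent semirings -/

section IdemSemiring

variable {α : Type*} [IdemCommSemiring α]

theorem mul_le_left_of_le_one {x y : α} (hy : y ≤ 1) : x * y ≤ x := by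
  simpa using mul_le_mul' (le_refl x) hy

theorem mul_le_right_of_le_one {x y : α} (hx : x ≤ 1) : x * y ≤ y := by
  simpa using mul_le_mul' hx (le_refl y)

/-- If `x` is comaximal with `y` and with `z`, then also with `y z`. -/
theorem one_le_add_mul_of_one_le {x y z : α} (hx : x ≤ 1) (hy : y ≤ 1) (hz : z ≤ 1)
    (h1 : 1 ≤ x + y) (h2 : 1 ≤ x + z) : 1 ≤ x + y * z := by
  have h : (1 : α) ≤ (x + y) * (x + z) := by simpa using mul_le_mul' h1 h2
  refine h.trans ?_
  rw [add_mul, mul_add y, ← add_assoc]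
  gcongr
  exact add_le (mul_le_left_of_le_one (add_le hx hz)) (mul_le_right_of_le_one hy)

theorem one_le_add_pow_of_one_le {x y : α} (hx : x ≤ 1) (hy : y ≤ 1) (h : 1 ≤ x + y) (N : ℕ) :
    1 ≤ x + y ^ N := by
  induction N with
  | zero => rw [pow_zero]; exact le_add_self
  | succ N ih =>
    rw [pow_succ]
    exact one_le_add_mul_of_one_le hx (pow_le_one' hy N) hy ih h

/-- The identity behind the square classes. Think of an ideal `M` generated by an integer `m`, of
`J` as the ideal of the section `z` and of `H`, `G` as those of binary forms satisfying
`κ z^e H² = -m G`. Suppose that, modulo `m`, the forms `G` and `H` do not meet away from `z = 0`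
(`h2`), nor `H` and `z` (`h3`), nor `G` and `z` unless `e = 1` (`h4`). Then
`M = (M + H)² (J + M)^e`. -/
theorem add_sq_mul_add_pow_eq {M J H G κ : α} {e N : ℕ} (hM : M ≤ 1) (hJ : J ≤ 1) (hH : H ≤ 1)
    (hG : G ≤ 1) (hκ : κ ≤ 1) (hκM : 1 ≤ κ + M) (he : 1 ≤ e)
    (hF : κ * (H ^ 2 * J ^ e) = M * G) (h2 : J ^ N ≤ G + H + M) (h3 : 1 ≤ H + J + M)
    (h4 : e = 1 ∨ 1 ≤ G + J + M) : (M + H) ^ 2 * (J + M) ^ e = M := by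
  have hJe : J ^ e ≤ 1 := pow_le_one' hJ e
  have hGHM : G + H + M ≤ 1 := add_le (add_le hG hH) hM
  -- `G`, `H` and `M` are comaximal
  have h5 : 1 ≤ G + H + M := by
    have h : 1 ≤ (G + H + M) + J := by
      refine h3.trans (add_le (add_le ?_ le_add_self) ?_)
      · exact (le_add_self.trans le_self_add : H ≤ G + H + M).trans le_self_add
      · exact (le_add_self : M ≤ G + H + M).trans le_self_add
    exact (one_le_add_pow_of_one_le hGHM hJ h N).trans (add_le le_rfl h2)
  have hJM : J ^ e ≤ (J + M) ^ e := pow_le_pow_left' le_self_add e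
  have hHq : H ^ 2 ≤ (M + H) ^ 2 := pow_le_pow_left' le_add_self 2
  have hMH : M * H ≤ (M + H) ^ 2 := by
    rw [pow_two]; exact mul_le_mul' le_self_add le_add_self
  have hMM : M * M ≤ (M + H) ^ 2 := by
    rw [pow_two]; exact mul_le_mul' le_self_add le_self_add
  have hMG : M * G ≤ (M + H) ^ 2 * (J + M) ^ e := by
    rw [← hF]
    exact (mul_le_right_of_le_one hκ).trans (mul_le_mul' hHq hJM)
  apply le_antisymm
  · have e1 : (M + H) ^ 2 ≤ M + H ^ 2 := by
      have : (M + H) ^ 2 = M * (M + H + H) + H ^ 2 := by ring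
      rw [this]
      gcongr
      exact mul_le_left_of_le_one (add_le (add_le hM hH) hH)
    have e2 : (J + M) ^ e ≤ M + J ^ e := by
      clear hF he hJe h4 hJM hMG
      induction e with
      | zero => simp only [pow_zero]; exact le_add_self
      | succ e ih =>
        rw [pow_succ]
        refine (mul_le_mul' ih le_rfl).trans ?_
        rw [add_mul, mul_add (J ^ e), ← pow_succ]
        refine add_le ((mul_le_left_of_le_one (add_le hJ hM)).trans le_self_add)
          (add_le le_add_self ((mul_le_right_of_le_one (pow_le_one' hJ e)).trans le_self_add))
    have hH2 : H ^ 2 ≤ 1 := pow_le_one' hH 2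
    refine (mul_le_mul' e1 e2).trans ?_
    have e3 : (M + H ^ 2) * (M + J ^ e) = M * (M + J ^ e + H ^ 2) + 1 * (H ^ 2 * J ^ e) := by ring
    rw [e3]
    refine add_le (mul_le_left_of_le_one (add_le (add_le hM hJe) hH2)) ?_
    refine (mul_le_mul' hκM le_rfl).trans ?_
    rw [add_mul, hF]
    exact add_le (mul_le_left_of_le_one hG) (mul_le_left_of_le_one (mul_le_one' hH2 hJe))
  · rcases h4 with rfl | h4
    · -- here `1 ≤ G + M + H²`
      rw [pow_one] at *
      have h6 : 1 ≤ (G + M) + H ^ 2 :=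
        one_le_add_pow_of_one_le (add_le hG hM) hH (h5.trans_eq (by ring)) 2
      calc M = M * 1 := (mul_one M).symm
        _ ≤ M * ((G + M) + H ^ 2) := mul_le_mul' le_rfl h6
        _ = M * G + M * M * 1 + H ^ 2 * M := by ring
        _ ≤ (M + H) ^ 2 * (J + M) := by
          refine add_le (add_le hMG ?_) (mul_le_mul' hHq le_add_self)
          calc M * M * 1 ≤ M * M * (H + J + M) := mul_le_mul' le_rfl h3
            _ = M * H * M + M * M * (J + M) := by ring
            _ ≤ _ := add_le (mul_le_mul' hMH le_add_self) (mul_le_mul' hMM le_rfl)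
    · -- here `1 ≤ G + H J^e + M^(e+1)`
      have h6 : 1 ≤ (G + M) + H * J ^ e :=
        one_le_add_mul_of_one_le (add_le hG hM) hH hJe (h5.trans_eq (by ring))
          (one_le_add_pow_of_one_le (add_le hG hM) hJ (h4.trans_eq (by ring)) e)
      have h7 : 1 ≤ (G + H * J ^ e) + M ^ (e + 1) :=
        one_le_add_pow_of_one_le (add_le hG (mul_le_one' hH hJe)) hM
          (h6.trans_eq (by ring)) (e + 1)
      calc M = M * 1 := (mul_one M).symm
        _ ≤ M * ((G + H * J ^ e) + M ^ (e + 1)) := mul_le_mul' le_rfl h7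
        _ = M * G + M * H * J ^ e + M * M * M ^ e := by ring
        _ ≤ _ := add_le (add_le hMG (mul_le_mul' hMH hJM))
          (mul_le_mul' hMM (pow_le_pow_left' le_add_self e))

/-- If `I` is inverse to `J`, then adding integral ideals `U`, `V` to `J` is multiplicative as soon
as the ideals `J`, `U`, `V` and `U V I` are comaximal. -/
theorem add_mul_add_eq {I J U V : α} (hIJ : I * J = 1) (hJ : J ≤ 1) (hU : U ≤ 1)
    (hV : V ≤ 1) (h : 1 ≤ J + U + V + U * V * I) : (J + U) * (J + V) = J + U * V := by
  apply le_antisymm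
  · have : (J + U) * (J + V) = J * (J + V + U) + U * V := by ring
    rw [this]
    gcongr
    exact mul_le_left_of_le_one (add_le (add_le hJ hV) hU)
  · refine add_le ?_ (mul_le_mul' le_add_self le_add_self)
    calc J = J * 1 := (mul_one J).symm
      _ ≤ J * (J + U + V + U * V * I) := mul_le_mul' le_rfl h
      _ = J * J + U * J + J * V + U * V * (I * J) := by ring
      _ = (J + U) * (J + V) := by rw [hIJ]; ring

end IdemSemiring

/-! ### Fractional ideals of the ring of a form -/

namespace BinaryForm

section Ideals

variable {n : ℕ} (F : BinaryForm ℤ n)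

/-- The fractional ideal generated by `a`. -/
abbrev principal (a : etAlg ℚ F) : Submodule (order ℚ F) (etAlg ℚ F) :=
  Submodule.spanSingleton (order ℚ F) a

/-- The fractional ideal `(1, θ)`, which corresponds to the line bundle `𝒪(1)`. -/
def idealOne : Submodule (order ℚ F) (etAlg ℚ F) :=
  Submodule.span (order ℚ F) {1, theta ℚ F}

/-- The ideal generated by `β_0, …, β_(n-1)`. For primitive `F` it is inverse to `(1, θ)`; it is
the ideal of the zeros at infinity (`z = 0`) of the form. -/
def idealInf : Submodule (order ℚ F) (etAlg ℚ F) :=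
  Submodule.span (order ℚ F) (beta ℚ F '' Set.Iio n)

theorem mem_one_iff (x : etAlg ℚ F) :
    x ∈ (1 : Submodule (order ℚ F) (etAlg ℚ F)) ↔ x ∈ order ℚ F := by
  rw [Submodule.mem_one]
  constructor
  · rintro ⟨y, rfl⟩; exact y.2
  · intro hx; exact ⟨⟨x, hx⟩, rfl⟩

theorem mem_order_iff (x : etAlg ℚ F) : x ∈ order ℚ F ↔ x ∈ orderModule ℚ F :=
  Submodule.mem_toSubalgebra

theorem mem_principal_mul_iff {a x : etAlg ℚ F} {N : Submodule (order ℚ F) (etAlg ℚ F)} :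
    x ∈ principal F a * N ↔ ∃ y ∈ N, a * y = x := by
  rw [principal, Submodule.spanSingleton_apply, Submodule.mem_span_singleton_mul]

theorem principal_le_iff {a : etAlg ℚ F} {N : Submodule (order ℚ F) (etAlg ℚ F)} :
    principal F a ≤ N ↔ a ∈ N := by
  rw [principal, Submodule.spanSingleton_apply, Submodule.span_singleton_le_iff_mem]

theorem mem_principal_self (a : etAlg ℚ F) : a ∈ principal F a :=
  Submodule.mem_span_singleton_self a

theorem principal_one : principal F 1 = 1 := map_one _

theorem principal_intCast_le_one (m : ℤ) : principal F (m : etAlg ℚ F) ≤ 1 := by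
  rw [principal_le_iff, mem_one_iff]
  exact intCast_mem _ m

theorem one_le_principal_intCast_add {a b : ℤ} (h : IsCoprime a b) :
    1 ≤ principal F (a : etAlg ℚ F) + principal F (b : etAlg ℚ F) := by
  obtain ⟨u, v, huv⟩ := h
  rw [← principal_one, principal_le_iff]
  have e : (1 : etAlg ℚ F) =
      (u : order ℚ F) • (a : etAlg ℚ F) + (v : order ℚ F) • (b : etAlg ℚ F) := by
    rw [Algebra.smul_def, Algebra.smul_def, map_intCast, map_intCast]
    rw [← Int.cast_mul, ← Int.cast_mul, ← Int.cast_add, huv, Int.cast_one]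
  rw [e]
  exact Submodule.add_mem_sup (Submodule.smul_mem _ _ (mem_principal_self F _))
    (Submodule.smul_mem _ _ (mem_principal_self F _))

theorem one_le_idealOne : 1 ≤ idealOne F := by
  rw [← principal_one, principal_le_iff]
  exact Submodule.subset_span (by simp)

theorem theta_mem_idealOne : theta ℚ F ∈ idealOne F :=
  Submodule.subset_span (by simp)

theorem theta_pow_mem {i d : ℕ} (h : i ≤ d) : theta ℚ F ^ i ∈ idealOne F ^ d := by
  have h1 : idealOne F ^ i ≤ idealOne F ^ d := pow_le_pow_right' (one_le_idealOne F) h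
  exact h1 (Submodule.pow_mem_pow _ (theta_mem_idealOne F) i)

theorem algebraMap_mul_mem_of_mem (N : Submodule (order ℚ F) (etAlg ℚ F)) (r : ℤ) {x : etAlg ℚ F}
    (hx : x ∈ N) : (algebraMap ℤ (etAlg ℚ F) r) * x ∈ N := by
  have := N.smul_mem (algebraMap ℤ (order ℚ F) r) hx
  rwa [Algebra.smul_def, ← IsScalarTower.algebraMap_apply] at this

theorem aeval_theta_mem {φ : ℤ[X]} {d : ℕ} (h : φ.natDegree ≤ d) :
    aeval (theta ℚ F) φ ∈ idealOne F ^ d := by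
  rw [aeval_eq_sum_range]
  refine Submodule.sum_mem _ fun i hi => ?_
  rw [Algebra.smul_def]
  refine algebraMap_mul_mem_of_mem F _ _ (theta_pow_mem F ?_)
  have := Finset.mem_range.1 hi
  omega

theorem idealInf_le_one : idealInf F ≤ 1 := by
  rw [idealInf, Submodule.span_le]
  rintro _ ⟨i, hi, rfl⟩
  change _ ∈ (1 : Submodule (order ℚ F) (etAlg ℚ F))
  rw [mem_one_iff, mem_order_iff]
  exact beta_mem_orderModule F (le_of_lt hi)

theorem beta_mem_idealInf {i : ℕ} (hi : i < n) : beta ℚ F i ∈ idealInf F :=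
  Submodule.subset_span ⟨i, hi, rfl⟩

theorem idealOne_mul_idealInf_le_one : idealOne F * idealInf F ≤ 1 := by
  rw [idealOne, idealInf, Submodule.span_mul_span, Submodule.span_le]
  rintro _ ⟨x, hx, _, ⟨i, hi, rfl⟩, rfl⟩
  change _ ∈ (1 : Submodule (order ℚ F) (etAlg ℚ F))
  rw [mem_one_iff, mem_order_iff]
  rcases hx with rfl | rfl
  · simp only [one_mul]; exact beta_mem_orderModule F (le_of_lt hi)
  · simp only [theta_mul_beta]; exact zeta_mem_orderModule F hi

variable {F}

theorem idealOne_mul_idealInf (hn : 0 < n) (hF : F.IsPrimitive) :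
    idealOne F * idealInf F = 1 := by
  refine le_antisymm (idealOne_mul_idealInf_le_one F) ?_
  have hcoef : ∀ i ≤ n, algebraMap ℤ (etAlg ℚ F) (F.coef i) ∈ idealOne F * idealInf F := by
    intro i hi
    rcases Nat.eq_zero_or_pos i with rfl | hpos
    · rw [← beta_zero, ← one_mul (beta ℚ F 0)]
      exact Submodule.mul_mem_mul (one_le_idealOne F ((mem_one_iff F _).2 (one_mem _)))
        (beta_mem_idealInf F hn)
    · obtain ⟨j, rfl⟩ : ∃ j, i = j + 1 := ⟨i - 1, by omega⟩
      have e : algebraMap ℤ (etAlg ℚ F) (F.coef (j + 1)) =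
          1 * beta ℚ F (j + 1) - theta ℚ F * beta ℚ F j := by rw [beta_succ]; ring
      rw [e]
      refine Submodule.sub_mem _ ?_ (Submodule.mul_mem_mul (theta_mem_idealOne F)
        (beta_mem_idealInf F (by omega)))
      rcases hi.lt_or_eq with hlt | heq
      · exact Submodule.mul_mem_mul (one_le_idealOne F ((mem_one_iff F _).2 (one_mem _)))
          (beta_mem_idealInf F hlt)
      · rw [heq, beta_last, mul_zero]; exact Submodule.zero_mem _
  have hspan : ∀ r ∈ Ideal.span (Set.range F),
      algebraMap ℤ (etAlg ℚ F) r ∈ idealOne F * idealInf F := by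
    intro r hr
    induction hr using Submodule.span_induction with
    | mem x hx =>
      obtain ⟨i, rfl⟩ := hx
      rw [← coef_of_lt F i]
      exact hcoef _ (by omega)
    | zero => rw [map_zero]; exact Submodule.zero_mem _
    | add x y _ _ hx hy => rw [map_add]; exact Submodule.add_mem _ hx hy
    | smul c x _ hx => rw [smul_eq_mul, map_mul]; exact algebraMap_mul_mem_of_mem F _ _ hx
  rw [← principal_one, principal_le_iff, ← map_one (algebraMap ℤ (etAlg ℚ F))]
  apply hspan
  rw [hF]
  exact Submodule.mem_top

theorem algebraMap_int_ne_zero {a : ℤ} (h0 : a ≠ 0) : algebraMap ℤ ℚ a ≠ 0 := by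
  simpa using h0

/-- The residue functional is integral on `𝒪(n-2)`. -/
theorem residue_mem_range (h0 : F 0 ≠ 0) (hn : 0 < n) {d : ℕ} :
    ∀ {w : etAlg ℚ F}, w ∈ idealOne F ^ d → ∀ {i : ℕ}, i + d + 2 ≤ n →
      residue F (algebraMap_int_ne_zero h0) hn (w * theta ℚ F ^ i) ∈
        Set.range (algebraMap ℤ ℚ) := by
  induction d with
  | zero =>
    intro w hw i hi
    rw [pow_zero, mem_one_iff, mem_order_iff] at hw
    unfold orderModule at hw
    induction hw using Submodule.span_induction with
    | zero => exact ⟨0, by simp⟩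
    | add x y _ _ hx hy =>
      obtain ⟨a, ha⟩ := hx
      obtain ⟨b, hb⟩ := hy
      exact ⟨a + b, by rw [map_add, ha, hb, add_mul, map_add]⟩
    | smul c x _ hx =>
      obtain ⟨a, ha⟩ := hx
      refine ⟨c * a, ?_⟩
      rw [Algebra.smul_def, mul_assoc, algebraMap_mul_eq_smul, map_smul, map_mul, ha, smul_eq_mul]
    | mem x hx =>
      rcases hx with rfl | ⟨j, ⟨hj1, hj2⟩, rfl⟩
      · rw [one_mul, residue_theta_pow F _ hn (by omega), if_neg (by omega)]
        exact ⟨0, by simp⟩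
      · have e : zeta ℚ F j * theta ℚ F ^ i =
            theta ℚ F ^ i * beta ℚ F j - algebraMap ℤ _ (F.coef j) * theta ℚ F ^ i := by
          rw [beta]; ring
        rw [e, map_sub, algebraMap_mul_eq_smul, map_smul,
          residue_theta_pow F _ hn (by omega : i < n), if_neg (by omega : i ≠ n - 1), smul_zero,
          sub_zero, residue_theta_pow_mul_beta F _ hn (by omega) (by omega)]
        split_ifs
        · exact ⟨1, by simp⟩
        · exact ⟨0, by simp⟩
  | succ d ih =>
    intro w hw i hi
    rw [pow_succ] at hw
    induction hw using Submodule.mul_induction_on' with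
    | mem_mul_mem a ha b hb =>
      rw [idealOne] at hb
      obtain ⟨s, t, rfl⟩ := Submodule.mem_span_pair.1 hb
      have e : a * (s • 1 + t • theta ℚ F) * theta ℚ F ^ i =
          (s • a) * theta ℚ F ^ i + (t • a) * theta ℚ F ^ (i + 1) := by
        simp only [Algebra.smul_def]; ring
      obtain ⟨u, hu⟩ := ih (Submodule.smul_mem _ s ha) (i := i) (by omega)
      obtain ⟨v, hv⟩ := ih (Submodule.smul_mem _ t ha) (i := i + 1) (by omega)
      exact ⟨u + v, by rw [e, map_add, map_add, hu, hv]⟩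
    | add x _ y _ hx hy =>
      obtain ⟨a, ha⟩ := hx
      obtain ⟨b, hb⟩ := hy
      exact ⟨a + b, by rw [map_add, ha, hb, add_mul, map_add]⟩

/-- An integral polynomial of degree `d < n` whose value at `θ` lies in `p 𝒪(d)` is divisible by
`p`. -/
theorem dvd_coeff_of_aeval_mem (h0 : F 0 ≠ 0) (hF : F.IsPrimitive) {U : ℤ[X]} {d : ℕ} {p : ℤ}
    (hn2 : 2 ≤ n) (hd : d < n) (hU : U.natDegree ≤ d)
    (hm : aeval (theta ℚ F) U ∈ principal F (p : etAlg ℚ F) * idealOne F ^ d) (i : ℕ) :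
    p ∣ U.coeff i := by
  have hn : 0 < n := by omega
  rcases lt_or_ge d i with hi | hi
  · rw [coeff_eq_zero_of_natDegree_lt (by omega)]; exact dvd_zero _
  obtain ⟨y, hy, hpy⟩ := (mem_principal_mul_iff F).1 hm
  have h1 : residue F (algebraMap_int_ne_zero h0) hn (aeval (theta ℚ F) U * beta ℚ F (n - 1 - i)) =
      U.coeff i := by
    rw [aeval_eq_sum_range' (n := n) (by omega), Finset.sum_mul, map_sum,
      Finset.sum_eq_single i]
    · rw [Algebra.smul_def, mul_assoc, algebraMap_mul_eq_smul, map_smul,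
        residue_theta_pow_mul_beta F _ hn (by omega) (by omega), if_pos (by omega)]
      simp
    · intro j hj hji
      have := Finset.mem_range.1 hj
      rw [Algebra.smul_def, mul_assoc, algebraMap_mul_eq_smul, map_smul,
        residue_theta_pow_mul_beta F _ hn (by omega) (by omega), if_neg (by omega), smul_zero]
    · intro hni; exact absurd (Finset.mem_range.2 (by omega)) hni
  have h2 : y * beta ℚ F (n - 1 - i) ∈ idealOne F ^ (n - 2) := by
    have hy' : y ∈ idealOne F ^ (n - 1) := pow_le_pow_right' (one_le_idealOne F) (by omega) hy
    have : idealOne F ^ (n - 1) * idealInf F = idealOne F ^ (n - 2) := by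
      rw [show n - 1 = n - 2 + 1 by omega, pow_succ, mul_assoc, idealOne_mul_idealInf hn hF,
        mul_one]
    rw [← this]
    exact Submodule.mul_mem_mul hy' (beta_mem_idealInf F (by omega))
  obtain ⟨c, hc⟩ := residue_mem_range h0 hn h2 (i := 0) (by omega)
  rw [pow_zero, mul_one] at hc
  refine ⟨c, ?_⟩
  have h3 : ((U.coeff i : ℤ) : ℚ) = p * c := by
    rw [← h1, ← hpy, mul_assoc, ← eq_intCast (algebraMap ℤ (etAlg ℚ F)) p,
      algebraMap_mul_eq_smul, map_smul, ← hc]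
    simp
  exact_mod_cast h3

end Ideals

/-! ### Square classes, the inverse different and ideals of forms -/

section SquareClasses

variable {n : ℕ} {F : BinaryForm ℤ n}

variable (F) in
/-- A fractional ideal of `R_F` that is invertible and whose class is a square. -/
def IsSquareClass (N : Submodule (order ℚ F) (etAlg ℚ F)) : Prop :=
  ∃ U : (Submodule (order ℚ F) (etAlg ℚ F))ˣ, U.val = N ∧ IsSquare (IdealClassGroup.mk U : Cl F)

theorem IsSquareClass.mul {N N' : Submodule (order ℚ F) (etAlg ℚ F)} (h : IsSquareClass F N)
    (h' : IsSquareClass F N') : IsSquareClass F (N * N') := by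
  obtain ⟨U, rfl, hU⟩ := h
  obtain ⟨V, rfl, hV⟩ := h'
  exact ⟨U * V, rfl, by rw [map_mul]; exact hU.mul hV⟩

theorem IsSquareClass.pow {N : Submodule (order ℚ F) (etAlg ℚ F)} (h : IsSquareClass F N)
    (e : ℕ) : IsSquareClass F (N ^ e) := by
  obtain ⟨U, rfl, hU⟩ := h
  exact ⟨U ^ e, rfl, by rw [map_pow]; exact hU.pow e⟩

theorem isSquareClass_sq {N : Submodule (order ℚ F) (etAlg ℚ F)} (h : IsUnit N) :
    IsSquareClass F (N ^ 2) := by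
  obtain ⟨U, rfl⟩ := h
  exact ⟨U ^ 2, rfl, by rw [map_pow]; exact IsSquare.sq _⟩

theorem isSquareClass_principal {a : etAlg ℚ F} (h : IsUnit a) :
    IsSquareClass F (principal F a) := by
  obtain ⟨u, rfl⟩ := h
  refine ⟨Units.map (Submodule.spanSingleton (order ℚ F)).toMonoidHom u, rfl, ?_⟩
  have : (IdealClassGroup.mk (Units.map
      (Submodule.spanSingleton (A := etAlg ℚ F) (order ℚ F)).toMonoidHom u) : Cl F) = 1 :=
    (QuotientGroup.eq_one_iff _).2 ⟨u, rfl⟩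
  rw [this]
  exact IsSquare.one

theorem IsSquareClass.of_mul_left {N N' : Submodule (order ℚ F) (etAlg ℚ F)}
    (h : IsSquareClass F (N * N')) (h' : IsSquareClass F N') : IsSquareClass F N := by
  obtain ⟨U, hU, hUs⟩ := h
  obtain ⟨V, rfl, hV⟩ := h'
  refine ⟨U * V⁻¹, ?_, by rw [map_mul, map_inv]; exact hUs.mul hV.inv⟩
  rw [Units.val_mul, hU, mul_assoc, Units.mul_inv, mul_one]

/-- An odd power differs from the base by a square. -/
theorem IsSquareClass.of_odd_pow {N : Submodule (order ℚ F) (etAlg ℚ F)} {e : ℕ} (he : Odd e)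
    (h : IsSquareClass F (N ^ e)) : IsSquareClass F N := by
  obtain ⟨c, rfl⟩ := he
  have hN : IsUnit N := by
    obtain ⟨U, hU, -⟩ := h
    refine isUnit_of_dvd_unit (dvd_pow_self N (by omega : 2 * c + 1 ≠ 0)) ⟨U, hU⟩
  rw [pow_succ', pow_mul] at h
  exact h.of_mul_left ((isSquareClass_sq hN).pow c)

theorem isUnit_intCast_etAlg {m : ℤ} (hm : m ≠ 0) : IsUnit (m : etAlg ℚ F) := by
  rw [← map_intCast (algebraMap ℚ (etAlg ℚ F))]
  exact (IsUnit.mk0 _ (by exact_mod_cast hm)).map _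

variable (h0 : F 0 ≠ 0) (hF : F.IsPrimitive)

include h0 in
/-- `(1, θ)^(n-2)` is the dual of `R_F` for the residue pairing. -/
theorem mem_idealOne_pow_iff (hn : 2 ≤ n) (w : etAlg ℚ F) :
    w ∈ idealOne F ^ (n - 2) ↔ ∀ y ∈ order ℚ F,
      residue F (algebraMap_int_ne_zero h0) (by omega) (w * y) ∈ Set.range (algebraMap ℤ ℚ) := by
  constructor
  · intro hw y hy
    have h1 : w * y ∈ idealOne F ^ (n - 2) := by
      have := Submodule.smul_mem _ (⟨y, hy⟩ : order ℚ F) hw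
      rwa [Subalgebra.smul_def, smul_eq_mul, mul_comm] at this
    have := residue_mem_range h0 (by omega) h1 (i := 0) (by omega)
    rwa [pow_zero, mul_one] at this
  · intro hw
    rw [eq_sum_residue_mul_beta F (algebraMap_int_ne_zero h0) (by omega) w]
    refine Submodule.sum_mem _ fun j hj => ?_
    have hjn := Finset.mem_range.1 hj
    rcases Nat.lt_or_ge j (n - 1) with hlt | hge
    · obtain ⟨c, hc⟩ := hw (beta ℚ F (n - 1 - j))
        ((mem_order_iff F _).2 (beta_mem_orderModule F (by omega)))
      rw [← hc, ← algebraMap_mul_eq_smul]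
      exact algebraMap_mul_mem_of_mem F _ _ (theta_pow_mem F (by omega))
    · obtain rfl : j = n - 1 := by omega
      obtain ⟨c, hc⟩ := hw 1 (one_mem _)
      -- only `f_0 θ^(n-1)`, not `θ^(n-1)` itself, lies in `𝒪(n-2)`
      have e1 : algebraMap ℤ (etAlg ℚ F) (F.coef 0) * theta ℚ F ^ (n - 1) ∈
          idealOne F ^ (n - 2) := by
        have e2 : algebraMap ℤ (etAlg ℚ F) (F.coef 0) * theta ℚ F ^ (n - 1) =
            beta ℚ F (n - 1) - ∑ j ∈ Finset.range (n - 1),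
              algebraMap ℤ (etAlg ℚ F) (F.coef (j + 1)) * theta ℚ F ^ (n - 1 - (j + 1)) := by
          rw [beta_eq_sum, Finset.sum_range_succ', Nat.sub_zero]
          ring
        rw [e2]
        refine Submodule.sub_mem _ ?_ (Submodule.sum_mem _ fun i hi => ?_)
        · have h1 : (1 : Submodule (order ℚ F) (etAlg ℚ F)) ≤ idealOne F ^ (n - 2) :=
            one_le_pow_of_one_le' (one_le_idealOne F) _
          exact h1 ((mem_one_iff F _).2
            ((mem_order_iff F _).2 (beta_mem_orderModule F (by omega))))
        · exact algebraMap_mul_mem_of_mem F _ _ (theta_pow_mem F (by omega))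
      rw [Nat.sub_self, beta_zero, mul_comm w, algebraMap_mul_eq_smul, map_smul, ← mul_one w, ← hc,
        smul_eq_mul, ← map_mul, ← algebraMap_mul_eq_smul, mul_comm (F.coef 0), map_mul, mul_assoc]
      exact algebraMap_mul_mem_of_mem F _ _ e1

include h0 in
/-- The inverse different is `F'(θ)⁻¹ (1, θ)^(n-2)`. -/
theorem principal_mul_inverseDifferent (hn : 2 ≤ n) (hs : F.IsSeparable ℚ) :
    principal F (aeval (theta ℚ F) (derivative (dehomog F))) * inverseDifferent F =
      idealOne F ^ (n - 2) := by
  obtain ⟨u, hu⟩ := isUnit_aeval_theta_derivative F hs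
  have key : ∀ x, x ∈ inverseDifferent F ↔ (u : etAlg ℚ F) * x ∈ idealOne F ^ (n - 2) := by
    intro x
    rw [mem_idealOne_pow_iff h0 hn]
    refine forall₂_congr fun y _ => ?_
    rw [trace_eq_residue F (algebraMap_int_ne_zero h0) (by omega), ← hu, mul_assoc]
  rw [← hu]
  ext w
  rw [mem_principal_mul_iff]
  constructor
  · rintro ⟨x, hx, rfl⟩; exact (key x).1 hx
  · intro hw
    refine ⟨(u⁻¹ : (etAlg ℚ F)ˣ) * w, (key _).2 ?_, ?_⟩
    · rwa [Units.mul_inv_cancel_left]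
    · rw [Units.mul_inv_cancel_left]

include h0 hF in
/-- As `idealInf F` is inverse to `(1, θ)`, the inverse different is, up to principal ideals, a
power of `idealInf F`. -/
theorem inverseDifferentIsSquare_of_idealInf (hn3 : 3 ≤ n) (hs : F.IsSeparable ℚ)
    (h : IsSquareClass F (idealInf F)) : F.InverseDifferentIsSquare := by
  have hI : IsSquareClass F (idealOne F) := by
    refine IsSquareClass.of_mul_left (N' := idealInf F) ?_ h
    rw [idealOne_mul_idealInf (by omega) hF, ← principal_one]
    exact isSquareClass_principal isUnit_one
  have h1 : IsSquareClass F (inverseDifferent F) := by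
    refine IsSquareClass.of_mul_left (N' := principal F _) ?_
      (isSquareClass_principal (isUnit_aeval_theta_derivative F hs))
    rw [mul_comm, principal_mul_inverseDifferent h0 (by omega) hs]
    exact hI.pow _
  exact h1

end SquareClasses

section Forms

variable {n : ℕ} (F : BinaryForm ℤ n)

/-- The fractional ideal `φ(θ) (1, θ)^(-d)` cut out by `φ`, regarded as a binary form of
degree `d`. The negative power of `(1, θ)` is written as a power of `idealInf F`, its inverse when
`F` is primitive. -/
def formIdeal (φ : ℤ[X]) (d : ℕ) : Submodule (order ℚ F) (etAlg ℚ F) :=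
  principal F (aeval (theta ℚ F) φ) * idealInf F ^ d

variable {F}

theorem principal_add_le (a b : etAlg ℚ F) :
    principal F (a + b) ≤ principal F a + principal F b := by
  rw [principal_le_iff]
  exact Submodule.add_mem_sup (mem_principal_self F a) (mem_principal_self F b)

theorem principal_neg (a : etAlg ℚ F) : principal F (-a) = principal F a := by
  apply le_antisymm <;> rw [principal_le_iff]
  · exact Submodule.neg_mem _ (mem_principal_self F a)
  · rw [← Submodule.neg_mem_iff]; exact mem_principal_self F (-a)

theorem formIdeal_mul (φ ψ : ℤ[X]) (c d : ℕ) :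
    formIdeal F (φ * ψ) (c + d) = formIdeal F φ c * formIdeal F ψ d := by
  rw [formIdeal, formIdeal, formIdeal, map_mul, principal, map_mul, pow_add]
  ring

theorem formIdeal_C (m : ℤ) : formIdeal F (C m) 0 = principal F (m : etAlg ℚ F) := by
  simp [formIdeal]

theorem formIdeal_add_le (φ ψ : ℤ[X]) (d : ℕ) :
    formIdeal F (φ + ψ) d ≤ formIdeal F φ d + formIdeal F ψ d := by
  rw [formIdeal, formIdeal, formIdeal, map_add, ← add_mul]
  exact mul_le_mul' (principal_add_le _ _) le_rfl

variable (hn : 0 < n) (hF : F.IsPrimitive)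
include hn hF

theorem idealOne_pow_mul_idealInf_pow (d : ℕ) : idealOne F ^ d * idealInf F ^ d = 1 := by
  rw [← mul_pow, idealOne_mul_idealInf hn hF, one_pow]

theorem formIdeal_le_one {φ : ℤ[X]} {d : ℕ} (h : φ.natDegree ≤ d) : formIdeal F φ d ≤ 1 := by
  rw [← idealOne_pow_mul_idealInf_pow hn hF d]
  exact mul_le_mul' ((principal_le_iff F).2 (aeval_theta_mem F h)) le_rfl

/-- A form whose leading coefficient is prime to `m` has no zero at infinity modulo `m`. -/
theorem one_le_formIdeal_add_idealInf_add {φ : ℤ[X]} {d : ℕ} {m : ℤ} (h : φ.natDegree ≤ d)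
    (hm : IsCoprime (φ.coeff d) m) :
    1 ≤ formIdeal F φ d + idealInf F + principal F (m : etAlg ℚ F) := by
  have key : principal F ((φ.coeff d : ℤ) : etAlg ℚ F) ≤ formIdeal F φ d + idealInf F := by
    rcases d with - | d
    · rw [eq_C_of_natDegree_le_zero h, coeff_C_zero, formIdeal_C]
      exact le_self_add
    · have hI : ∀ d, idealOne F ^ (d + 1) ≤ principal F (theta ℚ F ^ (d + 1)) + idealOne F ^ d := by
        intro d
        have hI1 : idealOne F ≤ principal F (theta ℚ F) + 1 := by
          rw [idealOne, Submodule.span_le]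
          rintro x (rfl | rfl)
          · exact (le_add_self : (1 : Submodule (order ℚ F) (etAlg ℚ F)) ≤ _)
              ((mem_one_iff F _).2 (one_mem _))
          · exact (le_self_add : _ ≤ principal F (theta ℚ F) + 1) (mem_principal_self F _)
        induction d with
        | zero => rw [zero_add, pow_one, pow_one, pow_zero]; exact hI1
        | succ d ih =>
          have h1 : principal F (theta ℚ F) * idealOne F ^ d ≤ idealOne F ^ (d + 1) := by
            rw [pow_succ']
            exact mul_le_mul' ((principal_le_iff F).2 (theta_mem_idealOne F)) le_rfl
          calc idealOne F ^ (d + 1 + 1) = idealOne F * idealOne F ^ (d + 1) := pow_succ' _ _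
            _ ≤ (principal F (theta ℚ F) + 1) * idealOne F ^ (d + 1) := mul_le_mul' hI1 le_rfl
            _ = principal F (theta ℚ F) * idealOne F ^ (d + 1) + idealOne F ^ (d + 1) := by ring
            _ ≤ principal F (theta ℚ F) * (principal F (theta ℚ F ^ (d + 1)) + idealOne F ^ d)
                + idealOne F ^ (d + 1) := by gcongr
            _ = principal F (theta ℚ F) * principal F (theta ℚ F ^ (d + 1)) +
                (principal F (theta ℚ F) * idealOne F ^ d + idealOne F ^ (d + 1)) := by ring
            _ ≤ _ := by
              refine add_le_add (le_of_eq ?_) (add_le h1 le_rfl)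
              rw [pow_succ' (theta ℚ F) (d + 1), principal, principal, principal, map_mul]
      have h1 : principal F (aeval (theta ℚ F) (φ - C (φ.coeff (d + 1)) * X ^ (d + 1))) ≤
          idealOne F ^ d := by
        refine (principal_le_iff F).2 (aeval_theta_mem F ?_)
        rw [natDegree_le_iff_coeff_eq_zero] at h ⊢
        intro i hi
        rw [coeff_sub, coeff_C_mul_X_pow]
        split_ifs with hid
        · rw [hid, sub_self]
        · rw [h i (by omega), sub_zero]
      have h2 : principal F ((φ.coeff (d + 1) : ℤ) : etAlg ℚ F) *
          principal F (theta ℚ F ^ (d + 1)) ≤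
          principal F (aeval (theta ℚ F) φ) + idealOne F ^ d := by
        have e : ((φ.coeff (d + 1) : ℤ) : etAlg ℚ F) * theta ℚ F ^ (d + 1) =
            aeval (theta ℚ F) φ +
              -aeval (theta ℚ F) (φ - C (φ.coeff (d + 1)) * X ^ (d + 1)) := by
          simp
        rw [principal, principal, ← map_mul, e]
        refine (principal_add_le _ _).trans ?_
        rw [principal_neg]
        gcongr
      have h3 := idealOne_pow_mul_idealInf_pow hn hF (d + 1)
      have h4 : idealOne F ^ d * idealInf F ^ (d + 1) = idealInf F := by
        rw [pow_succ, ← mul_assoc, idealOne_pow_mul_idealInf_pow hn hF, one_mul]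
      calc principal F ((φ.coeff (d + 1) : ℤ) : etAlg ℚ F)
          = principal F ((φ.coeff (d + 1) : ℤ) : etAlg ℚ F) *
            (idealOne F ^ (d + 1) * idealInf F ^ (d + 1)) := by rw [h3, mul_one]
        _ ≤ principal F ((φ.coeff (d + 1) : ℤ) : etAlg ℚ F) *
            ((principal F (theta ℚ F ^ (d + 1)) + idealOne F ^ d) * idealInf F ^ (d + 1)) := by
          gcongr; exact hI d
        _ = (principal F ((φ.coeff (d + 1) : ℤ) : etAlg ℚ F) * principal F (theta ℚ F ^ (d + 1)) +
              principal F ((φ.coeff (d + 1) : ℤ) : etAlg ℚ F) * idealOne F ^ d) *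
              idealInf F ^ (d + 1) := by ring
        _ ≤ (principal F (aeval (theta ℚ F) φ) + idealOne F ^ d) * idealInf F ^ (d + 1) := by
          exact mul_le_mul' (add_le h2 ((mul_le_right_of_le_one
            (principal_intCast_le_one F _)).trans le_add_self)) le_rfl
        _ = formIdeal F φ (d + 1) + idealInf F := by rw [add_mul, h4, formIdeal]
  exact (one_le_principal_intCast_add F hm).trans (by gcongr)

/-- If `F ≡ κ z^e H² mod m` with `e` odd and the three forms `z` (when `e ≥ 2`), `H` and
`(F - κ z^e H²) / m` do not meet modulo `m`, then the ideal `(m) + idealInf F` is a square class: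
its `e`-th power times a square is `(m)`. -/
theorem isSquareClass_idealInf_add_principal {m κ : ℤ} (hm0 : m ≠ 0) (hκ : IsCoprime κ m)
    {e h : ℕ} (he : Odd e) (hdeg : e + 2 * h = n) {H G : ℤ[X]} (hH : H.natDegree ≤ h)
    (hHlead : IsCoprime (H.coeff h) m) (hG : G.natDegree ≤ n)
    (hrel : dehomog F = C κ * H ^ 2 + C m * G)
    (hco : ∃ A B E : ℤ[X], A * G + B * H + C m * E = 1)
    (h4 : e = 1 ∨ IsCoprime (G.coeff n) m) :
    IsSquareClass F (idealInf F + principal F (m : etAlg ℚ F)) := by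
  have hJ := idealInf_le_one F
  have e1 : principal F (κ : etAlg ℚ F) * (formIdeal F H h ^ 2 * idealInf F ^ e) =
      principal F (m : etAlg ℚ F) * formIdeal F G n := by
    have e2 : (κ : etAlg ℚ F) * aeval (theta ℚ F) H ^ 2 =
        -((m : etAlg ℚ F) * aeval (theta ℚ F) G) := by
      have := congrArg (aeval (theta ℚ F)) hrel
      rw [aeval_theta_dehomog] at this
      rw [eq_neg_iff_add_eq_zero]
      simpa using this.symm
    calc _ = principal F (κ : etAlg ℚ F) * principal F (aeval (theta ℚ F) H) ^ 2 *
          idealInf F ^ (e + 2 * h) := by rw [formIdeal]; ring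
      _ = principal F ((κ : etAlg ℚ F) * aeval (theta ℚ F) H ^ 2) * idealInf F ^ n := by
        rw [hdeg, principal, principal, principal, map_mul, map_pow]
      _ = _ := by
        rw [e2, principal_neg, formIdeal, principal, principal, principal, map_mul, mul_assoc]
  have h2 : ∃ N : ℕ, idealInf F ^ N ≤
      formIdeal F G n + formIdeal F H h + principal F (m : etAlg ℚ F) := by
    obtain ⟨A, B, E, hABE⟩ := hco
    set a := A.natDegree
    set b := B.natDegree
    set c := E.natDegree
    have hle : ∀ (P Q : ℤ[X]) (k l N : ℕ), P.natDegree ≤ k → k + l ≤ N →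
        formIdeal F (P * Q) N ≤ formIdeal F Q l := by
      intro P Q k l N hP hN
      obtain ⟨r, rfl⟩ := Nat.exists_eq_add_of_le hN
      rw [show k + l + r = (k + r) + l by ring, formIdeal_mul]
      exact mul_le_right_of_le_one (formIdeal_le_one hn hF (by omega))
    refine ⟨a + b + c + n + h, ?_⟩
    have h1 : idealInf F ^ (a + b + c + n + h) = formIdeal F 1 (a + b + c + n + h) := by
      rw [formIdeal, map_one, principal_one, one_mul]
    rw [h1, ← hABE]
    refine (formIdeal_add_le _ _ _).trans (add_le_add ((formIdeal_add_le _ _ _).trans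
      (add_le_add (hle _ _ a _ _ le_rfl (by omega)) (hle _ _ b _ _ le_rfl (by omega)))) ?_)
    rw [mul_comm, ← formIdeal_C]
    exact hle _ _ c _ _ le_rfl (by omega)
  obtain ⟨N, h2⟩ := h2
  have key := add_sq_mul_add_pow_eq (principal_intCast_le_one F m) hJ (formIdeal_le_one hn hF hH)
    (formIdeal_le_one hn hF hG) (principal_intCast_le_one F κ) (one_le_principal_intCast_add F hκ)
    he.pos e1 h2 (one_le_formIdeal_add_idealInf_add hn hF hH hHlead)
    (h4.imp_right fun h => one_le_formIdeal_add_idealInf_add hn hF hG h)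
  have hP := isSquareClass_principal (F := F) (isUnit_intCast_etAlg hm0)
  have hunit : IsUnit (principal F (m : etAlg ℚ F)) := by
    obtain ⟨U, hU, -⟩ := hP; exact ⟨U, hU⟩
  have hq : IsUnit (principal F (m : etAlg ℚ F) + formIdeal F H h) := by
    rw [← key] at hunit
    exact isUnit_of_dvd_unit ((dvd_pow_self _ two_ne_zero).trans (dvd_mul_right _ _)) hunit
  refine IsSquareClass.of_odd_pow he (IsSquareClass.of_mul_left ?_ (isSquareClass_sq hq))
  rw [mul_comm, key]
  exact hP

end Forms

/-! ### Overorders -/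

section NonMaximal

variable {n : ℕ} {F : BinaryForm ℤ n}

theorem fg_orderModule : (orderModule ℚ F).FG :=
  Submodule.fg_span (((Set.finite_Icc 1 (n - 1)).image _).insert 1)

/-- A form in the square of the ideal `(φ, p)` is not maximal at `p`: the fractional ideal
`T = p⁻¹ φ ψ (1, θ)^(-(n - δ))` satisfies `T² ⊆ R_F + T`, so that `R_F + T` is a larger order. -/
theorem exists_isIntegral_not_mem_order (h0 : F 0 ≠ 0) (hn2 : 2 ≤ n) (hF : F.IsPrimitive) {p : ℤ}
    (hp0 : p ≠ 0) (hp : ¬ IsUnit p) {δ : ℕ} (hδ : 1 ≤ δ) (hδn : 2 * δ ≤ n) {φ ψ G₁ G₂ : ℤ[X]}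
    (hφ : φ.natDegree ≤ δ) (hψ : ψ.natDegree ≤ n - 2 * δ) (hG₁ : G₁.natDegree ≤ n - δ)
    (hG₂ : G₂.natDegree ≤ n)
    (hrel : dehomog F = φ ^ 2 * ψ + C p * φ * G₁ + C p ^ 2 * G₂) :
    ∃ x : etAlg ℚ F, IsIntegral ℤ x ∧ (p : etAlg ℚ F) * x ∈ order ℚ F ∧ x ∉ order ℚ F := by
  have hn : 0 < n := by omega
  obtain ⟨u, hu⟩ := isUnit_intCast_etAlg (F := F) hp0
  set a : etAlg ℚ F := ((u⁻¹ : (etAlg ℚ F)ˣ) : etAlg ℚ F) with ha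
  have hpa : (p : etAlg ℚ F) * a = 1 := by rw [← hu, ha, Units.mul_inv]
  set f := aeval (theta ℚ F) φ with hf
  set g := aeval (theta ℚ F) ψ with hg
  set g₁ := aeval (theta ℚ F) G₁ with hg₁
  set g₂ := aeval (theta ℚ F) G₂ with hg₂
  have hθ : f ^ 2 * g + p * f * g₁ + p ^ 2 * g₂ = 0 := by
    have := congrArg (aeval (theta ℚ F)) hrel
    rw [aeval_theta_dehomog] at this
    simpa using this.symm
  have hdeg : (φ * ψ).natDegree ≤ n - δ := natDegree_mul_le.trans (by omega)
  set T := principal F (a * (f * g)) * idealInf F ^ (n - δ) with hT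
  have hpT : principal F (p : etAlg ℚ F) * T ≤ 1 := by
    have : principal F (p : etAlg ℚ F) * T = formIdeal F (φ * ψ) (n - δ) := by
      have e : aeval (theta ℚ F) (φ * ψ) = p * (a * (f * g)) := by
        rw [← mul_assoc, hpa, one_mul, map_mul]
      rw [formIdeal, e, hT, ← mul_assoc, principal, principal, principal, map_mul _ (p : etAlg ℚ F)]
    rw [this]
    exact formIdeal_le_one hn hF hdeg
  have hTT : T * T ≤ 1 + T := by
    have e1 : a * (f * g) * (a * (f * g)) = -(a * (f * g) * g₁ + g * g₂) := by
      have e2 : a * (f * g) * (a * (f * g)) + (a * (f * g) * g₁ + g * g₂) =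
          a ^ 2 * g * (f ^ 2 * g + p * f * g₁ + p ^ 2 * g₂)
            + (1 - p * a) * a * f * g * g₁ + (1 - p * a) * (1 + p * a) * g * g₂ := by ring
      rw [eq_neg_iff_add_eq_zero, e2, hθ, hpa]
      ring
    have e2 : T * T = principal F (a * (f * g) * (a * (f * g))) *
        (idealInf F ^ (n - δ) * idealInf F ^ (n - δ)) := by
      rw [hT, principal, principal, map_mul _ (a * (f * g)) (a * (f * g))]; ring
    rw [e2, e1, principal_neg]
    refine (mul_le_mul' (principal_add_le _ _) le_rfl).trans ?_
    rw [add_mul, add_comm]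
    refine add_le_add ?_ ?_
    · have : principal F (g * g₂) * (idealInf F ^ (n - δ) * idealInf F ^ (n - δ)) =
          formIdeal F (ψ * G₂) ((n - 2 * δ) + n) := by
        rw [← pow_add, formIdeal, map_mul]
        congr 2
        omega
      rw [this]
      exact formIdeal_le_one hn hF (natDegree_mul_le.trans (by omega))
    · have : principal F (a * (f * g) * g₁) * (idealInf F ^ (n - δ) * idealInf F ^ (n - δ)) =
          T * formIdeal F G₁ (n - δ) := by
        rw [hT, formIdeal, principal, principal, principal, map_mul _ (a * (f * g)) g₁]; ring
      rw [this]
      exact mul_le_left_of_le_one (formIdeal_le_one hn hF hG₁)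
  have hM : (1 + T) * (1 + T) ≤ 1 + T := by
    have : (1 + T) * (1 + T) = 1 + T + (T + T * T) := by ring
    rw [this]
    exact add_le le_rfl (add_le le_add_self hTT)
  -- the order `R_F + T`
  let S : Subalgebra ℤ (etAlg ℚ F) := ((1 + T).restrictScalars ℤ).toSubalgebra
    ((le_self_add : 1 ≤ 1 + T) ((mem_one_iff F _).2 (one_mem _)))
    (fun x y hx hy => hM (Submodule.mul_mem_mul hx hy))
  have hpS : ∀ x ∈ 1 + T, (p : etAlg ℚ F) * x ∈ order ℚ F := by
    intro x hx
    rw [← mem_one_iff]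
    have h1 : principal F (p : etAlg ℚ F) * (1 + T) ≤ 1 := by
      rw [mul_add, mul_one]
      exact add_le (principal_intCast_le_one F p) hpT
    exact h1 (Submodule.mul_mem_mul (mem_principal_self F _) hx)
  have hSfg : (Subalgebra.toSubmodule S).FG := by
    refine Submodule.FG.of_le ((fg_orderModule (F := F)).map (LinearMap.mulLeft ℤ a)) ?_
    intro x hx
    refine ⟨(p : etAlg ℚ F) * x, (mem_order_iff F _).1 (hpS x hx), ?_⟩
    rw [LinearMap.mulLeft_apply, ← mul_assoc, mul_comm a, hpa, one_mul]
  by_contra hcon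
  push Not at hcon
  have hT1 : T ≤ 1 := by
    intro x hx
    have hx' : x ∈ 1 + T := (le_add_self : T ≤ 1 + T) hx
    rw [mem_one_iff]
    exact hcon x (IsIntegral.of_mem_of_fg S hSfg x hx') (hpS x hx')
  have h1 : a * (f * g) ∈ idealOne F ^ (n - δ) := by
    rw [← principal_le_iff]
    calc principal F (a * (f * g)) = idealOne F ^ (n - δ) * T := by
          rw [hT, mul_left_comm (idealOne F ^ (n - δ)), idealOne_pow_mul_idealInf_pow hn hF,
            mul_one]
      _ ≤ idealOne F ^ (n - δ) := mul_le_left_of_le_one hT1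
  have h2 : aeval (theta ℚ F) (φ * ψ) ∈ principal F (p : etAlg ℚ F) * idealOne F ^ (n - δ) := by
    have : aeval (theta ℚ F) (φ * ψ) = p * (a * (f * g)) := by
      rw [← mul_assoc, hpa, one_mul, map_mul]
    rw [this]
    exact Submodule.mul_mem_mul (mem_principal_self F _) h1
  have h3 : C p ∣ φ * ψ := (C_dvd_iff_dvd_coeff _ _).2
    (dvd_coeff_of_aeval_mem h0 hF hn2 (by omega) hdeg h2)
  have h4 : C p ∣ dehomog F := by
    rw [hrel]
    refine dvd_add (dvd_add ?_ ?_) ?_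
    · rw [pow_two, mul_assoc]; exact h3.mul_left _
    · rw [mul_assoc]; exact dvd_mul_right _ _
    · rw [pow_two, mul_assoc]; exact dvd_mul_right _ _
  have h5 : Ideal.span (Set.range F) ≤ Ideal.span {p} := by
    rw [Ideal.span_le]
    rintro _ ⟨i, rfl⟩
    rw [SetLike.mem_coe, Ideal.mem_span_singleton, ← coef_of_lt F i,
      ← coeff_dehomog F (by omega : (i : ℕ) ≤ n)]
    exact (C_dvd_iff_dvd_coeff _ _).1 h4 _
  have hF' : Ideal.span (Set.range F) = ⊤ := hF
  rw [hF', top_le_iff, Ideal.span_singleton_eq_top] at h5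
  exact hp h5

end NonMaximal

/-! ### Coordinates and base change to `ℤ_p` -/

section Coordinates

variable {R : Type*} {K : Type*} [CommRing R] [Field K] [Algebra R K] {n : ℕ}
  {F : BinaryForm R n}

theorem exists_eq_of_mem_orderModule {y : etAlg K F} (hy : y ∈ orderModule K F) :
    ∃ c : ℕ → R, y = algebraMap R _ (c 0) +
      ∑ i ∈ Finset.Icc 1 (n - 1), algebraMap R _ (c i) * zeta K F i := by
  obtain ⟨a, z, hz, rfl⟩ := Submodule.mem_span_insert.1 hy
  rw [← Finset.coe_Icc] at hz
  obtain ⟨c, hc⟩ := Submodule.mem_span_image_finset_iff_exists_fun' R |>.1 hz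
  refine ⟨fun i => if i = 0 then a else c i, ?_⟩
  simp only [if_true]
  rw [← hc, Algebra.smul_def, mul_one]
  congr 1
  refine Finset.sum_congr rfl fun i hi => ?_
  have := Finset.mem_Icc.1 hi
  rw [if_neg (by omega), Algebra.smul_def]

/-- The residue pairing with powers of `θ` recovers the coordinates with respect to
`1, ζ_1, …, ζ_(n-1)`. -/
theorem residue_mul_theta_pow (h : algebraMap R K (F 0) ≠ 0) (hn : 0 < n) (c : ℕ → R) {j : ℕ}
    (hj1 : 1 ≤ j) (hj : j < n) :
    residue F h hn ((algebraMap R _ (c 0) +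
      ∑ i ∈ Finset.Icc 1 (n - 1), algebraMap R _ (c i) * zeta K F i) * theta K F ^ (n - 1 - j)) =
      algebraMap R K (c j) := by
  have h1 : residue F h hn (theta K F ^ (n - 1 - j)) = 0 := by
    rw [residue_theta_pow F h hn (by omega), if_neg (by omega)]
  rw [add_mul, map_add, algebraMap_mul_eq_smul, map_smul, h1, smul_zero, zero_add, Finset.sum_mul,
    map_sum, Finset.sum_eq_single j]
  · have e : algebraMap R (etAlg K F) (c j) * zeta K F j * theta K F ^ (n - 1 - j) =
        algebraMap R (etAlg K F) (c j) * (theta K F ^ (n - 1 - j) * beta K F j -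
          algebraMap R (etAlg K F) (F.coef j) * theta K F ^ (n - 1 - j)) := by rw [beta]; ring
    rw [e, algebraMap_mul_eq_smul, map_smul, map_sub, algebraMap_mul_eq_smul, map_smul, h1,
      residue_theta_pow_mul_beta F h hn (by omega) hj, if_pos (by omega)]
    simp
  · intro i hi hij
    have := Finset.mem_Icc.1 hi
    have e : algebraMap R (etAlg K F) (c i) * zeta K F i * theta K F ^ (n - 1 - j) =
        algebraMap R (etAlg K F) (c i) * (theta K F ^ (n - 1 - j) * beta K F i -
          algebraMap R (etAlg K F) (F.coef i) * theta K F ^ (n - 1 - j)) := by rw [beta]; ring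
    rw [e, algebraMap_mul_eq_smul, map_smul, map_sub, algebraMap_mul_eq_smul, map_smul, h1,
      residue_theta_pow_mul_beta F h hn (by omega) (by omega), if_neg (by omega)]
    simp
  · intro hni
    exact absurd (Finset.mem_Icc.2 ⟨hj1, by omega⟩) hni

theorem coord_unique [IsDomain R] [FaithfulSMul R K] (h : algebraMap R K (F 0) ≠ 0) (hn : 0 < n)
    {c d : ℕ → R}
    (hcd : algebraMap R (etAlg K F) (c 0) +
      ∑ i ∈ Finset.Icc 1 (n - 1), algebraMap R _ (c i) * zeta K F i = algebraMap R _ (d 0) +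
      ∑ i ∈ Finset.Icc 1 (n - 1), algebraMap R _ (d i) * zeta K F i) {j : ℕ} (hj : j < n) :
    c j = d j := by
  have hinj := FaithfulSMul.algebraMap_injective R K
  have h1 : ∀ i, 1 ≤ i → i < n → c i = d i := by
    intro i hi1 hi
    apply hinj
    rw [← residue_mul_theta_pow h hn c hi1 hi, ← residue_mul_theta_pow h hn d hi1 hi, hcd]
  rcases Nat.eq_zero_or_pos j with rfl | hpos
  · have h2 : algebraMap R (etAlg K F) (c 0) = algebraMap R _ (d 0) := by
      have : ∑ i ∈ Finset.Icc 1 (n - 1), algebraMap R _ (c i) * zeta K F i =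
          ∑ i ∈ Finset.Icc 1 (n - 1), algebraMap R _ (d i) * zeta K F i := by
        refine Finset.sum_congr rfl fun i hi => ?_
        have := Finset.mem_Icc.1 hi
        rw [h1 i this.1 (by omega)]
      rw [this] at hcd
      exact add_right_cancel hcd
    have h3 := congrArg (fun x => residue F h hn (x * theta K F ^ (n - 1))) h2
    rw [algebraMap_mul_eq_smul, algebraMap_mul_eq_smul, map_smul, map_smul,
      residue_theta_pow F h hn (by omega), if_pos rfl, smul_eq_mul, smul_eq_mul] at h3
    exact hinj (mul_right_cancel₀ (inv_ne_zero h) h3)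
  · exact h1 j hpos hj

end Coordinates

section Transfer

variable {n : ℕ} {F : BinaryForm ℤ n} (p : ℕ) [Fact p.Prime]

omit [Fact p.Prime] in
theorem aeval_dehomog_map {S T A : Type*} [CommRing S] [CommRing T] [CommRing A] [Algebra T A]
    (φ : S →+* T) (G : BinaryForm S n) (t : A) :
    aeval t (dehomog (G.map φ)) = eval₂ ((algebraMap T A).comp φ) t (dehomog G) := by
  rw [dehomog_map, aeval_def, eval₂_map]

variable (F) in
/-- The base change `K_F → K_F ⊗ ℚ_p`. -/
def toPadic : etAlg ℚ F →+* etAlg ℚ_[p] (F.map (Int.castRingHom ℤ_[p])) :=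
  AdjoinRoot.lift ((algebraMap ℚ_[p] _).comp (algebraMap ℚ ℚ_[p]))
    (theta ℚ_[p] (F.map (Int.castRingHom ℤ_[p]))) (by
      have h := aeval_theta_dehomog (K := ℚ_[p]) (F.map (Int.castRingHom ℤ_[p]))
      rw [aeval_dehomog_map] at h
      rw [eval₂_map, ← h]
      congr 1)

theorem toPadic_theta : toPadic F p (theta ℚ F) = theta ℚ_[p] (F.map (Int.castRingHom ℤ_[p])) :=
  AdjoinRoot.lift_root _

theorem toPadic_algebraMap (r : ℤ) : toPadic F p (algebraMap ℤ _ r) =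
    algebraMap ℤ_[p] _ (Int.castRingHom ℤ_[p] r) := by
  simp

theorem toPadic_zeta (i : ℕ) :
    toPadic F p (zeta ℚ F i) = zeta ℚ_[p] (F.map (Int.castRingHom ℤ_[p])) i := by
  rw [zeta, zeta, map_sum]
  refine Finset.sum_congr rfl fun j _ => ?_
  rw [map_mul, map_pow, toPadic_theta, toPadic_algebraMap, coef_map]

/-- If `F` is maximal over `ℤ_p`, then `R_F` has no overorder of `p`-power index. -/
theorem mem_order_of_isMaximal_padic (h0 : F 0 ≠ 0) (hn : 0 < n)
    (hmax : (F.map (Int.castRingHom ℤ_[p])).IsMaximal ℚ_[p]) {x : etAlg ℚ F} (hx : IsIntegral ℤ x)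
    (hpx : ((p : ℤ) : etAlg ℚ F) * x ∈ order ℚ F) : x ∈ order ℚ F := by
  have hp0 : (p : ℤ) ≠ 0 := by exact_mod_cast (Fact.out : p.Prime).ne_zero
  obtain ⟨c, hc⟩ := exists_eq_of_mem_orderModule ((mem_order_iff F _).1 hpx)
  have hx1 : IsIntegral ℤ_[p] (toPadic F p x) := by
    have h1 : IsIntegral ℤ (toPadic F p x) := hx.map (toPadic F p).toIntAlgHom
    obtain ⟨q, hq, hq0⟩ := h1
    refine ⟨q.map (Int.castRingHom ℤ_[p]), hq.map _, ?_⟩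
    rw [eval₂_map, RingHom.ext_int (RingHom.comp _ _) (algebraMap ℤ _)]
    exact hq0
  have hx2 : toPadic F p x ∈ order ℚ_[p] (F.map (Int.castRingHom ℤ_[p])) := by
    rw [hmax]; exact hx1
  obtain ⟨d, hd⟩ := exists_eq_of_mem_orderModule
    (Submodule.mem_toSubalgebra.1 hx2)
  have h0' : algebraMap ℤ_[p] ℚ_[p] (F.map (Int.castRingHom ℤ_[p]) 0) ≠ 0 := by
    simpa [map] using h0
  have hcd : ∀ j < n, Int.castRingHom ℤ_[p] (c j) = p * d j := by
    intro j hj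
    refine coord_unique (F := F.map (Int.castRingHom ℤ_[p])) (K := ℚ_[p])
      (c := fun j => Int.castRingHom ℤ_[p] (c j)) (d := fun j => p * d j) h0' hn ?_ hj
    have h1 := congrArg (toPadic F p) hc
    rw [map_mul, hd, map_add, map_sum, toPadic_algebraMap, mul_add, Finset.mul_sum] at h1
    simp only [map_mul (toPadic F p), toPadic_algebraMap, toPadic_zeta] at h1
    rw [← h1, map_mul]
    simp [mul_assoc]
  have hdvd : ∀ j, ∃ c', j < n → c j = p * c' := by
    intro j
    by_cases hj : j < n
    · have h1 : ((p : ℤ_[p])) ∣ ((c j : ℤ) : ℤ_[p]) := ⟨d j, by simpa using hcd j hj⟩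
      have h2 : (p : ℤ) ∣ c j := by
        have := (PadicInt.pow_p_dvd_int_iff (p := p) 1 (c j)).1 (by simpa using h1)
        simpa using this
      obtain ⟨c', hc'⟩ := h2
      exact ⟨c', fun _ => hc'⟩
    · exact ⟨0, fun h => absurd h hj⟩
  choose c' hc' using hdvd
  have hx3 : x = algebraMap ℤ _ (c' 0) +
      ∑ i ∈ Finset.Icc 1 (n - 1), algebraMap ℤ _ (c' i) * zeta ℚ F i := by
    apply (isUnit_intCast_etAlg (F := F) hp0).mul_left_cancel
    rw [hc, mul_add, Finset.mul_sum, hc' 0 hn]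
    congr 1
    · simp
    · refine Finset.sum_congr rfl fun i hi => ?_
      have := Finset.mem_Icc.1 hi
      rw [hc' i (by omega)]
      simp [mul_assoc]
  rw [hx3, mem_order_iff]
  refine Submodule.add_mem _ (algebraMap_mem_orderModule F _) (Submodule.sum_mem _ fun i hi => ?_)
  have := Finset.mem_Icc.1 hi
  rw [← Algebra.smul_def]
  exact Submodule.smul_mem _ _ (zeta_mem_orderModule F (by omega))

end Transfer

/-! ### Squareful forms -/

section Lifting

/-- A polynomial over `ZMod p` lifts to an integral polynomial of no larger degree. -/
theorem exists_map_eq_natDegree_le {p : ℕ} (q : (ZMod p)[X]) :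
    ∃ Q : ℤ[X], Q.map (Int.castRingHom (ZMod p)) = q ∧ Q.natDegree ≤ q.natDegree := by
  obtain ⟨Q, hQ, hd⟩ := exists_degree_eq_of_mem_lifts
    (mem_lifts_of_surjective (ZMod.ringHom_surjective (Int.castRingHom (ZMod p))) q)
  exact ⟨Q, hQ, (natDegree_eq_of_degree_eq hd).le⟩

theorem exists_eq_C_mul_of_map_eq_zero {p : ℕ} (hp : p ≠ 0) {P : ℤ[X]}
    (h : P.map (Int.castRingHom (ZMod p)) = 0) :
    ∃ E : ℤ[X], P = C (p : ℤ) * E ∧ E.natDegree ≤ P.natDegree := by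
  have hdvd : C (p : ℤ) ∣ P := by
    rw [C_dvd_iff_dvd_coeff]
    intro i
    have := congrArg (fun q => coeff q i) h
    simp only [coeff_map, coeff_zero, eq_intCast] at this
    exact (ZMod.intCast_zmod_eq_zero_iff_dvd _ _).1 this
  obtain ⟨E, rfl⟩ := hdvd
  refine ⟨E, rfl, le_of_eq ?_⟩
  rw [natDegree_C_mul (by exact_mod_cast hp)]

theorem exists_eq_add_C_mul {p : ℕ} (hp : p ≠ 0) {P Q : ℤ[X]} {d : ℕ} (hP : P.natDegree ≤ d)
    (hQ : Q.natDegree ≤ d)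
    (h : P.map (Int.castRingHom (ZMod p)) = Q.map (Int.castRingHom (ZMod p))) :
    ∃ E : ℤ[X], P = Q + C (p : ℤ) * E ∧ E.natDegree ≤ d := by
  obtain ⟨E, hE, hd⟩ := exists_eq_C_mul_of_map_eq_zero hp (P := P - Q)
    (by rw [Polynomial.map_sub, h, sub_self])
  exact ⟨E, by rw [← hE]; ring, hd.trans ((natDegree_sub_le _ _).trans (max_le hP hQ))⟩

end Lifting

section Global

variable {n : ℕ} {F : BinaryForm ℤ n}

/-- If `u v` divides `f_0` and `u`, `v`, `f_1` are coprime, the ideals `(u)` and `(v)` can be added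
to `idealInf` one at a time. -/
theorem idealInf_add_mul (hn2 : 2 ≤ n) (hF : F.IsPrimitive) {u v x y z : ℤ}
    (huv : u * v ∣ F 0) (hc : x * u + y * v + z * F.coef 1 = 1) :
    (idealInf F + principal F (u : etAlg ℚ F)) * (idealInf F + principal F (v : etAlg ℚ F)) =
      idealInf F + principal F ((u * v : ℤ) : etAlg ℚ F) := by
  have huv' : principal F ((u * v : ℤ) : etAlg ℚ F) =
      principal F (u : etAlg ℚ F) * principal F (v : etAlg ℚ F) := by
    rw [Int.cast_mul, principal, principal, principal, map_mul]
  rw [huv']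
  apply add_mul_add_eq (idealOne_mul_idealInf (by omega) hF) (idealInf_le_one F)
    (principal_intCast_le_one F u) (principal_intCast_le_one F v)
  rw [← huv', ← principal_one, principal_le_iff]
  obtain ⟨w, hw⟩ := huv
  have hb : beta ℚ F 1 = theta ℚ F * ((F 0 : ℤ) : etAlg ℚ F) + ((F.coef 1 : ℤ) : etAlg ℚ F) := by
    have := beta_succ (K := ℚ) F 0
    rw [beta_zero, coef_zero] at this
    simpa using this
  have h1 : (1 : etAlg ℚ F) = z * beta ℚ F 1 + x * u + y * v +
      (-(z * w) : ℤ) * (((u * v : ℤ) : etAlg ℚ F) * theta ℚ F) := by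
    have h2 : ((x * u + y * v + z * F.coef 1 : ℤ) : etAlg ℚ F) = 1 := by rw [hc, Int.cast_one]
    rw [hb, hw, ← h2]
    push_cast
    ring
  have hsm : ∀ (m : ℤ) (N : Submodule (order ℚ F) (etAlg ℚ F)) (a : etAlg ℚ F), a ∈ N →
      (m : etAlg ℚ F) * a ∈ N := by
    intro m N a ha
    simpa using algebraMap_mul_mem_of_mem F N m ha
  rw [h1]
  refine Submodule.add_mem_sup (Submodule.add_mem_sup (Submodule.add_mem_sup ?_ ?_) ?_) ?_
  · exact hsm _ _ _ (beta_mem_idealInf F (by omega))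
  · exact hsm _ _ _ (mem_principal_self F _)
  · exact hsm _ _ _ (mem_principal_self F _)
  · exact hsm _ _ _ (Submodule.mul_mem_mul (mem_principal_self F _) (theta_mem_idealOne F))

theorem idealInf_add_principal_of_dvd (hn : 0 < n) {m : ℤ} (hm : F 0 ∣ m) :
    idealInf F + principal F (m : etAlg ℚ F) = idealInf F := by
  refine le_antisymm (add_le le_rfl ?_) le_self_add
  rw [principal_le_iff]
  obtain ⟨c, rfl⟩ := hm
  have h1 := beta_mem_idealInf F hn
  rw [beta_zero, coef_zero] at h1
  have := algebraMap_mul_mem_of_mem F _ c h1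
  simpa [mul_comm] using this

/-- Reduction to the squarefree part `k` of `f_0 = k t²`. -/
theorem isSquareClass_idealInf_of_add_principal (hn2 : 2 ≤ n) (hF : F.IsPrimitive) {k t : ℤ}
    (hkt : F 0 = k * t ^ 2) (hco : IsCoprime t (F.coef 1))
    (hk : IsSquareClass F (idealInf F + principal F (k : etAlg ℚ F))) :
    IsSquareClass F (idealInf F) := by
  obtain ⟨a, b, hab⟩ := hco
  obtain ⟨c, d, hcd⟩ := (IsCoprime.pow_left (m := 2) ⟨a, b, hab⟩ : IsCoprime (t ^ 2) (F.coef 1))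
  have h1 : (idealInf F + principal F (t : etAlg ℚ F)) ^ 2 =
      idealInf F + principal F ((t ^ 2 : ℤ) : etAlg ℚ F) := by
    rw [pow_two, pow_two]
    exact idealInf_add_mul hn2 hF (x := a) (y := 0) (z := b) ⟨k, by rw [hkt]; ring⟩
      (by rw [← hab]; ring)
  have h2 : (idealInf F + principal F (k : etAlg ℚ F)) *
      (idealInf F + principal F (t : etAlg ℚ F)) ^ 2 = idealInf F := by
    rw [h1, idealInf_add_mul hn2 hF (x := 0) (y := c) (z := d) ⟨1, by rw [hkt]; ring⟩
      (by rw [← hcd]; ring)]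
    exact idealInf_add_principal_of_dvd (by omega) ⟨1, by rw [hkt, mul_one]⟩
  have hJ : IsUnit (idealInf F) :=
    IsUnit.of_mul_eq_one (idealOne F) (by rw [mul_comm, idealOne_mul_idealInf (by omega) hF])
  have ht : IsUnit (idealInf F + principal F (t : etAlg ℚ F)) := by
    rw [← h2] at hJ
    exact isUnit_of_dvd_unit ((dvd_pow_self _ two_ne_zero).trans (dvd_mul_left _ _)) hJ
  rw [← h2]
  exact hk.mul (isSquareClass_sq ht)

/-- Reduction from a squarefree divisor of `f_0` to its prime factors. -/
theorem isSquareClass_add_principal_of_prime (hn2 : 2 ≤ n) (hF : F.IsPrimitive) (m : ℕ)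
    (hsq : Squarefree m) (hm : (m : ℤ) ∣ F 0)
    (h : ∀ p : ℕ, p.Prime → p ∣ m →
      IsSquareClass F (idealInf F + principal F ((p : ℤ) : etAlg ℚ F))) :
    IsSquareClass F (idealInf F + principal F ((m : ℤ) : etAlg ℚ F)) := by
  induction m using induction_on_primes with
  | zero => exact absurd hsq not_squarefree_zero
  | one =>
    have : idealInf F + principal F (((1 : ℕ) : ℤ) : etAlg ℚ F) = principal F 1 := by
      rw [Nat.cast_one, Int.cast_one]
      refine le_antisymm (add_le ?_ le_rfl) le_add_self
      rw [principal_one]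
      exact idealInf_le_one F
    rw [this]
    exact isSquareClass_principal isUnit_one
  | prime_mul p a hp ih =>
    have hcop : Nat.Coprime p a := Nat.coprime_of_squarefree_mul hsq
    obtain ⟨x, y, hxy⟩ := Nat.isCoprime_iff_coprime.2 hcop
    rw [Nat.cast_mul, ← idealInf_add_mul hn2 hF (x := x) (y := y) (z := 0)
      (by exact_mod_cast hm) (by rw [← hxy]; ring)]
    refine (h p hp (dvd_mul_right _ _)).mul (ih (hsq.squarefree_of_dvd (dvd_mul_left _ _)) ?_ ?_)
    · exact (Int.natCast_dvd_natCast.2 (dvd_mul_left _ _)).trans hm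
    · exact fun q hq hqa => h q hq (hqa.mul_left _)

/-- If `p² ∣ f_0` and `p ∣ f_1`, the form is not maximal at `p`. -/
theorem exists_not_mem_order_of_dvd (h0 : F 0 ≠ 0) (hn2 : 2 ≤ n) (hF : F.IsPrimitive) {p : ℤ}
    (hp0 : p ≠ 0) (hp : ¬ IsUnit p) (h1 : p ^ 2 ∣ F 0) (h2 : p ∣ F.coef 1) :
    ∃ x : etAlg ℚ F, IsIntegral ℤ x ∧ (p : etAlg ℚ F) * x ∈ order ℚ F ∧ x ∉ order ℚ F := by
  obtain ⟨a, ha⟩ := h1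
  obtain ⟨b, hb⟩ := h2
  obtain ⟨m, rfl⟩ : ∃ m, n = m + 2 := ⟨n - 2, by omega⟩
  refine exists_isIntegral_not_mem_order h0 hn2 hF hp0 hp (δ := 1) (φ := 1)
    (ψ := ∑ j ∈ Finset.range (m + 1), C (F.coef (j + 2)) * X ^ (m - j))
    (G₁ := C b * X ^ (m + 1)) (G₂ := C a * X ^ (m + 2)) le_rfl (by omega) (by simp) ?_ ?_ ?_ ?_
  · refine natDegree_sum_le_of_forall_le _ _ fun j _ => (natDegree_C_mul_X_pow_le _ _).trans ?_
    omega
  · exact (natDegree_C_mul_X_pow_le _ _).trans (by omega)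
  · exact natDegree_C_mul_X_pow_le _ _
  · rw [dehomog_eq_sum_range, Finset.sum_range_succ', Finset.sum_range_succ']
    rw [zero_add, coef_zero, ha, hb]
    have : ∑ j ∈ Finset.range (m + 1), C (F.coef (j + 1 + 1)) * X ^ (m + 2 - (j + 1 + 1)) =
        ∑ j ∈ Finset.range (m + 1), C (F.coef (j + 2)) * X ^ (m - j) :=
      Finset.sum_congr rfl fun j _ => by rw [show m + 2 - (j + 1 + 1) = m - j by omega]
    rw [this]
    simp only [Nat.sub_zero, show m + 2 - 1 = m + 1 by omega, map_mul, map_pow]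
    ring

/-- If `p² ∣ f_n` and `p ∣ f_(n-1)`, the form is not maximal at `p`. -/
theorem exists_not_mem_order_of_dvd_last (h0 : F 0 ≠ 0) (hn2 : 2 ≤ n) (hF : F.IsPrimitive) {p : ℤ}
    (hp0 : p ≠ 0) (hp : ¬ IsUnit p) (h1 : p ^ 2 ∣ F.coef n) (h2 : p ∣ F.coef (n - 1)) :
    ∃ x : etAlg ℚ F, IsIntegral ℤ x ∧ (p : etAlg ℚ F) * x ∈ order ℚ F ∧ x ∉ order ℚ F := by
  obtain ⟨a, ha⟩ := h1
  obtain ⟨b, hb⟩ := h2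
  obtain ⟨m, rfl⟩ : ∃ m, n = m + 2 := ⟨n - 2, by omega⟩
  rw [show m + 2 - 1 = m + 1 by omega] at hb
  refine exists_isIntegral_not_mem_order h0 hn2 hF hp0 hp (δ := 1) (φ := X)
    (ψ := ∑ j ∈ Finset.range (m + 1), C (F.coef j) * X ^ (m - j))
    (G₁ := C b) (G₂ := C a) le_rfl (by omega) natDegree_X_le ?_ (by simp) (by simp) ?_
  · refine natDegree_sum_le_of_forall_le _ _ fun j _ => (natDegree_C_mul_X_pow_le _ _).trans ?_
    omega
  · rw [dehomog_eq_sum_range, Finset.sum_range_succ, Finset.sum_range_succ, ha, hb, Finset.mul_sum]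
    have : ∑ j ∈ Finset.range (m + 1), C (F.coef j) * X ^ (m + 2 - j) =
        ∑ j ∈ Finset.range (m + 1), X ^ 2 * (C (F.coef j) * X ^ (m - j)) :=
      Finset.sum_congr rfl fun j hj => by
        have := Finset.mem_range.1 hj
        rw [show m + 2 - j = m - j + 2 by omega, pow_add]; ring
    rw [this]
    simp only [Nat.sub_self, show m + 2 - (m + 1) = 1 by omega, map_mul, map_pow]
    ring

end Global

section Squareful

variable {n : ℕ} {F : BinaryForm ℤ n}

theorem toMvPoly_eq_homogenize {S : Type*} [CommRing S] (G : BinaryForm S n) :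
    G.toMvPoly = (dehomog G).homogenize n := by
  rw [toMvPoly, dehomog, homogenize_finsetSum]
  refine Finset.sum_congr rfl fun i _ => ?_
  rw [homogenize_C_mul, homogenize_X_pow (Nat.sub_le _ _), mul_assoc,
    show n - (n - (i : ℕ)) = i by omega]

/-- At a prime where `F` is maximal and squareful, `(p) + idealInf F` is a square class. -/
theorem isSquareClass_of_isSquareful (hn3 : 3 ≤ n) (hn : Odd n) (h0 : F 0 ≠ 0)
    (hF : F.IsPrimitive) (p : ℕ) [Fact p.Prime]
    (hmax : ∀ x : etAlg ℚ F, IsIntegral ℤ x → ((p : ℤ) : etAlg ℚ F) * x ∈ order ℚ F →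
      x ∈ order ℚ F)
    (hsq : IsSquareful p (F.map (Int.castRingHom ℤ_[p]))) :
    IsSquareClass F (idealInf F + principal F ((p : ℤ) : etAlg ℚ F)) := by
  have hpp : p.Prime := Fact.out
  have hp0 : (p : ℤ) ≠ 0 := by exact_mod_cast hpp.ne_zero
  have hpu : ¬ IsUnit (p : ℤ) := (Nat.prime_iff_prime_int.1 hpp).not_isUnit
  obtain ⟨κ', e, d, H', he, hH0, hrel'⟩ := hsq
  have hmm : (F.map (Int.castRingHom ℤ_[p])).map PadicInt.toZMod =
      F.map (Int.castRingHom (ZMod p)) := by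
    funext i
    simp [map]
  rw [hmm, toMvPoly_eq_homogenize, toMvPoly_eq_homogenize, dehomog_map] at hrel'
  set hbar := dehomog H' with hbar_def
  have hbar_deg : hbar.natDegree ≤ d := natDegree_dehomog_le H'
  have hbar_coeff : hbar.coeff d = 1 := by
    have := coeff_dehomog H' (Nat.zero_le d)
    rwa [Nat.sub_zero, coef_zero, hH0] at this
  have hbar_monic : hbar.Monic := monic_of_natDegree_le_of_coeff_eq_one d hbar_deg hbar_coeff
  have hbar_nat : hbar.natDegree = d :=
    le_antisymm hbar_deg (le_natDegree_of_ne_zero (by rw [hbar_coeff]; exact one_ne_zero))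
  have hdF : ((dehomog F).map (Int.castRingHom (ZMod p))).natDegree ≤ n :=
    natDegree_map_le.trans (natDegree_dehomog_le F)
  -- the relation between the dehomogenized polynomials
  have hrel1 : (dehomog F).map (Int.castRingHom (ZMod p)) = C (κ' : ZMod p) * hbar ^ 2 := by
    have := congrArg (MvPolynomial.aeval ![(X : (ZMod p)[X]), 1]) hrel'
    rw [aeval_homogenize_X_one _ hdF, map_mul, map_mul, map_pow, map_pow,
      aeval_homogenize_X_one _ hbar_deg] at this
    simpa using this
  have hned : (dehomog F).map (Int.castRingHom (ZMod p)) ≠ 0 := by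
    rw [hrel1]
    exact mul_ne_zero (C_ne_zero.2 κ'.ne_zero) (pow_ne_zero _ hbar_monic.ne_zero)
  have hdeg : e + 2 * d = n := by
    have hh1 : (((dehomog F).map (Int.castRingHom (ZMod p))).homogenize n).IsHomogeneous n :=
      isHomogeneous_homogenize _
    have hh2 : (((dehomog F).map (Int.castRingHom (ZMod p))).homogenize n).IsHomogeneous
        (0 + 1 * e + d * 2) := by
      rw [hrel']
      exact ((MvPolynomial.isHomogeneous_C _ _).mul ((MvPolynomial.isHomogeneous_X _ _).pow e)).mul
        ((isHomogeneous_homogenize hbar).pow 2)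
    have hne : ((dehomog F).map (Int.castRingHom (ZMod p))).homogenize n ≠ 0 := by
      rwa [Ne, homogenize_eq_zero_iff hdF]
    have := hh2.inj_right hh1 hne
    omega
  obtain ⟨κ, hκ⟩ := ZMod.intCast_surjective (κ' : ZMod p)
  obtain ⟨H, hHmap, hHdeg, hHmonic⟩ := lifts_and_natDegree_eq_and_monic
    (mem_lifts_of_surjective (ZMod.ringHom_surjective (Int.castRingHom (ZMod p))) hbar) hbar_monic
  rw [hbar_nat] at hHdeg
  have hH2deg : (C κ * H ^ 2).natDegree ≤ 2 * d :=
    (natDegree_C_mul_le _ _).trans (natDegree_pow_le.trans (by omega))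
  obtain ⟨G, hG, hGdeg⟩ := exists_eq_add_C_mul hpp.ne_zero (natDegree_dehomog_le F)
    (hH2deg.trans (by omega : 2 * d ≤ n))
    (by rw [hrel1, Polynomial.map_mul, Polynomial.map_pow, hHmap, map_C, eq_intCast, hκ])
  have hκp : IsCoprime κ (p : ℤ) := by
    rw [isCoprime_comm, (Nat.prime_iff_prime_int.1 hpp).irreducible.coprime_iff_not_dvd]
    intro hdvd
    rw [← ZMod.intCast_zmod_eq_zero_iff_dvd, hκ] at hdvd
    exact κ'.ne_zero hdvd
  have heodd : Odd e := by
    rw [← hdeg] at hn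
    exact (Nat.odd_add.1 hn).2 (even_two_mul d)
  have hHcoef : H.coeff d = 1 := by rw [← hHdeg]; exact hHmonic
  refine isSquareClass_idealInf_add_principal (by omega) hF hp0 hκp heodd hdeg hHdeg.le
    (by rw [hHcoef]; exact isCoprime_one_left) hGdeg hG ?_ ?_
  · -- a common factor of `G` and `H` modulo `p` would give an overorder
    have hco : IsCoprime (G.map (Int.castRingHom (ZMod p))) hbar := by
      refine isCoprime_of_irreducible_dvd (fun h => hbar_monic.ne_zero h.2) ?_
      intro φ' hφ' hφG hφH
      obtain ⟨γ', hγ'⟩ := hφG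
      obtain ⟨ψ', hψ'⟩ := hφH
      obtain ⟨φ, hφ, hφd⟩ := exists_map_eq_natDegree_le φ'
      obtain ⟨γ, hγ, hγd⟩ := exists_map_eq_natDegree_le γ'
      obtain ⟨ψ, hψ, hψd⟩ := exists_map_eq_natDegree_le ψ'
      set δ := φ'.natDegree with hδ
      have hδ1 : 1 ≤ δ := hφ'.natDegree_pos
      have hψ0 : ψ' ≠ 0 := by
        rintro rfl; rw [mul_zero] at hψ'; exact hbar_monic.ne_zero hψ'
      have hψdeg : δ + ψ'.natDegree = d := by
        rw [← hbar_nat, hψ', natDegree_mul hφ'.ne_zero hψ0]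
      have hγdeg : γ'.natDegree ≤ n - δ := by
        by_cases hγ0 : γ' = 0
        · rw [hγ0]; simp
        · have h1 : (G.map (Int.castRingHom (ZMod p))).natDegree = δ + γ'.natDegree := by
            rw [hγ', natDegree_mul hφ'.ne_zero hγ0]
          have h2 : (G.map (Int.castRingHom (ZMod p))).natDegree ≤ n :=
            natDegree_map_le.trans hGdeg
          omega
      obtain ⟨E, hE, hEd⟩ := exists_eq_add_C_mul hpp.ne_zero (P := H) (Q := φ * ψ) (d := d)
        hHdeg.le (natDegree_mul_le.trans (by omega))
        (by rw [hHmap, Polynomial.map_mul, hφ, hψ, hψ'])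
      obtain ⟨E', hE', hEd'⟩ := exists_eq_add_C_mul hpp.ne_zero (P := G) (Q := φ * γ) (d := n)
        hGdeg (natDegree_mul_le.trans (by omega))
        (by rw [Polynomial.map_mul, hφ, hγ, hγ'])
      obtain ⟨x, hx1, hx2, hx3⟩ := exists_isIntegral_not_mem_order h0 (by omega) hF hp0 hpu hδ1
        (by omega) (φ := φ) (ψ := C κ * ψ ^ 2) (G₁ := C (2 * κ) * (ψ * E) + γ)
        (G₂ := C κ * E ^ 2 + E') hφd
        ((natDegree_C_mul_le _ _).trans (natDegree_pow_le.trans (by omega)))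
        (natDegree_add_le_of_degree_le
          ((natDegree_C_mul_le _ _).trans (natDegree_mul_le.trans (by omega))) (by omega))
        (natDegree_add_le_of_degree_le
          ((natDegree_C_mul_le _ _).trans (natDegree_pow_le.trans (by omega))) (by omega))
        (by
          rw [hG, hE', hE]
          simp only [map_mul, map_ofNat]
          ring)
      exact hx3 (hmax x hx1 hx2)
    obtain ⟨a, b, hab⟩ := hco
    obtain ⟨A, hA, -⟩ := exists_map_eq_natDegree_le a
    obtain ⟨B, hB, -⟩ := exists_map_eq_natDegree_le b
    obtain ⟨E, hE, -⟩ := exists_eq_C_mul_of_map_eq_zero hpp.ne_zero (P := 1 - (A * G + B * H)) (by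
      rw [Polynomial.map_sub, Polynomial.map_add, Polynomial.map_mul, Polynomial.map_mul, hA, hB,
        hHmap, hab, Polynomial.map_one, sub_self])
    exact ⟨A, B, E, by rw [← hE]; ring⟩
  · by_contra hcon
    push Not at hcon
    obtain ⟨he1, hGn⟩ := hcon
    have he3 : 3 ≤ e := by obtain ⟨c, rfl⟩ := heodd; omega
    have hpG : (p : ℤ) ∣ G.coeff n := by
      rwa [isCoprime_comm, (Nat.prime_iff_prime_int.1 hpp).irreducible.coprime_iff_not_dvd,
        not_not] at hGn
    have hcoef : ∀ i, 2 * d < n - i → i ≤ n → F.coef i = p * G.coeff (n - i) := by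
      intro i hi hin
      rw [← coeff_dehomog F hin, hG, coeff_add,
        coeff_eq_zero_of_natDegree_lt (hH2deg.trans_lt hi), zero_add, coeff_C_mul]
    have h1 : (p : ℤ) ^ 2 ∣ F 0 := by
      rw [← coef_zero F, hcoef 0 (by omega) (by omega), pow_two, Nat.sub_zero]
      exact mul_dvd_mul_left _ hpG
    have h2 : (p : ℤ) ∣ F.coef 1 := by
      rw [hcoef 1 (by omega) (by omega)]
      exact dvd_mul_right _ _
    obtain ⟨x, hx1, hx2, hx3⟩ := exists_not_mem_order_of_dvd h0 (by omega) hF hp0 hpu h1 h2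
    exact hx3 (hmax x hx1 hx2)

/-- The inverse different is a square class for forms that are maximal at the primes dividing the
leading coefficient and squareful at those dividing its squarefree part. -/
theorem inverseDifferentIsSquare_of_isSquareful (hn3 : 3 ≤ n) (hn : Odd n) (h0 : F 0 ≠ 0)
    (hs : F.IsSeparable ℚ) (hF : F.IsPrimitive) {k : ℤ} (hk : IsSquarefreePart k (F 0))
    (hmax : ∀ (p : ℕ) [Fact p.Prime], (p : ℤ) ∣ F 0 →
      (F.map (Int.castRingHom ℤ_[p])).IsMaximal ℚ_[p])
    (hsq : ∀ (p : ℕ) [Fact p.Prime], (p : ℤ) ∣ k →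
      IsSquareful p (F.map (Int.castRingHom ℤ_[p]))) : F.InverseDifferentIsSquare := by
  obtain ⟨hksq, t, ht⟩ := hk
  have hmax' : ∀ p : ℕ, p.Prime → (p : ℤ) ∣ F 0 → ∀ x : etAlg ℚ F, IsIntegral ℤ x →
      ((p : ℤ) : etAlg ℚ F) * x ∈ order ℚ F → x ∈ order ℚ F := by
    intro p hp hpd x hx hpx
    have : Fact p.Prime := ⟨hp⟩
    exact mem_order_of_isMaximal_padic p h0 (by omega) (hmax p hpd) hx hpx
  have hco : IsCoprime t (F.coef 1) := by
    rw [Int.isCoprime_iff_gcd_eq_one]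
    by_contra hg
    obtain ⟨p, hp, hpd⟩ := Nat.exists_prime_and_dvd hg
    have hpt : (p : ℤ) ∣ t := (Int.natCast_dvd_natCast.2 hpd).trans (Int.gcd_dvd_left _ _)
    have hpf : (p : ℤ) ∣ F.coef 1 := (Int.natCast_dvd_natCast.2 hpd).trans (Int.gcd_dvd_right _ _)
    have hpf0 : (p : ℤ) ^ 2 ∣ F 0 := by rw [ht]; exact (pow_dvd_pow_of_dvd hpt 2).mul_left _
    obtain ⟨x, hx1, hx2, hx3⟩ := exists_not_mem_order_of_dvd h0 (by omega) hF
      (by exact_mod_cast hp.ne_zero) (Nat.prime_iff_prime_int.1 hp).not_isUnit hpf0 hpf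
    exact hx3 (hmax' p hp ((dvd_pow_self _ two_ne_zero).trans hpf0) x hx1 hx2)
  refine inverseDifferentIsSquare_of_idealInf h0 hF hn3 hs
    (isSquareClass_idealInf_of_add_principal (by omega) hF ht hco ?_)
  have habs : principal F (k : etAlg ℚ F) = principal F ((k.natAbs : ℤ) : etAlg ℚ F) := by
    rcases Int.natAbs_eq k with h | h
    · rw [← h]
    · conv_lhs => rw [h]
      rw [Int.cast_neg, principal_neg]
  rw [habs]
  have hkd : (k.natAbs : ℤ) ∣ F 0 := Int.natAbs_dvd.2 ⟨t ^ 2, ht⟩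
  refine isSquareClass_add_principal_of_prime (by omega) hF _ (Int.squarefree_natAbs.2 hksq) hkd ?_
  intro p hp hpk
  have hpk' : (p : ℤ) ∣ k := Int.natCast_dvd.2 hpk
  have : Fact p.Prime := ⟨hp⟩
  exact isSquareClass_of_isSquareful hn3 hn h0 hF p
    (hmax' p hp (hpk'.trans ⟨t ^ 2, ht⟩)) (hsq p hpk')

end Squareful

/-! ### A family given by congruences -/

section Family

variable {n : ℕ} {F : BinaryForm ℤ n}

theorem isPrimitive_of_coef_one (hn : 1 ≤ n) (h1 : F.coef 1 = 1) : F.IsPrimitive := by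
  rw [IsPrimitive, Ideal.eq_top_iff_one, ← h1]
  have := coef_of_lt F ⟨1, by omega⟩
  simp only at this
  rw [this]
  exact Ideal.subset_span ⟨_, rfl⟩

/-- If `G(0)` is prime to `k`, then `G` and `x^h` generate the unit ideal modulo `k`. -/
theorem exists_combination_of_isCoprime_coeff_zero {G : ℤ[X]} {k : ℤ}
    (h : IsCoprime (G.coeff 0) k) (m : ℕ) :
    ∃ A B E : ℤ[X], A * G + B * X ^ m + C k * E = 1 := by
  obtain ⟨u, v, huv⟩ := h
  set y : ℤ[X] := C u * G + C v * C k with hy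
  have h1 : 1 - y = -C u * divX G * X := by
    have e1 : C u * C (G.coeff 0) + C v * C k = (1 : ℤ[X]) := by
      rw [← map_mul, ← map_mul, ← map_add, huv, map_one]
    have e2 := divX_mul_X_add G
    rw [hy, ← e1]
    nth_rewrite 2 [← e2]
    ring
  obtain ⟨s, hs⟩ := sub_dvd_pow_sub_pow (1 : ℤ[X]) (1 - y) m
  rw [one_pow, h1, mul_pow, ← h1, sub_sub_cancel] at hs
  refine ⟨s * C u, (-C u * divX G) ^ m, s * C v, ?_⟩
  rw [sub_eq_iff_eq_add] at hs
  rw [hs, hy]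
  ring

/-- The congruence conditions `f_1 = 1`, `2 f_0 ∣ f_i` for `1 < i < n` and `f_n ≡ 4k mod 4k²` make
`F ≡ x^(n-1) z` modulo `k`, and force the inverse different to be a square class. -/
theorem inverseDifferentIsSquare_of_congruences (hn3 : 3 ≤ n) (hn : Odd n) (hs : F.IsSeparable ℚ)
    {k t g : ℤ} (hodd : Odd (F 0)) (hkt : F 0 = k * t ^ 2) (h1 : F.coef 1 = 1)
    (hi : ∀ i, 2 ≤ i → i < n → 2 * F 0 ∣ F.coef i) (hlast : F.coef n = 4 * k * (1 + k * g)) :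
    F.InverseDifferentIsSquare := by
  have h0 : F 0 ≠ 0 := by rintro h; rw [h] at hodd; exact absurd hodd (by decide)
  have hk0 : k ≠ 0 := by rintro rfl; rw [zero_mul] at hkt; exact h0 hkt
  have hF : F.IsPrimitive := isPrimitive_of_coef_one (by omega) h1
  have hkodd : Odd k := by rw [hkt] at hodd; exact (Int.odd_mul.1 hodd).1
  refine inverseDifferentIsSquare_of_idealInf h0 hF hn3 hs
    (isSquareClass_idealInf_of_add_principal (by omega) hF hkt
      (by rw [h1]; exact isCoprime_one_right) ?_)
  have hdvd : ∀ i, ∃ c, i ≤ n → i ≠ 1 → F.coef i = k * c := by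
    intro i
    by_cases h : i ≤ n ∧ i ≠ 1
    · have : k ∣ F.coef i := by
        rcases Nat.eq_zero_or_pos i with rfl | hpos
        · rw [coef_zero, hkt]; exact dvd_mul_right _ _
        · rcases h.1.lt_or_eq with hlt | rfl
          · refine Dvd.dvd.trans ?_ (hi i (by omega) hlt)
            rw [hkt]
            exact (dvd_mul_right _ _).mul_left _
          · rw [hlast, mul_assoc, mul_left_comm]; exact dvd_mul_right _ _
      obtain ⟨c, hc⟩ := this
      exact ⟨c, fun _ _ => hc⟩
    · exact ⟨0, fun h2 h3 => absurd ⟨h2, h3⟩ h⟩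
  choose c hc using hdvd
  obtain ⟨h, hh⟩ := hn
  set G : ℤ[X] := ∑ i ∈ (Finset.range (n + 1)).erase 1, C (c i) * X ^ (n - i) with hG
  have hG0 : G.coeff 0 = 4 * (1 + k * g) := by
    rw [hG, finsetSum_coeff, Finset.sum_eq_single n]
    · rw [Nat.sub_self, pow_zero, mul_one, coeff_C_zero]
      have := hc n le_rfl (by omega)
      rw [hlast] at this
      apply mul_left_cancel₀ hk0
      rw [← this]
      ring
    · intro j hj hjn
      have := Finset.mem_range.1 (Finset.mem_of_mem_erase hj)
      rw [coeff_C_mul_X_pow, if_neg (by omega)]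
    · intro hni
      exact absurd (Finset.mem_erase.2 ⟨by omega, Finset.mem_range.2 (by omega)⟩) hni
  have hcop : IsCoprime (G.coeff 0) k := by
    rw [hG0]
    have h2 : IsCoprime (2 : ℤ) k := by
      obtain ⟨b, hb⟩ := hkodd
      exact ⟨-b, 1, by rw [hb]; ring⟩
    have h4 : IsCoprime (4 : ℤ) k := by
      have := h2.mul_left h2
      norm_num at this
      exact this
    exact h4.mul_left ⟨1, -g, by ring⟩
  refine isSquareClass_idealInf_add_principal (κ := 1) (e := 1) (h := h) (H := X ^ h) (G := G)
    (by omega) hF hk0 isCoprime_one_left odd_one (by omega) (natDegree_X_pow_le h)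
    (by rw [coeff_X_pow_self]; exact isCoprime_one_left) ?_ ?_
    (exists_combination_of_isCoprime_coeff_zero hcop h) (Or.inl rfl)
  · refine natDegree_sum_le_of_forall_le _ _ fun j _ => ?_
    exact (natDegree_C_mul_X_pow_le _ _).trans (Nat.sub_le _ _)
  · rw [dehomog_eq_sum_range, ← Finset.add_sum_erase _ _
      (Finset.mem_range.2 (by omega : 1 < n + 1)), h1, hG, Finset.mul_sum, ← pow_mul,
      show n - 1 = h * 2 by omega]
    congr 1
    refine Finset.sum_congr rfl fun j hj => ?_
    have hj1 := Finset.mem_erase.1 hj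
    have hj2 := Finset.mem_range.1 hj1.2
    rw [hc j (by omega) hj1.1, map_mul, mul_assoc]

theorem not_isMaximal_of_congruences (hn3 : 3 ≤ n) {k g : ℤ} (h0 : F 0 ≠ 0) (h1 : F.coef 1 = 1)
    (hi : ∀ i, 2 ≤ i → i < n → 2 * F 0 ∣ F.coef i) (hlast : F.coef n = 4 * k * (1 + k * g)) :
    ¬ F.IsMaximal ℚ := by
  intro hmax
  obtain ⟨x, hx1, -, hx3⟩ := exists_not_mem_order_of_dvd_last h0 (by omega)
    (isPrimitive_of_coef_one (by omega) h1) (p := 2) two_ne_zero (by decide)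
    ⟨k * (1 + k * g), by rw [hlast]; ring⟩
    ((dvd_mul_right _ _).trans (hi (n - 1) (by omega) (by omega)))
  apply hx3
  rw [hmax]
  exact hx1

end Family

end BinaryForm

/-! ### Stability of real factorizations -/

section Roots

/-- A monic complex polynomial that is small at `α` has a root near `α`. -/
theorem exists_root_near {f : ℂ[X]} (hf : f.Monic) {α : ℂ} {ρ : ℝ} (hρ : 0 ≤ ρ)
    (h : ‖f.eval α‖ < ρ ^ f.natDegree) : ∃ β, f.IsRoot β ∧ ‖α - β‖ < ρ := by
  by_contra hcon
  push Not at hcon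
  have hsplit := IsAlgClosed.splits f
  have h1 : f.eval α = (f.roots.map fun β => α - β).prod := by
    conv_lhs => rw [hsplit.eq_prod_roots_of_monic hf]
    rw [eval_multiset_prod, Multiset.map_map]
    simp
  have h2 : ρ ^ f.natDegree ≤ ‖f.eval α‖ := by
    rw [h1, hsplit.natDegree_eq_card_roots]
    have h3 : ∀ β ∈ f.roots, ρ ≤ ‖α - β‖ := fun β hβ => hcon β (isRoot_of_mem_roots hβ)
    generalize f.roots = s at h3
    induction s using Multiset.induction_on with
    | empty => simp
    | cons a s ih =>
      rw [Multiset.card_cons, Multiset.map_cons, Multiset.prod_cons, norm_mul, pow_succ']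
      exact mul_le_mul (h3 a (Multiset.mem_cons_self a s))
        (ih fun β hβ => h3 β (Multiset.mem_cons_of_mem hβ)) (pow_nonneg hρ _) (norm_nonneg _)
  linarith

/-- Index set for the roots of a real polynomial with `r₁` real roots and `r₂` pairs of complex
conjugate roots. -/
abbrev RootIndex (r₁ r₂ : ℕ) := Fin r₁ ⊕ (Fin r₂ ⊕ Fin r₂)

variable {r₁ r₂ : ℕ}

/-- Complex conjugation on `RootIndex`. -/
def RootIndex.conj : RootIndex r₁ r₂ → RootIndex r₁ r₂ := Sum.map id Sum.swap

/-- Points at mutual distance at least `1` on a translate of the integral lattice: `r₁` real ones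
and `r₂` complex conjugate pairs. -/
def gridPoint (μ : ℝ) : RootIndex r₁ r₂ → ℂ
  | .inl i => ⟨i - μ, 0⟩
  | .inr (.inl j) => ⟨-μ, j + 1⟩
  | .inr (.inr j) => ⟨-μ, -(j + 1)⟩

theorem gridPoint_conj (μ : ℝ) (i : RootIndex r₁ r₂) :
    gridPoint μ i.conj = (starRingEnd ℂ) (gridPoint μ i) := by
  rcases i with i | j | j <;> simp [RootIndex.conj, gridPoint, Complex.ext_iff]

theorem one_le_norm_gridPoint_sub (μ : ℝ) {i j : RootIndex r₁ r₂} (hij : i ≠ j) :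
    1 ≤ ‖gridPoint μ i - gridPoint μ j‖ := by
  have hcast : ∀ {m : ℕ} {a b : Fin m}, a ≠ b → 1 ≤ |(a : ℝ) - b| := by
    intro m a b hab
    have h1 : ((a : ℕ) : ℤ) - (b : ℕ) ≠ 0 := by
      intro h; apply hab; ext; omega
    have h2 := Int.one_le_abs h1
    exact_mod_cast h2
  rcases i with i | i | i <;> rcases j with j | j | j
  · refine le_trans ?_ (Complex.abs_re_le_norm _)
    simpa [gridPoint] using hcast (fun h => hij (by rw [h]))
  · refine le_trans ?_ (Complex.abs_im_le_norm _)
    simp only [gridPoint, Complex.sub_im]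
    rw [abs_of_nonpos] <;> linarith [Nat.cast_nonneg (α := ℝ) (j : ℕ)]
  · refine le_trans ?_ (Complex.abs_im_le_norm _)
    simp only [gridPoint, Complex.sub_im]
    rw [abs_of_nonneg] <;> linarith [Nat.cast_nonneg (α := ℝ) (j : ℕ)]
  · refine le_trans ?_ (Complex.abs_im_le_norm _)
    simp only [gridPoint, Complex.sub_im]
    rw [abs_of_nonneg] <;> linarith [Nat.cast_nonneg (α := ℝ) (i : ℕ)]
  · refine le_trans ?_ (Complex.abs_im_le_norm _)
    simpa [gridPoint] using hcast (fun h => hij (by rw [h]))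
  · refine le_trans ?_ (Complex.abs_im_le_norm _)
    simp only [gridPoint, Complex.sub_im]
    rw [abs_of_nonneg] <;>
      linarith [Nat.cast_nonneg (α := ℝ) (i : ℕ), Nat.cast_nonneg (α := ℝ) (j : ℕ)]
  · refine le_trans ?_ (Complex.abs_im_le_norm _)
    simp only [gridPoint, Complex.sub_im]
    rw [abs_of_nonpos] <;> linarith [Nat.cast_nonneg (α := ℝ) (i : ℕ)]
  · refine le_trans ?_ (Complex.abs_im_le_norm _)
    simp only [gridPoint, Complex.sub_im]
    rw [abs_of_nonpos] <;>
      linarith [Nat.cast_nonneg (α := ℝ) (i : ℕ), Nat.cast_nonneg (α := ℝ) (j : ℕ)]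
  · refine le_trans ?_ (Complex.abs_im_le_norm _)
    have := hcast (fun h : j = i => hij (by rw [h]))
    simp only [gridPoint, Complex.sub_im]
    rw [show -((i : ℝ) + 1) - -((j : ℝ) + 1) = j - i by ring]
    exact this

/-- A monic real polynomial of degree `r₁ + 2 r₂` with a root in each of the disjoint discs of
radius `Y / 3` around the scaled grid points has `r₁` real roots and `r₂` conjugate pairs. -/
theorem exists_factorization_of_near_roots (μ : ℝ) {Y : ℝ} (hY : 0 < Y) {f : ℝ[X]} (hf : f.Monic)
    (hdeg : f.natDegree = r₁ + 2 * r₂)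
    (hroot : ∀ i : RootIndex r₁ r₂, ∃ β, (f.map (algebraMap ℝ ℂ)).IsRoot β ∧
      ‖Y * gridPoint μ i - β‖ < Y / 3) :
    f.Separable ∧ ∃ (x : Fin r₁ → ℝ) (z : Fin r₂ → ℂ), (∀ j, (z j).im ≠ 0) ∧
      f = (∏ i, (X - C (x i))) *
        ∏ j, (X ^ 2 - C (2 * (z j).re) * X + C (Complex.normSq (z j))) := by
  choose β hβ hβn using hroot
  have huniq : ∀ {i j : RootIndex r₁ r₂}, ‖Y * gridPoint μ i - β j‖ < Y / 3 → i = j := by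
    intro i j h
    by_contra hij
    have h1 := one_le_norm_gridPoint_sub μ hij
    have h2 : Y * ‖gridPoint μ i - gridPoint μ j‖ < 2 * Y / 3 := by
      calc Y * ‖gridPoint μ i - gridPoint μ j‖ = ‖(Y : ℂ) * (gridPoint μ i - gridPoint μ j)‖ := by
            rw [norm_mul, Complex.norm_real, Real.norm_of_nonneg hY.le]
        _ = ‖(Y * gridPoint μ i - β j) - (Y * gridPoint μ j - β j)‖ := by congr 1; ring
        _ ≤ ‖Y * gridPoint μ i - β j‖ + ‖Y * gridPoint μ j - β j‖ := norm_sub_le _ _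
        _ < 2 * Y / 3 := by linarith [hβn j]
    nlinarith
  have hinj : Function.Injective β := fun i j h => huniq (h ▸ hβn i)
  have hfC : (f.map (algebraMap ℝ ℂ)).Monic := hf.map _
  have hprod : f.map (algebraMap ℝ ℂ) = ∏ i, (X - C (β i)) := by
    refine (eq_of_monic_of_dvd_of_natDegree_le (monic_prod_X_sub_C β Finset.univ) hfC ?_ ?_)
    · refine Finset.prod_dvd_of_coprime ?_ fun i _ => dvd_iff_isRoot.2 (hβ i)
      intro i _ j _ hij
      exact pairwise_coprime_X_sub_C hinj hij
    · rw [natDegree_map, hdeg, natDegree_prod_of_monic _ _ fun i _ => monic_X_sub_C _]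
      simp
      omega
  have hconj : ∀ i, β i.conj = (starRingEnd ℂ) (β i) := by
    intro i
    have h1 : (f.map (algebraMap ℝ ℂ)).IsRoot ((starRingEnd ℂ) (β i)) := by
      have h2 := hβ i
      rw [IsRoot.def, eval_map_algebraMap] at h2 ⊢
      have h3 := aeval_conj f (β i)
      rw [h3, h2, map_zero]
    rw [hprod, IsRoot.def, eval_prod, Finset.prod_eq_zero_iff] at h1
    obtain ⟨j, -, hj⟩ := h1
    rw [eval_sub, eval_X, eval_C, sub_eq_zero] at hj
    have h4 : ‖Y * gridPoint μ i.conj - β j‖ < Y / 3 := by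
      rw [← hj, gridPoint_conj]
      have : (Y : ℂ) * (starRingEnd ℂ) (gridPoint μ i) - (starRingEnd ℂ) (β i) =
          (starRingEnd ℂ) (Y * gridPoint μ i - β i) := by simp
      rw [this, Complex.norm_conj]
      exact hβn i
    rw [huniq h4, hj]
  constructor
  · rw [← separable_map (algebraMap ℝ ℂ), hprod]
    exact separable_prod_X_sub_C_iff.2 hinj
  · refine ⟨fun i => (β (.inl i)).re, fun j => β (.inr (.inl j)), ?_, ?_⟩
    · intro j h0
      have h1 := (Complex.abs_im_le_norm _).trans_lt (hβn (.inr (.inl j)))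
      simp only [gridPoint, Complex.sub_im, h0, Complex.mul_im, Complex.ofReal_re,
        Complex.ofReal_im, zero_mul, add_zero, sub_zero] at h1
      have h2 : Y * 1 ≤ Y * ((j : ℝ) + 1) := by
        have : (0 : ℝ) ≤ (j : ℕ) := Nat.cast_nonneg _
        gcongr
        linarith
      rw [abs_of_pos (by linarith)] at h1
      linarith
    · apply map_injective (algebraMap ℝ ℂ) Complex.ofReal_injective
      rw [hprod, Fintype.prod_sum_type, Fintype.prod_sum_type, Polynomial.map_mul,
        Polynomial.map_prod, Polynomial.map_prod, ← Finset.prod_mul_distrib]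
      congr 1
      · refine Finset.prod_congr rfl fun i _ => ?_
        have h1 : ((β (.inl i)).re : ℂ) = β (.inl i) :=
          Complex.conj_eq_iff_re.1 (hconj (.inl i)).symm
        simp [h1]
      · refine Finset.prod_congr rfl fun j _ => ?_
        have h1 : β (.inr (.inr j)) = (starRingEnd ℂ) (β (.inr (.inl j))) := hconj (.inr (.inl j))
        have h2 : (C ((2 * (β (.inr (.inl j))).re : ℝ) : ℂ) : ℂ[X]) =
            C (β (.inr (.inl j))) + C (β (.inr (.inr j))) := by
          rw [h1, ← map_add, Complex.add_conj]
        have h3 : (C ((Complex.normSq (β (.inr (.inl j))) : ℝ) : ℂ) : ℂ[X]) =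
            C (β (.inr (.inl j))) * C (β (.inr (.inr j))) := by
          rw [h1, ← map_mul, Complex.mul_conj]
        simp only [Polynomial.map_add, Polynomial.map_sub, Polynomial.map_mul, Polynomial.map_pow,
          map_X, map_C, Complex.coe_algebraMap]
        rw [h2, h3]
        ring

/-- There is a monic real polynomial `∑ a_i x^(n-i)` of degree `n = r₁ + 2 r₂` with `a_1 = 0`
such that all real polynomials near one of its rescalings `∑ a_i Y^i x^(n-i)` are separable with
`r₁` real roots and `r₂` pairs of conjugate roots. -/
theorem exists_stable_coefficients {n : ℕ} (hn : 0 < n) (hr : r₁ + 2 * r₂ = n) :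
    ∃ (a : ℕ → ℝ) (ε : ℝ), 0 < ε ∧ a 1 = 0 ∧ ∀ (Y : ℝ) (f : ℝ[X]), 0 < Y → f.Monic →
      f.natDegree = n → (∀ i, 1 ≤ i → i ≤ n → |f.coeff (n - i) - a i * Y ^ i| ≤ ε * Y ^ i) →
      f.Separable ∧ ∃ (x : Fin r₁ → ℝ) (z : Fin r₂ → ℂ), (∀ j, (z j).im ≠ 0) ∧
        f = (∏ i, (X - C (x i))) *
          ∏ j, (X ^ 2 - C (2 * (z j).re) * X + C (Complex.normSq (z j))) := by
  -- the shift `μ` makes the sum of the roots vanish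
  set μ : ℝ := (∑ i : Fin r₁, (i : ℝ)) / n with hμ
  set α : RootIndex r₁ r₂ → ℂ := gridPoint μ with hα
  set g : ℂ[X] := ∏ i, (X - C (α i)) with hg
  have hcard : Fintype.card (RootIndex r₁ r₂) = n := by simp; omega
  have hgdeg : g.natDegree = n := by
    rw [hg, natDegree_prod_of_monic _ _ fun i _ => monic_X_sub_C _]
    simp only [natDegree_X_sub_C, Finset.sum_const, Finset.card_univ, hcard, smul_eq_mul, mul_one]
  have hgmonic : g.Monic := monic_prod_X_sub_C α Finset.univ
  have hgconj : g.map (starRingEnd ℂ) = g := by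
    rw [hg, Polynomial.map_prod]
    have hinv : Function.Involutive (RootIndex.conj (r₁ := r₁) (r₂ := r₂)) := by
      intro i; rcases i with i | j | j <;> rfl
    refine Fintype.prod_equiv hinv.toPerm _ _ fun i => ?_
    rw [Function.Involutive.coe_toPerm, hα, gridPoint_conj]
    simp
  have hreal : ∀ i, g.coeff i = ((g.coeff i).re : ℂ) := by
    intro i
    refine (Complex.conj_eq_iff_re.1 ?_).symm
    rw [← coeff_map, hgconj]
  have hsum : ∑ i, α i = 0 := by
    have h1 : ((∑ i : Fin r₁, (i : ℝ) : ℝ) : ℂ) = n * μ := by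
      rw [hμ]
      have : (n : ℂ) ≠ 0 := by exact_mod_cast hn.ne'
      push_cast
      rw [mul_div_cancel₀ _ this]
    have e1 : ∀ i : Fin r₁, α (.inl i) = ((i : ℝ) : ℂ) - μ := by
      intro i; simp [hα, gridPoint, Complex.ext_iff]
    have e2 : ∀ j : Fin r₂, α (.inr (.inl j)) + α (.inr (.inr j)) = -2 * (μ : ℂ) := by
      intro j; simp [hα, gridPoint, Complex.ext_iff]; ring
    rw [Fintype.sum_sum_type, Fintype.sum_sum_type, ← Finset.sum_add_distrib]
    simp only [e1, e2, Finset.sum_sub_distrib, Finset.sum_const, Finset.card_univ, Fintype.card_fin,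
      nsmul_eq_mul]
    rw [← Complex.ofReal_sum, h1, ← hr]
    push_cast
    ring
  obtain ⟨M, hM1, hM⟩ : ∃ M : ℝ, 1 ≤ M ∧ ∀ i, ‖α i‖ ≤ M := by
    refine ⟨1 + ∑ i, ‖α i‖, ?_, fun i => ?_⟩
    · have : 0 ≤ ∑ i, ‖α i‖ := Finset.sum_nonneg fun _ _ => norm_nonneg _
      linarith
    · have := Finset.single_le_sum (f := fun i => ‖α i‖) (fun i _ => norm_nonneg _)
        (Finset.mem_univ i)
      linarith
  have hM0 : 0 < M := by linarith
  -- with this `ε` the perturbed polynomial is less than `(Y / 3)^n` at the points `Y α_i`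
  set ε : ℝ := (1 / 3) ^ n / (n * M ^ n + 1) with hε
  have hε0 : 0 < ε := by positivity
  refine ⟨fun i => (g.coeff (n - i)).re, ε, hε0, ?_, ?_⟩
  · have h1 : g.nextCoeff = 0 := by
      rw [hg, Polynomial.prod_X_sub_C_nextCoeff, hsum, neg_zero]
    rw [nextCoeff_of_natDegree_pos (by omega), hgdeg] at h1
    simp only [h1, Complex.zero_re]
  · intro Y f hY hf hfdeg hclose
    refine exists_factorization_of_near_roots μ hY hf (by omega) fun i => ?_
    refine exists_root_near (hf.map _) (by positivity) ?_
    rw [natDegree_map, hfdeg]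
    have hgi : g.eval (α i) = 0 := by
      rw [hg, eval_prod]
      exact Finset.prod_eq_zero (Finset.mem_univ i) (by simp)
    have hval : (f.map (algebraMap ℝ ℂ)).eval (Y * α i) =
        ∑ j ∈ Finset.range n, ((f.coeff j - (g.coeff j).re * Y ^ (n - j) : ℝ) : ℂ) *
          (Y * α i) ^ j := by
      have e1 : (f.map (algebraMap ℝ ℂ)).eval (Y * α i) =
          ∑ j ∈ Finset.range n, (f.coeff j : ℂ) * (Y * α i) ^ j + (Y * α i) ^ n := by
        rw [eval_eq_sum_range, natDegree_map, hfdeg, Finset.sum_range_succ]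
        have : f.coeff n = 1 := by rw [← hfdeg]; exact hf
        simp [this]
      have e2 : (0 : ℂ) = ∑ j ∈ Finset.range n, ((g.coeff j).re : ℂ) * Y ^ (n - j) * (Y * α i) ^ j +
          (Y * α i) ^ n := by
        have h1 : (Y : ℂ) ^ n * g.eval (α i) = 0 := by rw [hgi, mul_zero]
        rw [eval_eq_sum_range, hgdeg, Finset.sum_range_succ, mul_add, Finset.mul_sum] at h1
        rw [← h1]
        have : g.coeff n = 1 := by rw [← hgdeg]; exact hgmonic
        rw [this, one_mul, mul_pow]
        refine congrArg (· + _) (Finset.sum_congr rfl fun j hj => ?_)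
        have hjn := Finset.mem_range.1 hj
        rw [← hreal j, mul_pow]
        have : (Y : ℂ) ^ n = Y ^ (n - j) * Y ^ j := by rw [← pow_add]; congr 1; omega
        rw [this]
        ring
      rw [e1, ← sub_zero (_ + _), e2, add_sub_add_right_eq_sub, ← Finset.sum_sub_distrib]
      refine Finset.sum_congr rfl fun j _ => ?_
      push_cast
      ring
    rw [hval]
    calc _ ≤ ∑ j ∈ Finset.range n, ε * M ^ n * Y ^ n := by
          refine (norm_sum_le _ _).trans (Finset.sum_le_sum fun j hj => ?_)
          have hjn := Finset.mem_range.1 hj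
          have h1 := hclose (n - j) (by omega) (by omega)
          simp only [show n - (n - j) = j by omega] at h1
          rw [norm_mul, norm_pow, norm_mul, Complex.norm_real, Complex.norm_real, Real.norm_eq_abs,
            Real.norm_of_nonneg hY.le, mul_pow]
          have h2 : ‖α i‖ ^ j ≤ M ^ n :=
            (pow_le_pow_left₀ (norm_nonneg _) (hM i) j).trans (pow_le_pow_right₀ hM1 hjn.le)
          have h3 : Y ^ n = Y ^ (n - j) * Y ^ j := by rw [← pow_add]; congr 1; omega
          calc _ ≤ (ε * Y ^ (n - j)) * (Y ^ j * M ^ n) := by gcongr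
            _ = ε * M ^ n * Y ^ n := by rw [h3]; ring
      _ = ε * (n * M ^ n) * Y ^ n := by rw [Finset.sum_const, Finset.card_range, nsmul_eq_mul]; ring
      _ < ε * (n * M ^ n + 1) * Y ^ n := by gcongr; linarith
      _ = (Y / 3) ^ n := by
        rw [hε, div_mul_cancel₀ _ (by positivity), ← mul_pow]
        congr 1
        ring

end Roots

/-! ### Signatures of real forms -/

namespace BinaryForm

section Signature

/-- The homogenization of a real quadratic polynomial without real roots is irreducible. -/
theorem irreducible_homogenize_two {q : ℝ[X]} (hq : q.natDegree = 2) (hroot : ∀ x, ¬ q.IsRoot x) :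
    Irreducible (q.homogenize 2) := by
  have hq0 : q ≠ 0 := by rintro rfl; simp at hq
  have hirr : Irreducible q := by
    rw [irreducible_iff_roots_eq_zero_of_degree_le_three (by omega) (by omega)]
    exact Multiset.eq_zero_of_forall_notMem fun x hx => hroot x (isRoot_of_mem_roots hx)
  have hq' : q.homogenize 2 ≠ 0 := by rwa [Ne, homogenize_eq_zero_iff hq.le]
  constructor
  · intro hu
    have := hu.map (MvPolynomial.aeval ![(X : ℝ[X]), 1])
    rw [aeval_homogenize_X_one q hq.le] at this
    exact hirr.not_isUnit this
  · intro A B hAB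
    have hA0 : A ≠ 0 := by rintro rfl; rw [zero_mul] at hAB; exact hq' hAB
    have hB0 : B ≠ 0 := by rintro rfl; rw [mul_zero] at hAB; exact hq' hAB
    have hdeg : A.totalDegree + B.totalDegree = 2 := by
      rw [← MvPolynomial.totalDegree_mul_of_isDomain hA0 hB0, ← hAB]
      exact (isHomogeneous_homogenize q).totalDegree hq'
    have hle : ∀ P : MvPolynomial (Fin 2) ℝ,
        (MvPolynomial.aeval ![(X : ℝ[X]), 1] P).natDegree ≤ P.totalDegree := by
      intro P
      rw [P.as_sum, map_sum, ← P.as_sum]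
      refine natDegree_sum_le_of_forall_le _ _ fun m hm => ?_
      rw [MvPolynomial.aeval_monomial]
      refine le_trans ?_ (MvPolynomial.le_totalDegree hm)
      rw [Finsupp.prod_fintype _ _ (by simp), Finsupp.sum_fintype _ _ (by simp)]
      simp only [Fin.prod_univ_two, Fin.sum_univ_two, Matrix.cons_val_zero, Matrix.cons_val_one,
        one_pow, mul_one, algebraMap_eq]
      exact (natDegree_C_mul_X_pow_le _ _).trans (Nat.le_add_right _ _)
    have hab : q =
        MvPolynomial.aeval ![(X : ℝ[X]), 1] A * MvPolynomial.aeval ![(X : ℝ[X]), 1] B := by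
      rw [← map_mul, ← hAB, aeval_homogenize_X_one q hq.le]
    have hAle := hle A
    have hBle := hle B
    generalize MvPolynomial.aeval ![(X : ℝ[X]), 1] A = a at hab hAle
    generalize MvPolynomial.aeval ![(X : ℝ[X]), 1] B = b at hab hBle
    have hab2 : a.natDegree + b.natDegree = 2 := by
      rw [← natDegree_mul, ← hab, hq]
      · rintro h; rw [h, zero_mul] at hab; exact hq0 hab
      · rintro h; rw [h, mul_zero] at hab; exact hq0 hab
    have hunit : ∀ P : MvPolynomial (Fin 2) ℝ, P ≠ 0 → P.totalDegree = 0 → IsUnit P := by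
      intro P hP hd
      rw [MvPolynomial.totalDegree_eq_zero_iff_eq_C] at hd
      rw [hd] at hP ⊢
      refine (IsUnit.mk0 _ ?_).map MvPolynomial.C
      rintro h
      rw [h, map_zero] at hP
      exact hP rfl
    rcases hirr.isUnit_or_isUnit hab with h | h
    · left
      have := natDegree_eq_zero_of_isUnit h
      exact hunit A hA0 (by omega)
    · right
      have := natDegree_eq_zero_of_isUnit h
      exact hunit B hB0 (by omega)

theorem hasSignature_of_factorization {n r₁ r₂ : ℕ} (hr : r₁ + 2 * r₂ = n) (hr1 : 0 < r₁)
    (G : BinaryForm ℝ n) (c : ℝ) (x : Fin r₁ → ℝ) (z : Fin r₂ → ℂ) (hz : ∀ j, (z j).im ≠ 0)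
    (h : dehomog G = C c * ((∏ i, (X - C (x i))) *
      ∏ j, (X ^ 2 - C (2 * (z j).re) * X + C (Complex.normSq (z j))))) :
    G.HasSignature r₁ r₂ := by
  -- the constant factor is absorbed into the first linear form
  set L : Fin r₁ → BinaryForm ℝ 1 := fun i k =>
    (if i = ⟨0, hr1⟩ then c else 1) * (![1, -x i] : Fin 2 → ℝ) k with hL
  set Q : Fin r₂ → BinaryForm ℝ 2 := fun j =>
    (![1, -(2 * (z j).re), Complex.normSq (z j)] : Fin 3 → ℝ) with hQ
  have hLd : ∀ i, dehomog (L i) = C (if i = ⟨0, hr1⟩ then c else 1) * (X - C (x i)) := by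
    intro i
    rw [dehomog, Fin.sum_univ_two, hL]
    simp only [Matrix.cons_val_zero, Matrix.cons_val_one, Fin.val_zero, Fin.val_one, map_mul]
    simp
    ring
  have hQd : ∀ j, dehomog (Q j) =
      X ^ 2 - C (2 * (z j).re) * X + C (Complex.normSq (z j)) := by
    intro j
    rw [dehomog, Fin.sum_univ_three, hQ]
    simp
    ring
  have hQdeg : ∀ j, (dehomog (Q j)).natDegree = 2 := by
    intro j
    refine le_antisymm (natDegree_dehomog_le _) (le_natDegree_of_ne_zero ?_)
    have := coeff_dehomog (Q j) (Nat.zero_le 2)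
    rw [Nat.sub_zero, coef_zero] at this
    rw [this, hQ]
    simp
  refine ⟨L, Q, fun j => ?_, ?_⟩
  · rw [toMvPoly_eq_homogenize]
    refine irreducible_homogenize_two (hQdeg j) fun y hy => ?_
    rw [hQd, IsRoot.def] at hy
    simp only [eval_add, eval_sub, eval_pow, eval_X, eval_mul, eval_C] at hy
    have h1 : (y - (z j).re) ^ 2 + (z j).im ^ 2 = 0 := by
      rw [← hy, Complex.normSq_apply]; ring
    have h2 : 0 < (z j).im ^ 2 := by have := hz j; positivity
    nlinarith [sq_nonneg (y - (z j).re)]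
  · have hc : (∏ i : Fin r₁, C (if i = ⟨0, hr1⟩ then c else 1) : ℝ[X]) = C c := by
      rw [Finset.prod_eq_single (⟨0, hr1⟩ : Fin r₁)]
      · rw [if_pos rfl]
      · intro b _ hb; rw [if_neg hb, map_one]
      · intro hn; exact absurd (Finset.mem_univ _) hn
    have h1 : dehomog G = (∏ i, dehomog (L i)) * ∏ j, dehomog (Q j) := by
      rw [h]
      simp only [hLd, hQd]
      rw [Finset.prod_mul_distrib, hc, mul_assoc]
    have hs1 : (∑ _i : Fin r₁, 1) = r₁ := by simp
    have hs2 : (∑ _j : Fin r₂, 2) = 2 * r₂ := by simp [mul_comm]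
    have hd1 : (∏ i, dehomog (L i)).natDegree ≤ ∑ _i : Fin r₁, 1 :=
      (natDegree_prod_le _ _).trans (Finset.sum_le_sum fun i _ => natDegree_dehomog_le _)
    have hd2 : (∏ j, dehomog (Q j)).natDegree ≤ ∑ _j : Fin r₂, 2 :=
      (natDegree_prod_le _ _).trans (Finset.sum_le_sum fun i _ => natDegree_dehomog_le _)
    have hn : n = (∑ _i : Fin r₁, 1) + ∑ _j : Fin r₂, 2 := by rw [hs1, hs2, hr]
    rw [toMvPoly_eq_homogenize, h1]
    conv_lhs => rw [hn]
    rw [homogenize_mul _ _ hd1 hd2,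
      homogenize_finsetProd (fun i _ => natDegree_dehomog_le _),
      homogenize_finsetProd (fun i _ => natDegree_dehomog_le _)]
    simp only [toMvPoly_eq_homogenize]

end Signature

/-! ### Translation and height -/

section Translate

variable {S : Type*} [CommRing S] {n : ℕ}

theorem dehomog_translate (s : S) (G : BinaryForm S n) :
    dehomog (translate s G) = taylor s (dehomog G) := by
  ext j
  rcases le_or_gt j n with hj | hj
  · have h1 := coeff_dehomog (translate s G) (Nat.sub_le n j)
    rw [Nat.sub_sub_self hj] at h1
    rw [h1, coef, dif_pos (by omega), translate]
    simp only [Nat.sub_sub_self hj]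
  · rw [coeff_eq_zero_of_natDegree_lt ((natDegree_dehomog_le _).trans_lt hj),
      coeff_eq_zero_of_natDegree_lt]
    rw [natDegree_taylor]
    exact (natDegree_dehomog_le _).trans_lt hj

theorem translate_translate (r s : S) (G : BinaryForm S n) :
    translate r (translate s G) = translate (r + s) G := by
  apply dehomog_injective
  rw [dehomog_translate, dehomog_translate, dehomog_translate, taylor_taylor]

theorem translate_zero (G : BinaryForm S n) : translate 0 G = G := by
  apply dehomog_injective
  rw [dehomog_translate, taylor_zero]

theorem map_translate {T : Type*} [CommRing T] (φ : S →+* T) (s : S) (G : BinaryForm S n) :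
    (translate s G).map φ = translate (φ s) (G.map φ) := by
  apply dehomog_injective
  rw [dehomog_map, dehomog_translate, dehomog_translate, dehomog_map, map_taylor]

theorem coef_translate (s : S) (G : BinaryForm S n) {i : ℕ} (hi : i ≤ n) :
    (translate s G).coef i = ∑ l ∈ Finset.range (n + 1),
      G.coef l * (s ^ (n - l - (n - i)) * ((n - l).choose (n - i) : S)) := by
  rw [← coeff_dehomog _ hi, dehomog_translate, dehomog_eq_sum_range, map_sum, finsetSum_coeff]
  refine Finset.sum_congr rfl fun l _ => ?_
  rw [taylor_mul, taylor_C, taylor_X_pow, coeff_C_mul, coeff_X_add_C_pow]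

theorem coef_translate_zero (s : S) (G : BinaryForm S n) :
    (translate s G).coef 0 = G.coef 0 := by
  rw [coef_translate s G (Nat.zero_le n), Finset.sum_eq_single 0]
  · simp
  · intro l hl hl0
    have := Finset.mem_range.1 hl
    rw [Nat.choose_eq_zero_of_lt (by omega)]
    simp
  · simp

theorem coef_translate_one (hn : 1 ≤ n) (s : S) (G : BinaryForm S n) :
    (translate s G).coef 1 = G.coef 1 + n * s * G.coef 0 := by
  rw [coef_translate s G hn, ← Finset.sum_subset (s₁ := {0, 1})]
  · obtain ⟨m, rfl⟩ : ∃ m, n = m + 1 := ⟨n - 1, by omega⟩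
    rw [Finset.sum_pair (by omega)]
    simp
    ring
  · intro j hj
    rw [Finset.mem_range]
    rcases Finset.mem_insert.1 hj with rfl | hj
    · omega
    · rw [Finset.mem_singleton.1 hj]; omega
  · intro l hl hl0
    have := Finset.mem_range.1 hl
    have h1 : l ≠ 0 ∧ l ≠ 1 := by simpa using hl0
    rw [Nat.choose_eq_zero_of_lt (by omega)]
    simp

theorem orbit_translate (s : ℤ) (F : BinaryForm ℤ n) : orbit (translate s F) = orbit F := by
  unfold orbit
  ext G
  constructor
  · rintro ⟨r, rfl⟩
    exact ⟨r + s, (translate_translate r s F).symm⟩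
  · rintro ⟨r, rfl⟩
    refine ⟨r - s, ?_⟩
    simp only
    rw [translate_translate, sub_add_cancel]

theorem mem_orbit_self (F : BinaryForm ℤ n) : F ∈ orbit F := ⟨0, translate_zero F⟩

/-- Translating by a bounded amount distorts coefficients of size `O(Y^i)` by a bounded factor. -/
theorem abs_coef_translate_le {s σ B Y : ℝ} {G : BinaryForm ℝ n} (hs : |s| ≤ σ) (hσ : 1 ≤ σ)
    (hB : 0 ≤ B) (hY : 1 ≤ Y) (hG : ∀ i ≤ n, |G.coef i| ≤ B * Y ^ i) {i : ℕ} (hi : i ≤ n) :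
    |(translate s G).coef i| ≤ (n + 1) * (σ ^ n * 2 ^ n) * B * Y ^ i := by
  rw [coef_translate s G hi]
  calc _ ≤ ∑ l ∈ Finset.range (n + 1), B * Y ^ i * (σ ^ n * 2 ^ n) := by
        refine (Finset.abs_sum_le_sum_abs _ _).trans (Finset.sum_le_sum fun l hl => ?_)
        have hln := Finset.mem_range.1 hl
        rcases le_or_gt l i with hli | hli
        · rw [abs_mul, abs_mul, abs_pow, Nat.abs_cast]
          have h1 : |G.coef l| ≤ B * Y ^ i := (hG l (by omega)).trans (by gcongr)
          have h2 : |s| ^ (n - l - (n - i)) ≤ σ ^ n :=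
            (pow_le_pow_left₀ (abs_nonneg _) hs _).trans (pow_le_pow_right₀ hσ (by omega))
          have h3 : ((n - l).choose (n - i) : ℝ) ≤ 2 ^ n := by
            have h4 : (n - l).choose (n - i) ≤ 2 ^ n :=
              (Nat.choose_le_two_pow _ _).trans (Nat.pow_le_pow_right (by omega) (by omega))
            exact_mod_cast h4
          gcongr
        · rw [Nat.choose_eq_zero_of_lt (by omega), Nat.cast_zero, mul_zero, mul_zero, abs_zero]
          positivity
    _ = _ := by
        rw [Finset.sum_const, Finset.card_range, nsmul_eq_mul]
        push_cast
        ring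

end Translate

section Height

variable {n : ℕ}

theorem coef_monicize (G : BinaryForm ℝ n) {i : ℕ} (hi : i ≤ n) :
    (monicize G).coef i = (G 0)⁻¹ * (G.coef i * G 0 ^ i) := by
  have h1 := coef_of_lt (monicize G) ⟨i, by omega⟩
  have h2 := coef_of_lt G ⟨i, by omega⟩
  simp only at h1 h2
  rw [h1, h2, monicize]

/-- Substituting `f_0 x` turns the monicized form into a multiple of the original one. -/
theorem dehomog_monicize_comp {G : BinaryForm ℝ n} (h0 : G 0 ≠ 0) :
    C (G 0) * (dehomog (monicize G)).comp (C (G 0) * X) = C (G 0 ^ n) * dehomog G := by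
  rw [dehomog_eq_sum_range, dehomog_eq_sum_range, ← coe_compRingHom_apply, map_sum,
    Finset.mul_sum, Finset.mul_sum]
  refine Finset.sum_congr rfl fun i hi => ?_
  have hin : i ≤ n := by have := Finset.mem_range.1 hi; omega
  rw [coe_compRingHom_apply, coef_monicize G hin, mul_comp, pow_comp, C_comp, X_comp,
    mul_pow, ← mul_assoc, ← mul_assoc,
    ← mul_assoc, ← mul_assoc, ← map_pow, ← map_mul, ← map_mul, ← map_mul]
  have : G 0 ^ n = G 0 ^ i * G 0 ^ (n - i) := by rw [← pow_add]; congr 1; omega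
  rw [this]
  congr 2
  field_simp

theorem monicize_translate {G : BinaryForm ℝ n} (h0 : G 0 ≠ 0) (s : ℝ) :
    monicize (translate s G) = translate (G 0 * s) (monicize G) := by
  have h0' : translate s G 0 = G 0 := by
    rw [← coef_zero (translate s G), coef_translate_zero, coef_zero]
  apply dehomog_injective
  rw [dehomog_translate]
  have h1 := dehomog_monicize_comp (G := translate s G) (by rwa [h0'])
  rw [h0', dehomog_translate] at h1
  have h2 := congrArg (fun p => p.comp (X + C s)) (dehomog_monicize_comp h0)
  simp only [mul_comp, C_comp, comp_assoc, X_comp] at h2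
  rw [← taylor_apply, ← h1] at h2
  have h3 : (dehomog (monicize G)).comp (C (G 0) * (X + C s)) =
      (taylor (G 0 * s) (dehomog (monicize G))).comp (C (G 0) * X) := by
    rw [taylor_apply, comp_assoc]
    simp [mul_add]
  rw [h3] at h2
  have h4 := mul_left_cancel₀ (C_ne_zero.2 h0) h2
  have h5 := congrArg (fun p => p.comp (C (G 0)⁻¹ * X)) h4
  simp only [comp_assoc] at h5
  have h6 : (C (G 0) * X).comp (C (G 0)⁻¹ * X) = (X : ℝ[X]) := by
    simp only [mul_comp, C_comp, X_comp]
    rw [← mul_assoc, ← map_mul, mul_inv_cancel₀ h0, map_one, one_mul]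
  rw [h6, comp_X, comp_X] at h5
  exact h5.symm

theorem coef_depressed_zero {G : BinaryForm ℝ n} (h0 : G 0 ≠ 0) : (depressed G).coef 0 = 1 := by
  rw [depressed, coef_translate_zero, coef_monicize G (Nat.zero_le n), coef_zero, pow_zero, mul_one,
    inv_mul_cancel₀ h0]

theorem coef_monicize_one {G : BinaryForm ℝ n} (hn : 1 ≤ n) (h0 : G 0 ≠ 0) :
    (monicize G).coef 1 = G.coef 1 := by
  rw [coef_monicize G hn, pow_one]
  field_simp

theorem coef_depressed_one {G : BinaryForm ℝ n} (hn : 1 ≤ n) (h0 : G 0 ≠ 0) :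
    (depressed G).coef 1 = 0 := by
  rw [depressed, coef_translate_one hn, coef_monicize G (Nat.zero_le n), coef_zero, pow_zero,
    mul_one, inv_mul_cancel₀ h0, mul_one]
  have : (n : ℝ) ≠ 0 := by exact_mod_cast (by omega : n ≠ 0)
  field_simp
  ring

theorem monicize_eq_translate_depressed {G : BinaryForm ℝ n} (hn : 1 ≤ n) (h0 : G 0 ≠ 0) :
    monicize G = translate (G.coef 1 / n) (depressed G) := by
  rw [depressed, translate_translate, coef_monicize_one hn h0]
  rw [show G.coef 1 / n + -(G.coef 1) / n = 0 by ring, translate_zero]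

theorem height_lt_iff (G : BinaryForm ℝ n) {X : ℝ} (hX : 0 < X) :
    (G.height : ℝ) < X ↔ ∀ i, 2 ≤ i → i ≤ n → |G.depressed.coef i| < X ^ i := by
  lift X to NNReal using hX.le
  rw [NNReal.coe_lt_coe, height, Finset.sup_lt_iff (by exact_mod_cast hX)]
  refine ⟨fun h i h2 hin => ?_, fun h i hi => ?_⟩
  · have h1 := h i (Finset.mem_Icc.2 ⟨h2, hin⟩)
    have hi0 : (0 : ℝ) < i := by exact_mod_cast (by omega : 0 < i)
    rw [one_div, NNReal.rpow_inv_lt_iff hi0, NNReal.rpow_natCast] at h1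
    exact_mod_cast h1
  · obtain ⟨h2, hin⟩ := Finset.mem_Icc.1 hi
    have h1 := h i h2 hin
    have hi0 : (0 : ℝ) < i := by exact_mod_cast (by omega : 0 < i)
    rw [one_div, NNReal.rpow_inv_lt_iff hi0, NNReal.rpow_natCast]
    exact_mod_cast h1

/-- A form of height less than `X` has a translate whose second coefficient is reduced modulo
`n f_0` and whose other coefficients are `O(X^i)`. -/
theorem exists_reduced_translate (hn : 1 ≤ n) {F : BinaryForm ℤ n} (h0 : F 0 ≠ 0) {X : ℝ}
    (hX : 1 ≤ X) (hF : ((F.map (Int.castRingHom ℝ)).height : ℝ) < X) :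
    ∃ s : ℤ, (translate s F) 0 = F 0 ∧ 0 ≤ (translate s F).coef 1 ∧
      (translate s F).coef 1 < n * |F 0| ∧ ∀ i, 2 ≤ i → i ≤ n →
        |((translate s F).coef i : ℝ)| ≤ (n + 1) * (|(F 0 : ℝ)| ^ n * 2 ^ n) * X ^ i := by
  set N : ℤ := n * F 0 with hN
  have hN0 : N ≠ 0 := mul_ne_zero (by exact_mod_cast (by omega : n ≠ 0)) h0
  set s : ℤ := -(F.coef 1 / N) with hs
  have h1 : (translate s F).coef 1 = F.coef 1 % N := by
    rw [coef_translate_one hn, coef_zero, hs, Int.emod_def]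
    ring
  have hNabs : |N| = n * |F 0| := by rw [hN, abs_mul, Nat.abs_cast]
  have hlt : (translate s F).coef 1 < n * |F 0| := by
    rw [h1, ← hNabs]; exact Int.emod_lt_abs _ hN0
  have hnn : 0 ≤ (translate s F).coef 1 := by rw [h1]; exact Int.emod_nonneg _ hN0
  refine ⟨s, by rw [← coef_zero (translate s F), coef_translate_zero, coef_zero], hnn, hlt, ?_⟩
  set G := F.map (Int.castRingHom ℝ) with hG
  set G' := (translate s F).map (Int.castRingHom ℝ) with hG'
  have hG0 : G 0 = F 0 := by simp [hG, map]
  have hG0' : G 0 ≠ 0 := by rw [hG0]; exact_mod_cast h0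
  have hGG' : G' = translate (s : ℝ) G := by rw [hG', map_translate]; rfl
  have hG'0 : G' 0 = G 0 := by
    rw [hGG', ← coef_zero (translate _ G), coef_translate_zero, coef_zero]
  have hf1 : (1 : ℝ) ≤ |(F 0 : ℝ)| := by exact_mod_cast Int.one_le_abs h0
  have hn0 : (0 : ℝ) < n := by exact_mod_cast (by omega : 0 < n)
  have hmon : monicize G' = translate (G'.coef 1 / n) (depressed G) := by
    rw [hGG', monicize_translate hG0', monicize_eq_translate_depressed hn hG0',
      translate_translate, coef_translate_one hn, coef_zero]
    congr 1
    field_simp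
    ring
  have hshift : |G'.coef 1 / n| ≤ |(F 0 : ℝ)| := by
    rw [abs_div, Nat.abs_cast, div_le_iff₀ hn0, hG', coef_map, eq_intCast]
    have h2 : |(translate s F).coef 1| ≤ n * |F 0| := by rw [abs_of_nonneg hnn]; exact hlt.le
    rw [mul_comm]
    exact_mod_cast h2
  have hdep : ∀ i ≤ n, |(depressed G).coef i| ≤ 1 * X ^ i := by
    intro i hi
    rw [one_mul]
    rcases Nat.lt_or_ge i 2 with h | h
    · interval_cases i
      · rw [coef_depressed_zero hG0']; simp
      · rw [coef_depressed_one hn hG0']; simp; linarith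
    · exact ((height_lt_iff G (by linarith)).1 hF i h hi).le
  intro i h2 hi
  have h3 := abs_coef_translate_le hshift hf1 zero_le_one hX hdep hi
  rw [← hmon, coef_monicize G' hi, hG'0, hG0] at h3
  have h4 : G'.coef i = ((translate s F).coef i : ℝ) := by rw [hG', coef_map, eq_intCast]
  rw [h4] at h3
  have h5 : |((F 0 : ℝ))⁻¹ * (((translate s F).coef i : ℝ) * (F 0 : ℝ) ^ i)| =
      |((translate s F).coef i : ℝ)| * |(F 0 : ℝ)| ^ (i - 1) := by
    obtain ⟨j, rfl⟩ : ∃ j, i = j + 1 := ⟨i - 1, by omega⟩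
    rw [abs_mul, abs_mul, abs_inv, abs_pow, Nat.add_sub_cancel, pow_succ]
    have : |(F 0 : ℝ)| ≠ 0 := by positivity
    field_simp
  rw [h5, mul_one] at h3
  refine le_trans ?_ h3
  exact le_mul_of_one_le_right (abs_nonneg _) (one_le_pow₀ hf1)

/-- A form with second coefficient `1` and with coefficients at most `B Y^i` has height less than
`X` once `X / Y` is large. -/
theorem height_lt_of_coef_le (hn : 1 ≤ n) {G : BinaryForm ℝ n} (hG0 : 1 ≤ |G 0|)
    (h1 : G.coef 1 = 1) {B X Y : ℝ} (hB : 0 ≤ B) (hY : 1 ≤ Y) (hX : 0 < X)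
    (hG : ∀ i ≤ n, |G.coef i| ≤ |G 0| * B * Y ^ i)
    (hXY : ((n + 1) * 2 ^ n * (|G 0| ^ n * B) + 1) * Y ≤ X) : (G.height : ℝ) < X := by
  have hG0' : G 0 ≠ 0 := by rintro h; rw [h, abs_zero] at hG0; linarith
  have hn0 : (0 : ℝ) < n := by exact_mod_cast (by omega : 0 < n)
  have hmon : ∀ i ≤ n, |(monicize G).coef i| ≤ (|G 0| ^ n * B) * Y ^ i := by
    intro i hi
    rw [coef_monicize G hi, abs_mul, abs_mul, abs_inv, abs_pow]
    calc |G 0|⁻¹ * (|G.coef i| * |G 0| ^ i) ≤ |G 0|⁻¹ * ((|G 0| * B * Y ^ i) * |G 0| ^ n) := by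
          gcongr
          exact hG i hi
      _ = _ := by
          field_simp
  have hs : |-((monicize G).coef 1) / n| ≤ 1 := by
    rw [coef_monicize_one hn hG0', h1, abs_div, abs_neg, abs_one, Nat.abs_cast, div_le_one hn0]
    exact_mod_cast hn
  rw [height_lt_iff G hX]
  intro i h2 hi
  have h3 := abs_coef_translate_le hs le_rfl (by positivity) hY hmon hi
  rw [← depressed, one_pow, one_mul] at h3
  set D := (n + 1) * 2 ^ n * (|G 0| ^ n * B) with hD
  have hD0 : 0 ≤ D := by positivity
  calc |(depressed G).coef i| ≤ D * Y ^ i := h3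
    _ < (D + 1) * Y ^ i := by
      have : 0 < Y ^ i := by positivity
      nlinarith
    _ ≤ (D + 1) ^ i * Y ^ i := by
      gcongr
      exact le_self_pow₀ (by linarith) (by omega)
    _ = ((D + 1) * Y) ^ i := (mul_pow _ _ _).symm
    _ ≤ X ^ i := by gcongr

end Height

/-! ### Counting translation classes -/

section Counting

open Filter

/-- An interval of length `2R` contains about `2R / |B|` members of an arithmetic progression with
difference `B`. -/
theorem exists_progression_in_interval (A : ℤ) {B : ℤ} (hB : B ≠ 0) (x R : ℝ) :
    ∃ s : Finset ℤ, (∀ m ∈ s, (∃ g, m = A + B * g) ∧ |(m : ℝ) - x| ≤ R) ∧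
      2 * (R / |(B : ℝ)|) - 1 ≤ s.card := by
  have hB' : (B : ℝ) ≠ 0 := by exact_mod_cast hB
  have hBpos : 0 < |(B : ℝ)| := abs_pos.2 hB'
  set y : ℝ := (x - A) / B with hy
  set ρ : ℝ := R / |(B : ℝ)| with hρ
  refine ⟨(Finset.Icc ⌈y - ρ⌉ ⌊y + ρ⌋).image (fun g => A + B * g), ?_, ?_⟩
  · intro m hm
    obtain ⟨g, hg, rfl⟩ := Finset.mem_image.1 hm
    refine ⟨⟨g, rfl⟩, ?_⟩
    obtain ⟨h1, h2⟩ := Finset.mem_Icc.1 hg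
    have h3 : |(g : ℝ) - y| ≤ ρ := by
      rw [abs_le]
      constructor <;> linarith [Int.ceil_le.1 h1, Int.le_floor.1 h2]
    have h4 : ((A + B * g : ℤ) : ℝ) - x = B * (g - y) := by
      rw [hy]
      push_cast
      field_simp
      ring
    rw [h4, abs_mul]
    calc |(B : ℝ)| * |g - y| ≤ |(B : ℝ)| * ρ := by gcongr
      _ = R := by rw [hρ]; field_simp
  · rw [Finset.card_image_of_injective _ fun a b h =>
      mul_left_cancel₀ hB (add_left_cancel h), Int.card_Icc]
    have h1 : ((⌊y + ρ⌋ + 1 - ⌈y - ρ⌉ : ℤ) : ℝ) ≤ ((⌊y + ρ⌋ + 1 - ⌈y - ρ⌉).toNat : ℝ) := by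
      exact_mod_cast Int.self_le_toNat _
    refine le_trans ?_ h1
    push_cast
    linarith [Int.lt_floor_add_one (y + ρ), Int.ceil_lt_add_one (y - ρ)]

/-- Densities multiply: if in each coordinate the lower set `P` has positive density in the upper
set `Q`, so does the product. -/
theorem exists_boxes {ι : Type*} [Fintype ι] [DecidableEq ι] (P Q : ι → ℝ → ℤ → Prop)
    (h : ∀ i, ∃ c : ℝ, 0 < c ∧ ∀ᶠ X : ℝ in atTop, ∃ l u : Finset ℤ, c * u.card ≤ l.card ∧
      l.Nonempty ∧ (∀ m ∈ l, P i X m) ∧ ∀ m, Q i X m → m ∈ u) :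
    ∃ c : ℝ, 0 < c ∧ ∀ᶠ X : ℝ in atTop, ∃ L U : Finset (ι → ℤ), c * U.card ≤ L.card ∧
      L.Nonempty ∧ (∀ F ∈ L, ∀ i, P i X (F i)) ∧ ∀ F : ι → ℤ, (∀ i, Q i X (F i)) → F ∈ U := by
  choose c hc0 hc using h
  refine ⟨∏ i, c i, Finset.prod_pos fun i _ => hc0 i, ?_⟩
  filter_upwards [eventually_all.2 hc] with X hX
  choose l u h1 h2 h3 h4 using hX
  refine ⟨Fintype.piFinset l, Fintype.piFinset u, ?_, Fintype.piFinset_nonempty.2 h2, ?_, ?_⟩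
  · rw [Fintype.card_piFinset, Fintype.card_piFinset]
    push_cast
    rw [← Finset.prod_mul_distrib]
    exact Finset.prod_le_prod (fun i _ => by have := hc0 i; positivity) fun i _ => h1 i
  · intro F hF i
    exact h3 i _ (Fintype.mem_piFinset.1 hF i)
  · intro F hF
    exact Fintype.mem_piFinset.2 fun i => h4 i _ (hF i)

/-- In one coordinate, an arithmetic progression has positive density in an interval of length
`O(X^i)` around a point of size `O(X^i)`. -/
theorem exists_coordinate_sets (A : ℤ) {B : ℤ} (hB : B ≠ 0) {i : ℕ} (hi : 1 ≤ i) (x : ℝ → ℝ)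
    {r C : ℝ} (hr : 0 < r) (hC : 0 ≤ C) :
    ∃ c : ℝ, 0 < c ∧ ∀ᶠ X : ℝ in atTop, ∃ l u : Finset ℤ, c * u.card ≤ l.card ∧ l.Nonempty ∧
      (∀ m ∈ l, (∃ g, m = A + B * g) ∧ |(m : ℝ) - x X| ≤ r * X ^ i) ∧
      ∀ m : ℤ, |(m : ℝ)| ≤ C * X ^ i → m ∈ u := by
  have hB' : 0 < |(B : ℝ)| := abs_pos.2 (by exact_mod_cast hB)
  set ρ := r / |(B : ℝ)| with hρ
  have hρ0 : 0 < ρ := by positivity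
  refine ⟨ρ / (2 * C + 1), by positivity, ?_⟩
  filter_upwards [eventually_ge_atTop 1, eventually_ge_atTop (1 / ρ)] with X hX1 hX2
  have hXi1 : 1 ≤ X ^ i := one_le_pow₀ hX1
  have hXi : 1 ≤ ρ * X ^ i := by
    rw [div_le_iff₀ hρ0] at hX2
    have : X ≤ X ^ i := le_self_pow₀ hX1 (by omega)
    nlinarith
  obtain ⟨l, hl, hcard⟩ := exists_progression_in_interval A hB (x X) (r * X ^ i)
  have hcard' : ρ * X ^ i ≤ l.card := by
    have : r * X ^ i / |(B : ℝ)| = ρ * X ^ i := by rw [hρ]; ring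
    rw [this] at hcard
    linarith
  refine ⟨l, Finset.Icc (-⌊C * X ^ i⌋) ⌊C * X ^ i⌋, ?_, ?_, hl, ?_⟩
  · rw [Int.card_Icc]
    have hfl : 0 ≤ ⌊C * X ^ i⌋ := Int.floor_nonneg.2 (by positivity)
    have h1 : (((⌊C * X ^ i⌋ + 1 - -⌊C * X ^ i⌋).toNat : ℤ) : ℝ) = 2 * ⌊C * X ^ i⌋ + 1 := by
      rw [Int.toNat_of_nonneg (by omega)]
      push_cast
      ring
    rw [Int.cast_natCast] at h1
    rw [h1]
    have h2 : (2 * (⌊C * X ^ i⌋ : ℝ) + 1) ≤ (2 * C + 1) * X ^ i := by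
      have := Int.floor_le (C * X ^ i)
      nlinarith
    calc ρ / (2 * C + 1) * (2 * (⌊C * X ^ i⌋ : ℝ) + 1)
        ≤ ρ / (2 * C + 1) * ((2 * C + 1) * X ^ i) := by gcongr
      _ = ρ * X ^ i := by field_simp
      _ ≤ _ := hcard'
  · rw [← Finset.card_pos]
    have : (0 : ℝ) < l.card := by linarith
    exact_mod_cast this
  · intro m hm
    rw [abs_le] at hm
    rw [Finset.mem_Icc]
    constructor
    · have : -m ≤ ⌊C * X ^ i⌋ := Int.le_floor.2 (by push_cast; linarith [hm.1])
      linarith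
    · exact Int.le_floor.2 hm.2

variable {n : ℕ} {f₀ k : ℤ} {r₁ r₂ : ℕ}

/-- Forms with coefficients near those of the stable real form, with second coefficient `1` and in
suitable residue classes, belong to the family and have an inverse different that is a square class,
while their ring is not maximal. -/
theorem mem_target_of_near (hn3 : 3 ≤ n) (hn : Odd n) (hf₀ : Odd f₀) {t : ℤ}
    (hkt : f₀ = k * t ^ 2) (hr : r₁ + 2 * r₂ = n) {a : ℕ → ℝ} {ε : ℝ} (ha1 : a 1 = 0)
    {Y : ℝ} (hεY : 1 ≤ ε * Y)
    (hstable : ∀ f : ℝ[X], f.Monic →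
      f.natDegree = n → (∀ i, 1 ≤ i → i ≤ n → |f.coeff (n - i) - a i * Y ^ i| ≤ ε * Y ^ i) →
      f.Separable ∧ ∃ (x : Fin r₁ → ℝ) (z : Fin r₂ → ℂ), (∀ j, (z j).im ≠ 0) ∧
        f = (∏ i, (X - C (x i))) *
          ∏ j, (X ^ 2 - C (2 * (z j).re) * X + C (Complex.normSq (z j))))
    {F : BinaryForm ℤ n} (hF0 : F 0 = f₀) (hF1 : F.coef 1 = 1)
    (hFi : ∀ i, 2 ≤ i → i < n → 2 * f₀ ∣ F.coef i)
    (hFn : ∃ g, F.coef n = 4 * k * (1 + k * g))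
    (hnear : ∀ i, 2 ≤ i → i ≤ n → |(F.coef i : ℝ) - f₀ * a i * Y ^ i| ≤ |(f₀ : ℝ)| * ε * Y ^ i) :
    F ∈ {F ∈ primForms n f₀ r₁ r₂ | ¬ F.IsMaximal ℚ ∧ F.InverseDifferentIsSquare} := by
  obtain ⟨g, hg⟩ := hFn
  have hf0 : f₀ ≠ 0 := by rintro rfl; exact absurd hf₀ (by decide)
  have h0 : F 0 ≠ 0 := by rwa [hF0]
  have hfR : (f₀ : ℝ) ≠ 0 := by exact_mod_cast hf0
  have hf1 : (1 : ℝ) ≤ |(f₀ : ℝ)| := by exact_mod_cast Int.one_le_abs hf0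
  have hfpos : 0 < |(f₀ : ℝ)| := by linarith
  set f : ℝ[X] := C (f₀ : ℝ)⁻¹ * dehomog (F.map (Int.castRingHom ℝ)) with hf
  have hcoeff : ∀ i ≤ n, f.coeff (n - i) = (f₀ : ℝ)⁻¹ * F.coef i := by
    intro i hi
    rw [hf, coeff_C_mul, coeff_dehomog _ hi, coef_map, eq_intCast]
  have hfdeg' : f.natDegree ≤ n := (natDegree_C_mul_le _ _).trans (natDegree_dehomog_le _)
  have hlead : f.coeff n = 1 := by
    have := hcoeff 0 (Nat.zero_le n)
    rw [Nat.sub_zero, coef_zero, hF0, inv_mul_cancel₀ hfR] at this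
    exact this
  have hmonic : f.Monic := monic_of_natDegree_le_of_coeff_eq_one n hfdeg' hlead
  have hfdeg : f.natDegree = n :=
    le_antisymm hfdeg' (le_natDegree_of_ne_zero (by rw [hlead]; exact one_ne_zero))
  have hback : dehomog (F.map (Int.castRingHom ℝ)) = C (f₀ : ℝ) * f := by
    rw [hf, ← mul_assoc, ← map_mul, mul_inv_cancel₀ hfR, map_one, one_mul]
  obtain ⟨hsep, x, z, hz, hfac⟩ := hstable f hmonic hfdeg (by
    intro i h1 hi
    rw [hcoeff i hi]
    rcases h1.eq_or_lt with rfl | h2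
    · rw [hF1, ha1, pow_one, Int.cast_one, mul_one, zero_mul, sub_zero, abs_inv]
      exact (inv_le_one_of_one_le₀ hf1).trans hεY
    · have e : (f₀ : ℝ)⁻¹ * F.coef i - a i * Y ^ i =
          (f₀ : ℝ)⁻¹ * ((F.coef i : ℝ) - f₀ * a i * Y ^ i) := by field_simp
      rw [e, abs_mul, abs_inv, inv_mul_le_iff₀ hfpos, ← mul_assoc]
      exact hnear i h2 hi)
  have hs : F.IsSeparable ℚ := by
    rw [IsSeparable, ← separable_map (algebraMap ℚ ℝ), Polynomial.map_map,
      RingHom.ext_int ((algebraMap ℚ ℝ).comp (algebraMap ℤ ℚ)) (Int.castRingHom ℝ),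
      ← dehomog_map, hback]
    exact hsep.unit_mul ((IsUnit.mk0 _ hfR).map C)
  have hr1 : 0 < r₁ := by
    rcases Nat.eq_zero_or_pos r₁ with h | h
    · obtain ⟨c, hc⟩ := hn; omega
    · exact h
  rw [← hF0] at hf₀ hkt hFi
  refine ⟨⟨hF0, hs, isPrimitive_of_coef_one (by omega) hF1, ?_⟩, ?_, ?_⟩
  · exact hasSignature_of_factorization hr hr1 _ (f₀ : ℝ) x z hz (by rw [hback, hfac])
  · exact not_isMaximal_of_congruences hn3 h0 hF1 hFi hg
  · exact inverseDifferentIsSquare_of_congruences hn3 hn hs hf₀ hkt hF1 hFi hg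

/-- A positive proportion of the translation classes of height less than `X` consists of classes of
non-maximal forms whose inverse different is a square class. -/
theorem exists_pos_proportion (hn3 : 3 ≤ n) (hn : Odd n) (hf₀ : Odd f₀)
    (hk : IsSquarefreePart k f₀) (hr : r₁ + 2 * r₂ = n) :
    ∃ c : ℝ, 0 < c ∧ ∀ᶠ X : ℝ in atTop,
      (classesBelow (primForms n f₀ r₁ r₂) X).Finite ∧
      (classesBelow (primForms n f₀ r₁ r₂) X).Nonempty ∧
      c * ((classesBelow (primForms n f₀ r₁ r₂) X).ncard : ℝ) ≤
        ((classesBelow {F ∈ primForms n f₀ r₁ r₂ |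
          ¬ F.IsMaximal ℚ ∧ F.InverseDifferentIsSquare} X).ncard : ℝ) := by
  obtain ⟨-, t, hkt⟩ := hk
  have hf0 : f₀ ≠ 0 := by rintro rfl; exact absurd hf₀ (by decide)
  have hk0 : k ≠ 0 := by rintro rfl; rw [zero_mul] at hkt; exact hf0 hkt
  have hf1 : (1 : ℝ) ≤ |(f₀ : ℝ)| := by exact_mod_cast Int.one_le_abs hf0
  have hn0 : (0 : ℝ) < n := by exact_mod_cast (by omega : 0 < n)
  obtain ⟨a, ε, hε, ha1, hstable⟩ :=
    exists_stable_coefficients (r₁ := r₁) (r₂ := r₂) (by omega) hr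
  set b : ℝ := 1 + ε + ∑ i ∈ Finset.range (n + 1), |a i| with hb
  have hsum0 : 0 ≤ ∑ i ∈ Finset.range (n + 1), |a i| := Finset.sum_nonneg fun _ _ => abs_nonneg _
  have hb1 : 1 ≤ b := by linarith
  have hab : ∀ i ≤ n, |a i| + ε ≤ b := by
    intro i hi
    have := Finset.single_le_sum (f := fun i => |a i|) (fun i _ => abs_nonneg _)
      (Finset.mem_range.2 (by omega : i < n + 1))
    linarith
  -- the roots are placed at scale `η X`; a small `η` keeps the height below `X`
  set D : ℝ := (n + 1) * 2 ^ n * (|(f₀ : ℝ)| ^ n * b) with hD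
  have hD0 : 0 ≤ D := by positivity
  set η : ℝ := 1 / (D + 1) with hη
  have hη0 : 0 < η := by positivity
  set E : ℝ := (n + 1) * (|(f₀ : ℝ)| ^ n * 2 ^ n) with hE
  have hE0 : 0 ≤ E := by positivity
  -- conditions on the coefficients of the forms that are constructed
  set P : Fin (n + 1) → ℝ → ℤ → Prop := fun i X m =>
    ((i : ℕ) = 0 → m = f₀) ∧ ((i : ℕ) = 1 → m = 1) ∧
    (2 ≤ (i : ℕ) → (∃ g, m = (if (i : ℕ) < n then 0 else 4 * k) +
      (if (i : ℕ) < n then 2 * f₀ else 4 * k * k) * g) ∧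
      |(m : ℝ) - f₀ * a i * (η * X) ^ (i : ℕ)| ≤ (|(f₀ : ℝ)| * ε * η ^ (i : ℕ)) * X ^ (i : ℕ))
    with hP
  -- conditions that some representative of every orbit below `X` satisfies
  set Q : Fin (n + 1) → ℝ → ℤ → Prop := fun i X m =>
    ((i : ℕ) = 0 → m = f₀) ∧ ((i : ℕ) = 1 → 0 ≤ m ∧ m < n * |f₀|) ∧
    (2 ≤ (i : ℕ) → |(m : ℝ)| ≤ E * X ^ (i : ℕ)) with hQ
  obtain ⟨c, hc0, hc⟩ := exists_boxes P Q (by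
    intro i
    rcases Nat.lt_or_ge (i : ℕ) 2 with h2 | h2
    · rcases Nat.eq_zero_or_pos (i : ℕ) with hi0 | hi0
      · refine ⟨1, one_pos, Eventually.of_forall fun X => ⟨{f₀}, {f₀}, by simp, by simp, ?_, ?_⟩⟩
        · intro m hm
          exact ⟨fun _ => Finset.mem_singleton.1 hm, fun h => by omega, fun h => by omega⟩
        · intro m hm
          exact Finset.mem_singleton.2 (hm.1 hi0)
      · have hN : 0 < (n : ℝ) * |(f₀ : ℝ)| := by positivity
        refine ⟨1 / ((n : ℝ) * |(f₀ : ℝ)|), by positivity, Eventually.of_forall fun X =>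
          ⟨{1}, Finset.Ico 0 (n * |f₀|), ?_, by simp, ?_, ?_⟩⟩
        · rw [Int.card_Ico, Finset.card_singleton, sub_zero]
          have h3 : (((n * |f₀| : ℤ).toNat : ℤ) : ℝ) = n * |(f₀ : ℝ)| := by
            rw [Int.toNat_of_nonneg (by positivity)]
            push_cast
            rfl
          rw [Int.cast_natCast] at h3
          rw [h3, one_div, inv_mul_cancel₀ hN.ne', Nat.cast_one]
        · intro m hm
          exact ⟨fun h => by omega, fun _ => Finset.mem_singleton.1 hm, fun h => by omega⟩
        · intro m hm
          exact Finset.mem_Ico.2 (hm.2.1 (by omega))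
    · have hB : (if (i : ℕ) < n then 2 * f₀ else 4 * k * k) ≠ 0 := by
        split_ifs
        · exact mul_ne_zero two_ne_zero hf0
        · exact mul_ne_zero (mul_ne_zero (by norm_num) hk0) hk0
      obtain ⟨c, hc0, hc⟩ := exists_coordinate_sets (if (i : ℕ) < n then 0 else 4 * k) hB
        (by omega : 1 ≤ (i : ℕ)) (fun X => f₀ * a i * (η * X) ^ (i : ℕ))
        (r := |(f₀ : ℝ)| * ε * η ^ (i : ℕ)) (by positivity) hE0
      refine ⟨c, hc0, hc.mono fun X hX => ?_⟩
      obtain ⟨l, u, h3, h4, h5, h6⟩ := hX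
      exact ⟨l, u, h3, h4, fun m hm => ⟨fun h => by omega, fun h => by omega, fun _ => h5 m hm⟩,
        fun m hm => h6 m (hm.2.2 h2)⟩)
  refine ⟨c, hc0, ?_⟩
  filter_upwards [hc, eventually_ge_atTop 1, eventually_ge_atTop (1 / η),
    eventually_ge_atTop (1 / (ε * η))] with X hX hX1 hXη hXε
  obtain ⟨L, U, hcard, hLne, hL, hU⟩ := hX
  have hX0 : 0 < X := by linarith
  set Y := η * X with hYdef
  have hY1 : 1 ≤ Y := by rw [div_le_iff₀ hη0] at hXη; linarith
  have hεY : 1 ≤ ε * Y := by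
    rw [div_le_iff₀ (by positivity)] at hXε
    calc 1 ≤ X * (ε * η) := hXε
      _ = ε * Y := by rw [hYdef]; ring
  set T : Set (BinaryForm ℤ n) := {F ∈ primForms n f₀ r₁ r₂ |
    ¬ F.IsMaximal ℚ ∧ F.InverseDifferentIsSquare} with hT
  -- the orbits below `X` all meet the upper box
  have hsub : classesBelow (primForms n f₀ r₁ r₂) X ⊆ orbit '' (U : Set (BinaryForm ℤ n)) := by
    rintro _ ⟨F, ⟨hF, hFh⟩, rfl⟩
    have hF0 : F 0 = f₀ := hF.1
    obtain ⟨s, hs0, hs1, hs2, hs3⟩ :=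
      exists_reduced_translate (by omega) (by rwa [hF0]) hX1 hFh
    refine ⟨translate s F, hU _ fun i => ?_, orbit_translate s F⟩
    rw [hF0] at hs0 hs2 hs3
    have hi := coef_of_lt (translate s F) i
    refine ⟨fun h => ?_, fun h => ?_, fun h => ?_⟩
    · rw [← hi, h, coef_zero, hs0]
    · rw [← hi, h]; exact ⟨hs1, hs2⟩
    · rw [← hi]; exact hs3 i h (by omega)
  have hfin : (classesBelow (primForms n f₀ r₁ r₂) X).Finite :=
    (U.finite_toSet.image _).subset hsub
  have hle : (classesBelow (primForms n f₀ r₁ r₂) X).ncard ≤ U.card := by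
    refine (Set.ncard_le_ncard hsub (U.finite_toSet.image _)).trans ?_
    refine (Set.ncard_image_le U.finite_toSet).trans ?_
    rw [Set.ncard_coe_finset]
  -- the forms in the lower box are distinct representatives of good orbits
  have hLmem : ∀ F : BinaryForm ℤ n, F ∈ L → F 0 = f₀ ∧ F.coef 1 = 1 ∧ F ∈ T ∧
      ((F.map (Int.castRingHom ℝ)).height : ℝ) < X := by
    intro F hF
    have hPF := hL F hF
    have hF0 : F 0 = f₀ := (hPF 0).1 rfl
    have hF1 : F.coef 1 = 1 := by
      have h1 := (hPF ⟨1, by omega⟩).2.1 rfl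
      rwa [← coef_of_lt F] at h1
    have hFi : ∀ i, 2 ≤ i → i ≤ n → (∃ g, F.coef i = (if i < n then 0 else 4 * k) +
        (if i < n then 2 * f₀ else 4 * k * k) * g) ∧
        |(F.coef i : ℝ) - f₀ * a i * Y ^ i| ≤ |(f₀ : ℝ)| * ε * Y ^ i := by
      intro i h2 hi
      have h1 := (hPF ⟨i, by omega⟩).2.2 h2
      rw [← coef_of_lt F] at h1
      refine ⟨h1.1, h1.2.trans_eq ?_⟩
      rw [hYdef, mul_pow, mul_assoc]
    refine ⟨hF0, hF1, ?_, ?_⟩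
    · refine mem_target_of_near hn3 hn hf₀ hkt hr ha1 hεY
        (fun f hf1 hf2 hf3 => hstable Y f (by linarith) hf1 hf2 hf3) hF0 hF1 ?_ ?_
        fun i h2 hi => (hFi i h2 hi).2
      · intro i h2 hi
        obtain ⟨g, hg⟩ := (hFi i h2 hi.le).1
        rw [if_pos hi, if_pos hi, zero_add] at hg
        exact ⟨g, hg⟩
      · obtain ⟨g, hg⟩ := (hFi n (by omega) le_rfl).1
        rw [if_neg (lt_irrefl n), if_neg (lt_irrefl n)] at hg
        exact ⟨g, by rw [hg]; ring⟩
    · have hG0 : (F.map (Int.castRingHom ℝ)) 0 = f₀ := by simp [map, hF0]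
      refine height_lt_of_coef_le (by omega) (by rwa [hG0]) (by rw [coef_map, hF1]; simp)
        (by linarith : 0 ≤ b) hY1 hX0 ?_ ?_
      · intro i hi
        rw [hG0, coef_map, eq_intCast]
        have hfb : 1 ≤ |(f₀ : ℝ)| * b := one_le_mul_of_one_le_of_one_le hf1 hb1
        rcases Nat.lt_or_ge i 2 with h | h
        · interval_cases i
          · rw [coef_zero, hF0, pow_zero, mul_one]
            exact le_mul_of_one_le_right (abs_nonneg _) hb1
          · rw [hF1, Int.cast_one, abs_one, pow_one]
            exact one_le_mul_of_one_le_of_one_le hfb hY1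
        · have h1 := (hFi i h hi).2
          have h2 := hab i hi
          calc |(F.coef i : ℝ)| = |((F.coef i : ℝ) - f₀ * a i * Y ^ i) + f₀ * a i * Y ^ i| := by
                rw [sub_add_cancel]
            _ ≤ |(f₀ : ℝ)| * ε * Y ^ i + |(f₀ : ℝ)| * |a i| * Y ^ i := by
                refine (abs_add_le _ _).trans (add_le_add h1 (le_of_eq ?_))
                rw [abs_mul, abs_mul, abs_pow, abs_of_nonneg (by linarith : 0 ≤ Y)]
            _ = |(f₀ : ℝ)| * (|a i| + ε) * Y ^ i := by ring
            _ ≤ |(f₀ : ℝ)| * b * Y ^ i := by gcongr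
      · rw [hG0, ← hD, hYdef, hη]
        refine le_of_eq ?_
        field_simp
  have hTsub : classesBelow T X ⊆ classesBelow (primForms n f₀ r₁ r₂) X := by
    rintro _ ⟨F, ⟨hF, hFh⟩, rfl⟩
    exact ⟨F, ⟨hF.1, hFh⟩, rfl⟩
  have hLsub : orbit '' (L : Set (BinaryForm ℤ n)) ⊆ classesBelow T X := by
    rintro _ ⟨F, hF, rfl⟩
    obtain ⟨-, -, h3, h4⟩ := hLmem F hF
    exact ⟨F, ⟨h3, h4⟩, rfl⟩
  have hinj : Set.InjOn orbit (L : Set (BinaryForm ℤ n)) := by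
    intro F hF F' hF' heq
    obtain ⟨h1, h2, -, -⟩ := hLmem F hF
    obtain ⟨h1', h2', -, -⟩ := hLmem F' hF'
    have hmem : F' ∈ orbit F := by rw [heq]; exact mem_orbit_self F'
    obtain ⟨s, hs⟩ := hmem
    simp only at hs
    -- translation by `s` adds `n s f_0` to the second coefficient
    have h5 : (translate s F).coef 1 = 1 := by rw [hs, h2']
    rw [coef_translate_one (by omega), h2, coef_zero, h1] at h5
    have h6 : (n : ℤ) * s * f₀ = 0 := by linarith
    have h7 : s = 0 := by
      rcases mul_eq_zero.1 h6 with h | h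
      · rcases mul_eq_zero.1 h with h | h
        · exact absurd h (by exact_mod_cast (by omega : n ≠ 0))
        · exact h
      · exact absurd h hf0
    rw [← hs, h7, translate_zero]
  have hge : L.card ≤ (classesBelow T X).ncard := by
    rw [← Set.ncard_coe_finset, ← hinj.ncard_image]
    exact Set.ncard_le_ncard hLsub (hfin.subset hTsub)
  refine ⟨hfin, ?_, ?_⟩
  · obtain ⟨F, hF⟩ := hLne
    exact ⟨orbit F, hTsub (hLsub ⟨F, hF, rfl⟩)⟩
  · calc c * ((classesBelow (primForms n f₀ r₁ r₂) X).ncard : ℝ) ≤ c * U.card := by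
          gcongr
      _ ≤ L.card := hcard
      _ ≤ _ := by exact_mod_cast hge

end Counting

end BinaryForm

end

theorem mainTheorem4 (n : ℕ) (hn3 : 3 ≤ n) (hn : Odd n) (f₀ : ℤ) (hf₀ : Odd f₀)
    (k : ℤ) (hk : IsSquarefreePart k f₀) (r₁ r₂ : ℕ) (hr : r₁ + 2 * r₂ = n) :
    (∀ F ∈ BinaryForm.primForms n f₀ r₁ r₂,
      (∀ (p : ℕ) [Fact p.Prime], (p : ℤ) ∣ f₀ →
        F.map (Int.castRingHom ℤ_[p]) ∈ BinaryForm.maxFormsPadic p n (f₀ : ℤ_[p])) →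
      (∀ (p : ℕ) [Fact p.Prime], (p : ℤ) ∣ k →
        BinaryForm.IsSquareful p (F.map (Int.castRingHom ℤ_[p]))) →
      F.InverseDifferentIsSquare) ∧
    ∃ c : ℝ, 0 < c ∧ ∀ᶠ X : ℝ in Filter.atTop,
      (BinaryForm.classesBelow (BinaryForm.primForms n f₀ r₁ r₂) X).Finite ∧
      (BinaryForm.classesBelow (BinaryForm.primForms n f₀ r₁ r₂) X).Nonempty ∧
      c * ((BinaryForm.classesBelow (BinaryForm.primForms n f₀ r₁ r₂) X).ncard : ℝ) ≤
        ((BinaryForm.classesBelow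
          {F ∈ BinaryForm.primForms n f₀ r₁ r₂ |
            ¬ F.IsMaximal ℚ ∧ F.InverseDifferentIsSquare} X).ncard : ℝ) := by
  have hf0 : f₀ ≠ 0 := by rintro rfl; exact absurd hf₀ (by decide)
  refine ⟨?_, BinaryForm.exists_pos_proportion hn3 hn hf₀ hk hr⟩
  rintro F ⟨hF0, hs, hF, -⟩ hmax hsq
  rw [← hF0] at hk hf0 hmax
  exact BinaryForm.inverseDifferentIsSquare_of_isSquareful hn3 hn hf0 hs hF hk
    (fun p _ hp => (hmax p hp).2.2.2) hsq
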